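/- **Conventions.** A finite double groupoid $\mathcal T$ consists of finite nonempty sets $\mathcal B$ (boxes), $\mathcal H$ (horizontal edges), $\mathcal V$ (vertical edges), $\mathcal P$ (points) and four groupoid structures: $\mathcal B\rightrightarrows\mathcal H$ (source = top $t$, target = bottom $b$; composition $\begin{smallmatrix}A\\ C\end{smallmatrix}$ of boxes with $b(A)=t(C)$), $\mathcal B\rightrightarrows\mathcal V$ (source = left $l$, target = right $r$; composition $AC$ of boxes with $r(A)=l(C)$), $\mathcal H\rightrightarrows\mathcal P$ (source $l$, target $r$) and $\mathcal V\rightrightarrows\mathcal P$ (source $t$, target $b$), such that the corners of a box agree ($tl=lt$, $tr=rt$, $bl=lb$, $br=rb$), $t,b:\mathcal B\to\mathcal H$ and $l,r:\mathcal B\to\mathcal V$ preserve compositions and identities, the identity maps $\mathcal H\to\mathcal B$, $\mathcal V\to\mathcal B$ preserve compositions and agree on the identities of points, and the interchange law $\begin{smallmatrix}AC\\ DE\end{smallmatrix}=\bigl(\begin{smallmatrix}A\\ D\end{smallmatrix}\bigr)\bigl(\begin{smallmatrix}C\\ E\end{smallmatrix}\bigr)$ holds whenever all compositions are defined. It is *vacant*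 if for all $x\in\mathcal H$, $g\in\mathcal V$ with $r(x)=t(g)$ there is exactly one box with top $x$ and right side $g$. Let $\Bbbk$ be a field. A *normalized 2-cocycle* on $\mathcal T$ with values in $\Bbbk^\times$ is a pair $(\sigma,\tau)$, where $\sigma$ is a normalized 2-cocycle on the groupoid $\mathcal B\rightrightarrows\mathcal H$ (a function $\sigma(A,C)\in\Bbbk^\times$ of vertically composable pairs, equal to $1$ if one argument is a vertical identity, with $\sigma(A,C)\,\sigma(\begin{smallmatrix}A\\ C\end{smallmatrix},D)=\sigma(C,D)\,\sigma(A,\begin{smallmatrix}C\\ D\end{smallmatrix})$), $\tau$ is likewise a normalized 2-cocycle on $\mathcal B\rightrightarrows\mathcal V$, and $$\sigma(AC,DE)\,\tau\bigl(\begin{smallmatrix}A\\ D\end{smallmatrix},\begin{smallmatrix}C\\ E\end{smallmatrix}\bigr)=\tau(A,C)\,\tau(D,E)\,\sigma(A,D)\,\sigma(C,E)$$ for all composable $2\times2$ arrangements $\begin{smallmatrix}A&C\\ D&E\end{smallmatrix}$. For a finite vacant double groupoid $\mathcal T$ and a normalized 2-cocycle $(\sigma,\tau)$, let $\Bbbk^\tau_\sigma\mathcal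 T$ be the weak bialgebra over $\Bbbk$ with basis $\mathcal B$, multiplication $A\cdot C=\sigma(A,C)\begin{smallmatrix}A\\ C\end{smallmatrix}$ if $b(A)=t(C)$ and $0$ otherwise, unit the sum of all vertical identities (the identities of $\mathcal B\rightrightarrows\mathcal H$), comultiplication $\Delta(A)=\sum_{XY=A}\tau(X,Y)\,X\otimes Y$ (sum over the horizontally composable pairs with $XY=A$), and counit $\varepsilon(A)=1$ if $A$ is a horizontal identity (an identity of $\mathcal B\rightrightarrows\mathcal V$) and $0$ otherwise. Let $\operatorname{Rep}\Bbbk^\tau_\sigma\mathcal T$ be the category of its finite-dimensional modules, with the monoidal structure $X\otimes Y:=\Delta(1)(X\otimes_{\Bbbk}Y)$, on which $h$ acts through $\Delta(h)$; the associativity constraint is that of vector spaces, and the unit object is the target subalgebra, i.e. the image of $\varepsilon_t(h)=(\varepsilon\otimes\mathrm{id})(\Delta(1)(h\otimes1))$, with action $h\cdot z=\varepsilon_t(hz)$ (and the usual unit constraints $z\otimes x\mapsto zx$ and $x\otimes z\mapsto (\mathrm{id}\otimes\varepsilon)(\Delta(1)(1\otimes z))\,x$). A *multifusion category* over $\Bbbk$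 is a semisimple $\Bbbk$-linear rigid tensor category (an abelian $\Bbbk$-linear category in which every object is a finite direct sum of simple objects, with a $\Bbbk$-bilinear monoidal structure for which every object has a left and a right dual) with finitely many isomorphism classes of simple objects and finite-dimensional spaces of morphisms. It is a *fusion category* if in addition its unit object is simple. A groupoid is *connected* if there is an arrow between any two of its objects. **Proposition.** Let $\mathcal T$ be a finite vacant double groupoid, $\Bbbk$ a field, and $(\sigma,\tau)$ a normalized 2-cocycle on $\mathcal T$ with values in $\Bbbk^\times$. (i) The unit object of $\operatorname{Rep}\Bbbk^\tau_\sigma\mathcal T$ is simple if and only if the groupoid $\mathcal V\rightrightarrows\mathcal P$ is connected. (ii) If $\operatorname{char}\Bbbk=0$, then $\operatorname{Rep}\Bbbk^\tau_\sigma\mathcal T$ is a multifusion category; it is a fusion category if and only if $\mathcal V\rightrightarrows\mathcal P$ is connected. -/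

import Mathlib

open CategoryTheory
open scoped TensorProduct MonoidalCategory

universe u

noncomputable section

/-! ### Weak bialgebras -/

/-- A weak bialgebra: an algebra and a coalgebra whose comultiplication is multiplicative
(but need not preserve the unit), with the weak unit and weak counit axioms. -/
class WeakBialgebra (k A : Type u) [Field k] [Ring A] [Algebra k A] extends Coalgebra k A where
  /-- `Δ(ab) = Δ(a)Δ(b)` -/
  comul_mul : ∀ a b : A, comul (a * b) = comul a * comul b
  /-- `Δ²(1) = (Δ(1) ⊗ 1)(1 ⊗ Δ(1))` -/
  comul_comul_one : comul.lTensor A (comul (1 : A)) =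
    TensorProduct.assoc k A A A (comul (1 : A) ⊗ₜ[k] (1 : A)) * ((1 : A) ⊗ₜ[k] comul (1 : A))
  /-- `Δ²(1) = (1 ⊗ Δ(1))(Δ(1) ⊗ 1)` -/
  comul_comul_one' : comul.lTensor A (comul (1 : A)) =
    ((1 : A) ⊗ₜ[k] comul (1 : A)) * TensorProduct.assoc k A A A (comul (1 : A) ⊗ₜ[k] (1 : A))
  /-- `ε(abc) = ε(a b₁) ε(b₂ c)` -/
  counit_mul_mul : ∀ a b c : A, counit (a * b * c) = LinearMap.mul' k k
    (TensorProduct.map (counit ∘ₗ LinearMap.mulLeft k a) (counit ∘ₗ LinearMap.mulRight k c)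
      (comul b))
  /-- `ε(abc) = ε(a b₂) ε(b₁ c)` -/
  counit_mul_mul' : ∀ a b c : A, counit (a * b * c) = LinearMap.mul' k k
    (TensorProduct.map (counit ∘ₗ LinearMap.mulRight k c) (counit ∘ₗ LinearMap.mulLeft k a)
      (comul b))

namespace WeakBialgebra

open Coalgebra

variable (k A : Type u) [Field k] [Ring A] [Algebra k A] [WeakBialgebra k A]

/-- `ε ⊗ id`. -/
def counitL : A ⊗[k] A →ₗ[k] A := TensorProduct.lid k A ∘ₗ counit.rTensor A

/-- `id ⊗ ε`. -/
def counitR : A ⊗[k] A →ₗ[k] A := TensorProduct.rid k A ∘ₗ counit.lTensor A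

/-- The target map `ε_t(h) = (ε ⊗ id)(Δ(1)(h ⊗ 1))`. -/
def εt : A →ₗ[k] A :=
  counitL k A ∘ₗ LinearMap.mulLeft k (comul (1 : A)) ∘ₗ (TensorProduct.mk k A A).flip 1

/-- The map `h ↦ (id ⊗ ε)(Δ(1)(1 ⊗ h))`. -/
def εr : A →ₗ[k] A :=
  counitR k A ∘ₗ LinearMap.mulLeft k (comul (1 : A)) ∘ₗ TensorProduct.mk k A A 1

variable {A}

lemma counitL_tmul (a b : A) : counitL k A (a ⊗ₜ b) = counit (R := k) a • b := by
  simp [counitL]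

lemma counitR_tmul (a b : A) : counitR k A (a ⊗ₜ b) = counit (R := k) b • a := by
  simp [counitR]

lemma εt_apply (h : A) : εt k A h = counitL k A (comul (1 : A) * (h ⊗ₜ 1)) := rfl

lemma εr_apply (h : A) : εr k A h = counitR k A (comul (1 : A) * (1 ⊗ₜ h)) := rfl

lemma counit_mul_counitL (x b : A) (t : A ⊗[k] A) :
    counit (R := k) (x * counitL k A (t * (b ⊗ₜ 1))) = LinearMap.mul' k k
    (TensorProduct.map (counit ∘ₗ LinearMap.mulRight k b) (counit ∘ₗ LinearMap.mulLeft k x) t) := by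
  induction t with
  | zero => simp
  | add s t hs ht => rw [add_mul, map_add, mul_add, map_add, hs, ht, map_add, map_add]
  | tmul a c => simp [counitL_tmul]

lemma counit_mul_εt (x b : A) : counit (R := k) (x * εt k A b) = counit (x * b) := by
  rw [εt_apply, counit_mul_counitL, ← counit_mul_mul', mul_one]

lemma counit_εt (b : A) : counit (R := k) (εt k A b) = counit b := by
  simpa using counit_mul_εt k 1 b

lemma εt_one : εt k A 1 = 1 := by
  rw [εt_apply, ← Algebra.TensorProduct.one_def, mul_one, counitL]
  simp

lemma εr_one : εr k A 1 = 1 := by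
  rw [εr_apply, ← Algebra.TensorProduct.one_def, mul_one, counitR]
  simp

lemma εt_mul_εt (a b : A) : εt k A (a * εt k A b) = εt k A (a * b) := by
  have key : ∀ t : A ⊗[k] A, counitL k A (t * ((a * εt k A b) ⊗ₜ 1)) =
      counitL k A (t * ((a * b) ⊗ₜ 1)) := by
    intro t
    induction t with
    | zero => simp
    | add s t hs ht => simp only [add_mul, map_add, hs, ht]
    | tmul x y =>
      simp only [Algebra.TensorProduct.tmul_mul_tmul, counitL_tmul, ← mul_assoc, counit_mul_εt]
  exact key _

lemma εt_εt (b : A) : εt k A (εt k A b) = εt k A b := by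
  simpa using εt_mul_εt k 1 b

lemma counitL_comul (a : A) : counitL k A (comul a) = a := by simp [counitL]
lemma counitR_comul (a : A) : counitR k A (comul a) = a := by simp [counitR]

lemma comul_mul_comul_one (h : A) : comul (R := k) h * comul (1 : A) = comul h := by
  rw [← comul_mul, mul_one]

lemma comul_one_mul_comul (h : A) : comul (R := k) (1 : A) * comul h = comul h := by
  rw [← comul_mul, one_mul]

lemma coassoc_one : TensorProduct.assoc k A A A (comul.rTensor A (comul (1 : A))) =
    comul.lTensor A (comul (1 : A)) := coassoc_apply _

/-- `ε(h₁ b) h₂ = h ε_t(b)` -/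
lemma counitL_comul_mul (h b : A) : counitL k A (comul h * (b ⊗ₜ 1)) = h * εt k A b := by
  -- `x ⊗ y ⊗ z ↦ ε(x b) (ε ⊗ id)(t (y ⊗ z))`
  let Ψ (t : A ⊗[k] A) : A ⊗[k] (A ⊗[k] A) →ₗ[k] A :=
    TensorProduct.lid k A ∘ₗ TensorProduct.map (counit ∘ₗ LinearMap.mulRight k b)
      (counitL k A ∘ₗ LinearMap.mulLeft k t)
  have h1 : ∀ s : A ⊗[k] A, Ψ (comul h) (comul.lTensor A s) =
      h * counitL k A (s * (b ⊗ₜ 1)) := by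
    intro s
    induction s with
    | zero => simp
    | add s t hs ht => simp only [add_mul, map_add, hs, ht, mul_add]
    | tmul x y => simp [Ψ, ← comul_mul, counitL_comul, counitL_tmul]
  have h2 : ∀ t s : A ⊗[k] A, Ψ t (TensorProduct.assoc k A A A (comul.rTensor A s)) =
      counitL k A (t * s * (b ⊗ₜ 1)) := by
    intro t s
    induction s with
    | zero => simp
    | add s t hs ht => simp only [add_mul, map_add, hs, ht, mul_add]
    | tmul x y =>
      induction t with
      | zero => simp [Ψ]
      | add s t hs ht =>
        have : Ψ (s + t) = Ψ s + Ψ t := by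
          ext; simp [Ψ, add_mul, TensorProduct.tmul_add]
        simp only [this, LinearMap.add_apply, hs, ht, add_mul, map_add]
      | tmul p q =>
        simp only [Algebra.TensorProduct.tmul_mul_tmul, counitL_tmul, mul_one, counit_mul_mul',
          LinearMap.rTensor_tmul]
        generalize comul (R := k) x = r
        induction r with
        | zero => simp
        | add s t hs ht => simp only [TensorProduct.add_tmul, map_add, hs, ht, add_smul]
        | tmul c d => simp [Ψ, counitL_tmul, smul_smul, mul_comm]
  rw [← comul_mul_comul_one, ← h2, coassoc_one, h1, εt_apply]

/-- `ε(h₂ b) h₁ = h ε_r(b)` -/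
lemma counitR_comul_mul (h b : A) : counitR k A (comul h * (1 ⊗ₜ b)) = h * εr k A b := by
  let Ψ (t : A ⊗[k] A) : (A ⊗[k] A) ⊗[k] A →ₗ[k] A :=
    TensorProduct.rid k A ∘ₗ TensorProduct.map
      (counitR k A ∘ₗ LinearMap.mulLeft k t) (counit ∘ₗ LinearMap.mulRight k b)
  have h1 : ∀ s : A ⊗[k] A, Ψ (comul h) (comul.rTensor A s) =
      h * counitR k A (s * (1 ⊗ₜ b)) := by
    intro s
    induction s with
    | zero => simp
    | add s t hs ht => simp only [add_mul, map_add, hs, ht, mul_add]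
    | tmul x y => simp [Ψ, ← comul_mul, counitR_comul, counitR_tmul]
  have h2 : ∀ t s : A ⊗[k] A, Ψ t ((TensorProduct.assoc k A A A).symm (comul.lTensor A s)) =
      counitR k A (t * s * (1 ⊗ₜ b)) := by
    intro t s
    induction s with
    | zero => simp
    | add s t hs ht => simp only [add_mul, map_add, hs, ht, mul_add]
    | tmul x y =>
      induction t with
      | zero => simp [Ψ]
      | add s t hs ht =>
        have : Ψ (s + t) = Ψ s + Ψ t := by
          ext; simp [Ψ, add_mul]
        simp only [this, LinearMap.add_apply, hs, ht, add_mul, map_add]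
      | tmul p q =>
        simp only [Algebra.TensorProduct.tmul_mul_tmul, counitR_tmul, mul_one, counit_mul_mul,
          LinearMap.lTensor_tmul]
        generalize comul (R := k) y = r
        induction r with
        | zero => simp
        | add s t hs ht => simp only [TensorProduct.tmul_add, map_add, hs, ht, add_smul]
        | tmul c d => simp [Ψ, counitR_tmul, smul_smul, mul_comm]
  rw [← comul_mul_comul_one, ← h2, ← coassoc_one, LinearEquiv.symm_apply_apply, h1, εr_apply]

/-- `ε(y h₁) h₂ = ε(y 1₁) 1₂ h` -/
lemma counitL_mul_comul (y h : A) :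
    counitL k A ((y ⊗ₜ 1) * comul h) = counitL k A ((y ⊗ₜ 1) * comul (1 : A)) * h := by
  let Ψ (t : A ⊗[k] A) : A ⊗[k] (A ⊗[k] A) →ₗ[k] A :=
    TensorProduct.lid k A ∘ₗ TensorProduct.map (counit ∘ₗ LinearMap.mulLeft k y)
      (counitL k A ∘ₗ LinearMap.mulRight k t)
  have h1 : ∀ s : A ⊗[k] A, Ψ (comul h) (comul.lTensor A s) =
      counitL k A ((y ⊗ₜ 1) * s) * h := by
    intro s
    induction s with
    | zero => simp
    | add s t hs ht => simp only [add_mul, map_add, hs, ht, mul_add]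
    | tmul x y => simp [Ψ, ← comul_mul, counitL_comul, counitL_tmul]
  have h2 : ∀ t s : A ⊗[k] A, Ψ t (TensorProduct.assoc k A A A (comul.rTensor A s)) =
      counitL k A ((y ⊗ₜ 1) * (s * t)) := by
    intro t s
    induction s with
    | zero => simp
    | add s t hs ht => simp only [add_mul, map_add, hs, ht, mul_add]
    | tmul x z =>
      induction t with
      | zero => simp [Ψ]
      | add s t hs ht =>
        have : Ψ (s + t) = Ψ s + Ψ t := by
          ext; simp [Ψ, mul_add, TensorProduct.tmul_add]
        simp only [this, LinearMap.add_apply, hs, ht, mul_add, map_add]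
      | tmul p q =>
        simp only [Algebra.TensorProduct.tmul_mul_tmul, counitL_tmul, one_mul, ← mul_assoc,
          counit_mul_mul, LinearMap.rTensor_tmul]
        generalize comul (R := k) x = r
        induction r with
        | zero => simp
        | add s t hs ht => simp only [TensorProduct.add_tmul, map_add, hs, ht, add_smul]
        | tmul c d => simp [Ψ, counitL_tmul, smul_smul, mul_comm]
  rw [← comul_one_mul_comul, ← h2, coassoc_one, h1]

/-- `ε(1₁ b) (1₂ ⊗ 1₃) = 1₁ ε_t(b) ⊗ 1₂` -/
lemma comul_εt (b : A) : comul (R := k) (εt k A b) = comul (1 : A) * (εt k A b ⊗ₜ 1) := by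
  let Ψ : A ⊗[k] (A ⊗[k] A) →ₗ[k] A ⊗[k] A :=
    TensorProduct.lid k (A ⊗[k] A) ∘ₗ (counit ∘ₗ LinearMap.mulRight k b).rTensor _
  have h1 : ∀ s : A ⊗[k] A, Ψ (comul.lTensor A s) = comul (counitL k A (s * (b ⊗ₜ 1))) := by
    intro s
    induction s with
    | zero => simp
    | add s t hs ht => simp only [add_mul, map_add, hs, ht]
    | tmul x y => simp [Ψ, counitL_tmul]
  have h2 : ∀ t s : A ⊗[k] A, Ψ ((1 ⊗ₜ t) * TensorProduct.assoc k A A A (s ⊗ₜ 1)) =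
      t * (counitL k A (s * (b ⊗ₜ 1)) ⊗ₜ 1) := by
    intro t s
    induction s with
    | zero => simp
    | add s t hs ht =>
      simp only [add_mul, map_add, hs, ht, mul_add, TensorProduct.add_tmul]
    | tmul x y =>
      simp [Ψ, counitL_tmul, ← TensorProduct.smul_tmul']
  rw [εt_apply, ← h1, comul_comul_one', h2]

/-- `1₁ ⊗ ε_t(1₂ z) = 1₁ ε_r(z) ⊗ 1₂` -/
lemma lTensor_εt_comul_one (z : A) :
    (εt k A ∘ₗ LinearMap.mulRight k z).lTensor A (comul (1 : A)) =
      comul (1 : A) * (εr k A z ⊗ₜ 1) := by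
  let Ψ : A ⊗[k] (A ⊗[k] A) →ₗ[k] A ⊗[k] A :=
    (counitL k A ∘ₗ LinearMap.mulRight k (z ⊗ₜ 1)).lTensor A
  have h1 : ∀ s t : A ⊗[k] A, Ψ ((1 ⊗ₜ t) * TensorProduct.assoc k A A A (s ⊗ₜ 1)) =
      (counitL k A ∘ₗ LinearMap.mulLeft k t ∘ₗ (TensorProduct.mk k A A).flip 1 ∘ₗ
        LinearMap.mulRight k z).lTensor A s := by
    intro s t
    induction s with
    | zero => simp
    | add s t hs ht => simp only [TensorProduct.add_tmul, map_add, mul_add, hs, ht]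
    | tmul x y => simp [Ψ, mul_assoc]
  have h2 : ∀ s : A ⊗[k] A, Ψ (TensorProduct.assoc k A A A (comul.rTensor A s)) =
      s * (εr k A z ⊗ₜ 1) := by
    intro s
    induction s with
    | zero => simp
    | add s t hs ht => simp only [map_add, add_mul, hs, ht]
    | tmul x y =>
      have : ∀ r : A ⊗[k] A, Ψ (TensorProduct.assoc k A A A (r ⊗ₜ y)) =
          counitR k A (r * (1 ⊗ₜ z)) ⊗ₜ y := by
        intro r
        induction r with
        | zero => simp
        | add s t hs ht => simp only [TensorProduct.add_tmul, map_add, add_mul, hs, ht]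
        | tmul p q =>
          simp [Ψ, counitL_tmul, counitR_tmul, TensorProduct.smul_tmul']
      rw [LinearMap.rTensor_tmul, this, counitR_comul_mul]
      simp
  have h3 := h1 (comul 1) (comul 1)
  rw [← comul_comul_one', ← coassoc_one, h2] at h3
  exact h3.symm

/-- `ε_t(h₁) ⊗ h₂ = ε_t(1₁) ⊗ 1₂ h` -/
lemma rTensor_εt_comul (h : A) :
    (εt k A).rTensor A (comul h) =
      (LinearMap.mulRight k h).lTensor A ((εt k A).rTensor A (comul (1 : A))) := by
  have key : ∀ s t : A ⊗[k] A,
      (counitL k A ∘ₗ LinearMap.mulLeft k s ∘ₗ (TensorProduct.mk k A A).flip 1).rTensor A t =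
      (TensorProduct.comm k A A) ((counitL k A ∘ₗ LinearMap.mulRight k t ∘ₗ
        (TensorProduct.mk k A A).flip 1).rTensor A s) := by
    intro s t
    induction s with
    | zero => simp
    | add s s' hs hs' =>
      rw [map_add, map_add, ← hs, ← hs', ← LinearMap.add_apply, ← LinearMap.rTensor_add]
      congr 2; ext; simp [add_mul]
    | tmul p q =>
      induction t with
      | zero => simp
      | add s s' hs hs' =>
        simp only [map_add, hs, hs']
        simp [mul_add, TensorProduct.add_tmul]
      | tmul a b => simp [counitL_tmul, TensorProduct.tmul_smul, TensorProduct.smul_tmul']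
  have k2 : ∀ s : A ⊗[k] A, (TensorProduct.comm k A A) ((counitL k A ∘ₗ LinearMap.mulRight k (comul h)
      ∘ₗ (TensorProduct.mk k A A).flip 1).rTensor A s) = (LinearMap.mulRight k h).lTensor A
      ((TensorProduct.comm k A A) ((counitL k A ∘ₗ LinearMap.mulRight k (comul (1 : A))
      ∘ₗ (TensorProduct.mk k A A).flip 1).rTensor A s)) := by
    intro s
    induction s with
    | zero => simp
    | add s t hs ht => simp only [map_add, hs, ht]
    | tmul x y => simp [counitL_mul_comul k x h]
  have h1 := key (comul 1) (comul h)
  rw [k2, ← key] at h1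
  exact h1

end WeakBialgebra

/-! ### Finite-dimensional representations of an algebra -/

/-- A finite-dimensional representation of a `k`-algebra `A`. -/
structure FinRep (k A : Type u) [Field k] [Ring A] [Algebra k A] : Type (u + 1) where
  /-- the underlying vector space -/
  V : Type u
  [addCommGroup : AddCommGroup V]
  [module : Module k V]
  [finiteDimensional : FiniteDimensional k V]
  /-- the action of `A` -/
  ρ : A →ₐ[k] Module.End k V

namespace FinRep

attribute [instance] addCommGroup module finiteDimensional

section category

variable {k A : Type u} [Field k] [Ring A] [Algebra k A]

/-- `A`-linear maps. -/
@[ext]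
structure Hom (X Y : FinRep k A) : Type u where
  /-- the underlying linear map -/
  hom : X.V →ₗ[k] Y.V
  comm : ∀ (a : A) (v : X.V), hom (X.ρ a v) = Y.ρ a (hom v)

instance : Category (FinRep k A) where
  Hom X Y := Hom X Y
  id X := ⟨LinearMap.id, fun _ _ => rfl⟩
  comp f g := ⟨g.hom ∘ₗ f.hom, fun a v => by simp [f.comm, g.comm]⟩

@[ext]
lemma hom_ext {X Y : FinRep k A} {f g : X ⟶ Y} (h : f.hom = g.hom) : f = g := Hom.ext h

@[simp] lemma id_hom (X : FinRep k A) : Hom.hom (𝟙 X) = LinearMap.id := rfl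

@[simp] lemma comp_hom {X Y Z : FinRep k A} (f : X ⟶ Y) (g : Y ⟶ Z) :
    Hom.hom (f ≫ g) = g.hom ∘ₗ f.hom := rfl

variable (X Y : FinRep k A)

instance : Zero (X ⟶ Y) := ⟨⟨0, by simp⟩⟩
instance : Add (X ⟶ Y) := ⟨fun f g => ⟨f.hom + g.hom, by simp [f.comm, g.comm]⟩⟩
instance : Neg (X ⟶ Y) := ⟨fun f => ⟨-f.hom, by simp [f.comm]⟩⟩
instance : Sub (X ⟶ Y) := ⟨fun f g => ⟨f.hom - g.hom, by simp [f.comm, g.comm]⟩⟩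
instance : SMul ℕ (X ⟶ Y) := ⟨fun n f => ⟨n • f.hom, by simp [f.comm]⟩⟩
instance : SMul ℤ (X ⟶ Y) := ⟨fun n f => ⟨n • f.hom, by simp [f.comm]⟩⟩
instance : SMul k (X ⟶ Y) := ⟨fun c f => ⟨c • f.hom, by simp [f.comm]⟩⟩

variable {X Y}

lemma hom_injective : Function.Injective (fun f : X ⟶ Y => f.hom) := fun _ _ h => hom_ext h

@[simp] lemma zero_hom : Hom.hom (0 : X ⟶ Y) = 0 := rfl
@[simp] lemma add_hom (f g : X ⟶ Y) : Hom.hom (f + g) = f.hom + g.hom := rfl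
@[simp] lemma smul_hom (c : k) (f : X ⟶ Y) : Hom.hom (c • f) = c • f.hom := rfl

instance : AddCommGroup (X ⟶ Y) :=
  hom_injective.addCommGroup _ rfl (fun _ _ => rfl) (fun _ => rfl) (fun _ _ => rfl)
    (fun _ _ => rfl) (fun _ _ => rfl)

instance : Module k (X ⟶ Y) :=
  hom_injective.module k ⟨⟨fun f : X ⟶ Y => f.hom, rfl⟩, fun _ _ => rfl⟩ (fun _ _ => rfl)

instance : Preadditive (FinRep k A) where
  add_comp _ _ _ f f' g := hom_ext (LinearMap.comp_add _ _ g.hom)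
  comp_add _ _ _ f g g' := hom_ext (LinearMap.add_comp _ _ _)

instance : Linear k (FinRep k A) where
  smul_comp _ _ _ r f g := hom_ext (LinearMap.comp_smul _ _ _)
  comp_smul _ _ _ f r g := hom_ext (LinearMap.smul_comp _ _ _)

/-- An isomorphism of representations from mutually inverse linear maps. -/
def mkIso (f : X ⟶ Y) (g : Y.V →ₗ[k] X.V) (h₁ : g ∘ₗ f.hom = LinearMap.id)
    (h₂ : f.hom ∘ₗ g = LinearMap.id) : X ≅ Y where
  hom := f
  inv := ⟨g, fun a v => by
    have e₁ : ∀ x, g (f.hom x) = x := fun x => LinearMap.congr_fun h₁ x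
    have e₂ : ∀ y, f.hom (g y) = y := fun y => LinearMap.congr_fun h₂ y
    rw [← e₁ (X.ρ a (g v)), f.comm, e₂]⟩
  hom_inv_id := hom_ext h₁
  inv_hom_id := hom_ext h₂

end category

/-! ### The tensor product of representations of a weak bialgebra -/

section monoidal

open Coalgebra WeakBialgebra

variable {k A : Type u} [Field k] [Ring A] [Algebra k A]

/-- The action of `A ⊗ A` on `X ⊗ Y` (tensor product of vector spaces). -/
def act₂ (X Y : FinRep k A) : A ⊗[k] A →ₐ[k] Module.End k (X.V ⊗[k] Y.V) :=
  Module.endTensorEndAlgHom.comp (Algebra.TensorProduct.map X.ρ Y.ρ)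

@[simp] lemma act₂_tmul (X Y : FinRep k A) (a b : A) :
    act₂ X Y (a ⊗ₜ b) = TensorProduct.map (X.ρ a) (Y.ρ b) := by
  rw [act₂, AlgHom.comp_apply, Algebra.TensorProduct.map_tmul]
  exact Module.endTensorEndAlgHom_apply _ _

lemma act₂_natural {X X' Y Y' : FinRep k A} (f : X ⟶ X') (g : Y ⟶ Y') (t : A ⊗[k] A)
    (w : X.V ⊗[k] Y.V) : TensorProduct.map f.hom g.hom (act₂ X Y t w) =
      act₂ X' Y' t (TensorProduct.map f.hom g.hom w) := by
  induction w with
  | zero => simp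
  | add w w' h h' => simp only [map_add, h, h']
  | tmul x y =>
    induction t with
    | zero => simp
    | add w w' h h' => simp only [map_add, LinearMap.add_apply, h, h']
    | tmul a b => simp [f.comm, g.comm]

lemma act₂_mul_apply (X Y : FinRep k A) (s t : A ⊗[k] A) (w : X.V ⊗[k] Y.V) :
    act₂ X Y s (act₂ X Y t w) = act₂ X Y (s * t) w := by
  rw [map_mul]; rfl

/-- The action of `A ⊗ (A ⊗ A)` on `X ⊗ (Y ⊗ Z)`. -/
def act₃ (X Y Z : FinRep k A) : A ⊗[k] (A ⊗[k] A) →ₐ[k] Module.End k (X.V ⊗[k] (Y.V ⊗[k] Z.V)) :=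
  Module.endTensorEndAlgHom.comp (Algebra.TensorProduct.map X.ρ (act₂ Y Z))

lemma act₃_tmul (X Y Z : FinRep k A) (a : A) (t : A ⊗[k] A) :
    act₃ X Y Z (a ⊗ₜ t) = TensorProduct.map (X.ρ a) (act₂ Y Z t) := by
  rw [act₃, AlgHom.comp_apply, Algebra.TensorProduct.map_tmul]
  exact Module.endTensorEndAlgHom_apply _ _

variable [WeakBialgebra k A]

/-- The vector space `Δ(1)(X ⊗ Y)` underlying the tensor product of two representations. -/
def tensorSpace (X Y : FinRep k A) : Submodule k (X.V ⊗[k] Y.V) :=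
  LinearMap.range (act₂ X Y (comul (1 : A)))

/-- The projection of `X ⊗ Y` onto `Δ(1)(X ⊗ Y)` given by the action of `Δ(1)`. -/
def tensorProj (X Y : FinRep k A) : X.V ⊗[k] Y.V →ₗ[k] tensorSpace X Y :=
  (act₂ X Y (comul (1 : A))).rangeRestrict

lemma act₂_one_coe (X Y : FinRep k A) (w : tensorSpace X Y) :
    act₂ X Y (comul (1 : A)) w = w := by
  obtain ⟨_, w, rfl⟩ := w
  exact (act₂_mul_apply _ _ _ _ _).trans (by rw [comul_one_mul_comul])

/-- The tensor product of two representations: `Δ(1)(X ⊗ Y)`, on which `h` acts by `Δ(h)`. -/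
def tensor (X Y : FinRep k A) : FinRep k A where
  V := tensorSpace X Y
  ρ := AlgHom.ofLinearMap
    { toFun := fun h => tensorProj X Y ∘ₗ act₂ X Y (comul h) ∘ₗ (tensorSpace X Y).subtype
      map_add' := fun a b => by ext; simp
      map_smul' := fun c a => by ext; simp }
    (LinearMap.ext fun w => Subtype.ext (by
      change act₂ X Y (comul 1) (act₂ X Y (comul 1) w) = w
      rw [act₂_one_coe, act₂_one_coe]))
    (fun a b => LinearMap.ext fun w => Subtype.ext (by
      change act₂ X Y (comul 1) (act₂ X Y (comul (a * b)) w) = act₂ X Y (comul 1)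
        (act₂ X Y (comul a) (act₂ X Y (comul 1) (act₂ X Y (comul b) w)))
      simp only [act₂_mul_apply, ← comul_mul, one_mul]))

/-- The inclusion of `Δ(1)(X ⊗ Y)` in `X ⊗ Y`. -/
def ι (X Y : FinRep k A) : (tensor X Y).V →ₗ[k] X.V ⊗[k] Y.V := (tensorSpace X Y).subtype

/-- The projection of `X ⊗ Y` onto `Δ(1)(X ⊗ Y)`. -/
def π (X Y : FinRep k A) : X.V ⊗[k] Y.V →ₗ[k] (tensor X Y).V := tensorProj X Y

lemma ι_injective (X Y : FinRep k A) : Function.Injective (ι X Y) := Subtype.val_injective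

lemma ι_π (X Y : FinRep k A) (w : X.V ⊗[k] Y.V) : ι X Y (π X Y w) = act₂ X Y (comul (1 : A)) w :=
  rfl

lemma act₂_one_ι (X Y : FinRep k A) (w : (tensor X Y).V) :
    act₂ X Y (comul (1 : A)) (ι X Y w) = ι X Y w := act₂_one_coe X Y w

lemma π_ι (X Y : FinRep k A) (w : (tensor X Y).V) : π X Y (ι X Y w) = w :=
  ι_injective X Y (act₂_one_ι X Y w)

lemma ι_ρ (X Y : FinRep k A) (a : A) (w : (tensor X Y).V) :
    ι X Y ((tensor X Y).ρ a w) = act₂ X Y (comul a) (ι X Y w) := by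
  change act₂ X Y (comul (1 : A)) (act₂ X Y (comul a) (ι X Y w)) = _
  rw [act₂_mul_apply, comul_one_mul_comul]

/-- The tensor product of two morphisms: the restriction of `f ⊗ g`. -/
def tensorMap {X X' Y Y' : FinRep k A} (f : X ⟶ X') (g : Y ⟶ Y') : tensor X Y ⟶ tensor X' Y' where
  hom := π X' Y' ∘ₗ TensorProduct.map f.hom g.hom ∘ₗ ι X Y
  comm a v := by
    apply ι_injective
    rw [ι_ρ]
    simp only [LinearMap.comp_apply, ι_π, ι_ρ, act₂_natural, act₂_mul_apply, ← comul_mul, one_mul,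
      mul_one]

lemma ι_tensorMap {X X' Y Y' : FinRep k A} (f : X ⟶ X') (g : Y ⟶ Y') (w : (tensor X Y).V) :
    ι X' Y' ((tensorMap f g).hom w) = TensorProduct.map f.hom g.hom (ι X Y w) := by
  change act₂ X' Y' (comul (1 : A)) (TensorProduct.map f.hom g.hom (ι X Y w)) = _
  rw [← act₂_natural, act₂_one_ι]

/-! #### The associator -/

/-- `(X ⊗ Y) ⊗ Z` inside the tensor product of the three vector spaces. -/
def jL (X Y Z : FinRep k A) : (tensor (tensor X Y) Z).V →ₗ[k] (X.V ⊗[k] Y.V) ⊗[k] Z.V :=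
  (ι X Y).rTensor Z.V ∘ₗ ι (tensor X Y) Z

/-- `X ⊗ (Y ⊗ Z)` inside the tensor product of the three vector spaces. -/
def jR (X Y Z : FinRep k A) : (tensor X (tensor Y Z)).V →ₗ[k] X.V ⊗[k] (Y.V ⊗[k] Z.V) :=
  (ι Y Z).lTensor X.V ∘ₗ ι X (tensor Y Z)

/-- The projection onto `(X ⊗ Y) ⊗ Z`. -/
def pL (X Y Z : FinRep k A) : (X.V ⊗[k] Y.V) ⊗[k] Z.V →ₗ[k] (tensor (tensor X Y) Z).V :=
  π (tensor X Y) Z ∘ₗ (π X Y).rTensor Z.V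

/-- The projection onto `X ⊗ (Y ⊗ Z)`. -/
def pR (X Y Z : FinRep k A) : X.V ⊗[k] (Y.V ⊗[k] Z.V) →ₗ[k] (tensor X (tensor Y Z)).V :=
  π X (tensor Y Z) ∘ₗ (π Y Z).lTensor X.V

variable (X Y Z : FinRep k A)

lemma π_comp_ι : π X Y ∘ₗ ι X Y = LinearMap.id := LinearMap.ext (π_ι X Y)

lemma pL_jL (w) : pL X Y Z (jL X Y Z w) = w := by
  change π (tensor X Y) Z ((π X Y).rTensor Z.V ((ι X Y).rTensor Z.V (ι (tensor X Y) Z w))) = w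
  rw [← LinearMap.rTensor_comp_apply, π_comp_ι, LinearMap.rTensor_id_apply, π_ι]

lemma pR_jR (w) : pR X Y Z (jR X Y Z w) = w := by
  change π X (tensor Y Z) ((π Y Z).lTensor X.V ((ι Y Z).lTensor X.V (ι X (tensor Y Z) w))) = w
  rw [← LinearMap.lTensor_comp_apply, π_comp_ι, LinearMap.lTensor_id_apply, π_ι]

lemma lTensor_ι_act₂ (t : A ⊗[k] A) (w : X.V ⊗[k] (tensor Y Z).V) :
    (ι Y Z).lTensor X.V (act₂ X (tensor Y Z) t w) =
      act₃ X Y Z (comul.lTensor A t) ((ι Y Z).lTensor X.V w) := by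
  induction w with
  | zero => simp
  | add w w' h h' => simp only [map_add, h, h']
  | tmul x y =>
    induction t with
    | zero => simp
    | add w w' h h' => simp only [map_add, LinearMap.add_apply, h, h']
    | tmul a b =>
      simp only [act₂_tmul, TensorProduct.map_tmul, LinearMap.lTensor_tmul, act₃_tmul]
      rw [ι_ρ]

lemma rTensor_ι_act₂ (t : A ⊗[k] A) (w : (tensor X Y).V ⊗[k] Z.V) :
    TensorProduct.assoc k _ _ _ ((ι X Y).rTensor Z.V (act₂ (tensor X Y) Z t w)) =
      act₃ X Y Z (TensorProduct.assoc k _ _ _ (comul.rTensor A t))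
        (TensorProduct.assoc k _ _ _ ((ι X Y).rTensor Z.V w)) := by
  induction w with
  | zero => simp
  | add w w' h h' => simp only [map_add, h, h']
  | tmul x z =>
    induction t with
    | zero => simp
    | add w w' h h' => simp only [map_add, LinearMap.add_apply, h, h']
    | tmul a b =>
      simp only [act₂_tmul, TensorProduct.map_tmul, LinearMap.rTensor_tmul]
      rw [ι_ρ]
      generalize comul (R := k) a = r
      generalize ι X Y x = v
      induction r with
      | zero => simp
      | add w w' h h' => simp only [map_add, LinearMap.add_apply, TensorProduct.add_tmul, h, h']
      | tmul p q =>
        induction v with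
        | zero => simp
        | add w w' h h' => simp only [map_add, TensorProduct.add_tmul, h, h']
        | tmul x y => simp [act₃_tmul]

lemma jR_pR (w) : jR X Y Z (pR X Y Z w) = act₃ X Y Z (comul.lTensor A (comul (1 : A))) w := by
  change (ι Y Z).lTensor X.V (act₂ X (tensor Y Z) (comul (1 : A)) ((π Y Z).lTensor X.V w)) = _
  rw [lTensor_ι_act₂]
  generalize comul (R := k) (1 : A) = t
  induction w with
  | zero => simp
  | add w w' h h' => simp only [map_add, h, h']
  | tmul x y =>
    induction t with
    | zero => simp
    | add w w' h h' => simp only [map_add, LinearMap.add_apply, h, h']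
    | tmul a b =>
      simp only [LinearMap.lTensor_tmul, act₃_tmul, TensorProduct.map_tmul, ι_π, act₂_mul_apply,
        comul_mul_comul_one]

lemma jL_pL (w) : TensorProduct.assoc k _ _ _ (jL X Y Z (pL X Y Z w)) =
    act₃ X Y Z (comul.lTensor A (comul (1 : A))) (TensorProduct.assoc k _ _ _ w) := by
  change TensorProduct.assoc k _ _ _
    ((ι X Y).rTensor Z.V (act₂ (tensor X Y) Z (comul (1 : A)) ((π X Y).rTensor Z.V w))) = _
  rw [← coassoc_one]
  generalize comul (R := k) (1 : A) = t
  induction w with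
  | zero => simp
  | add w w' h h' => simp only [map_add, h, h']
  | tmul v z =>
    induction t with
    | zero => simp
    | add w w' h h' => simp only [map_add, LinearMap.add_apply, h, h']
    | tmul a b =>
      simp only [LinearMap.rTensor_tmul, act₂_tmul, TensorProduct.map_tmul]
      rw [ι_ρ, ι_π, act₂_mul_apply, comul_mul_comul_one]
      generalize comul (R := k) a = r
      induction r with
      | zero => simp
      | add w w' h h' => simp only [map_add, LinearMap.add_apply, TensorProduct.add_tmul, h, h']
      | tmul p q =>
        induction v with
        | zero => simp
        | add w w' h h' => simp only [map_add, TensorProduct.add_tmul, h, h']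
        | tmul x y => simp [act₃_tmul]

lemma jR_pR_jL (w) : jR X Y Z (pR X Y Z (TensorProduct.assoc k _ _ _ (jL X Y Z w))) =
    TensorProduct.assoc k _ _ _ (jL X Y Z w) := by
  rw [jR_pR, ← jL_pL, pL_jL]

lemma jL_pL_jR (w) : jL X Y Z (pL X Y Z ((TensorProduct.assoc k _ _ _).symm (jR X Y Z w))) =
    (TensorProduct.assoc k _ _ _).symm (jR X Y Z w) := by
  rw [LinearEquiv.eq_symm_apply, jL_pL, LinearEquiv.apply_symm_apply, ← jR_pR, pR_jR]

lemma jR_injective : Function.Injective (jR X Y Z) :=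
  Function.LeftInverse.injective (pR_jR X Y Z)

lemma jL_ρ (a : A) (w : (tensor (tensor X Y) Z).V) :
    TensorProduct.assoc k _ _ _ (jL X Y Z ((tensor (tensor X Y) Z).ρ a w)) =
    act₃ X Y Z (comul.lTensor A (comul a)) (TensorProduct.assoc k _ _ _ (jL X Y Z w)) := by
  change TensorProduct.assoc k _ _ _ ((ι X Y).rTensor Z.V
    (ι (tensor X Y) Z ((tensor (tensor X Y) Z).ρ a w))) = _
  rw [ι_ρ, rTensor_ι_act₂, coassoc_apply]
  rfl

lemma jR_ρ (a : A) (w : (tensor X (tensor Y Z)).V) : jR X Y Z ((tensor X (tensor Y Z)).ρ a w) =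
    act₃ X Y Z (comul.lTensor A (comul a)) (jR X Y Z w) := by
  change (ι Y Z).lTensor X.V (ι X (tensor Y Z) ((tensor X (tensor Y Z)).ρ a w)) = _
  rw [ι_ρ, lTensor_ι_act₂]
  rfl

/-- The associator, induced by that of vector spaces. -/
def assocIso : tensor (tensor X Y) Z ≅ tensor X (tensor Y Z) :=
  mkIso
    { hom := pR X Y Z ∘ₗ (TensorProduct.assoc k _ _ _).toLinearMap ∘ₗ jL X Y Z
      comm := fun a w => jR_injective X Y Z (by
        rw [jR_ρ]
        simp only [LinearMap.comp_apply, LinearEquiv.coe_coe]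
        rw [jR_pR_jL, jL_ρ, jR_pR_jL]) }
    (pL X Y Z ∘ₗ (TensorProduct.assoc k _ _ _).symm.toLinearMap ∘ₗ jR X Y Z)
    (LinearMap.ext fun w => by
      simp only [LinearMap.comp_apply, LinearEquiv.coe_coe, LinearMap.id_apply]
      rw [jR_pR_jL, LinearEquiv.symm_apply_apply, pL_jL])
    (LinearMap.ext fun w => by
      simp only [LinearMap.comp_apply, LinearEquiv.coe_coe, LinearMap.id_apply]
      rw [jL_pL_jR, LinearEquiv.apply_symm_apply, pR_jR])

lemma jR_assocIso (w) : jR X Y Z ((assocIso X Y Z).hom.hom w) =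
    TensorProduct.assoc k _ _ _ (jL X Y Z w) :=
  jR_pR_jL X Y Z w

/-! #### The unit object -/

variable (k A) in
/-- The target subalgebra of `A`, as a subspace: the image of `ε_t`. -/
def targetSpace : Submodule k A := LinearMap.range (εt k A)

lemma εt_coe (z : targetSpace k A) : εt k A z = z := by
  obtain ⟨_, a, rfl⟩ := z
  exact εt_εt k a

variable [FiniteDimensional k A]

variable (k A) in
/-- The unit object: the target subalgebra of `A` with the action `h · z = ε_t(hz)`. -/
def tensorUnit : FinRep k A where
  V := targetSpace k A
  ρ := AlgHom.ofLinearMap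
    { toFun := fun h =>
        (εt k A).rangeRestrict ∘ₗ LinearMap.mulLeft k h ∘ₗ (targetSpace k A).subtype
      map_add' := fun a b => LinearMap.ext fun z => Subtype.ext (by
        change εt k A ((a + b) * z) = εt k A (a * z) + εt k A (b * z)
        rw [add_mul, map_add])
      map_smul' := fun c a => LinearMap.ext fun z => Subtype.ext (by
        change εt k A ((c • a) * z) = c • εt k A (a * z)
        rw [smul_mul_assoc, map_smul]) }
    (LinearMap.ext fun z => Subtype.ext (by
      change εt k A (1 * z) = z
      rw [one_mul, εt_coe]))
    (fun a b => LinearMap.ext fun z => Subtype.ext (by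
      change εt k A (a * b * z) = εt k A (a * εt k A (b * z))
      rw [εt_mul_εt, mul_assoc]))

variable (k A) in
/-- The inclusion of the unit object in `A`. -/
def incl : (tensorUnit k A).V →ₗ[k] A := (targetSpace k A).subtype

variable (k A) in
/-- The target map with values in the unit object. -/
def εt' : A →ₗ[k] (tensorUnit k A).V := (εt k A).rangeRestrict

lemma εt_incl (z : (tensorUnit k A).V) : εt k A (incl k A z) = incl k A z := εt_coe z

lemma εt'_εt (a : A) : εt' k A (εt k A a) = εt' k A a := Subtype.ext (εt_εt k a)

lemma tensorUnit_ρ (a : A) (z : (tensorUnit k A).V) :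
    (tensorUnit k A).ρ a z = εt' k A (a * incl k A z) := rfl

/-- `z ⊗ x ↦ z x` -/
def leftAct : (tensorUnit k A).V ⊗[k] X.V →ₗ[k] X.V :=
  TensorProduct.lift (X.ρ.toLinearMap ∘ₗ incl k A)

/-- `x ⊗ z ↦ ε(1₂ z) 1₁ x` -/
def rightAct : X.V ⊗[k] (tensorUnit k A).V →ₗ[k] X.V :=
  TensorProduct.lift (X.ρ.toLinearMap ∘ₗ εr k A ∘ₗ incl k A).flip

lemma leftAct_tmul (z : (tensorUnit k A).V) (x : X.V) :
    leftAct X (z ⊗ₜ x) = X.ρ (incl k A z) x := rfl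

lemma rightAct_tmul (z : (tensorUnit k A).V) (x : X.V) :
    rightAct X (x ⊗ₜ z) = X.ρ (εr k A (incl k A z)) x := rfl

variable (k A) in
/-- The restriction of the counit to the target subalgebra. -/
def unitCounit : (tensorUnit k A).V →ₗ[k] k := counit ∘ₗ incl k A

/-- `z ⊗ x ↦ ε(z) x` -/
def leftCounit : (tensorUnit k A).V ⊗[k] X.V →ₗ[k] X.V :=
  TensorProduct.lid k X.V ∘ₗ (unitCounit k A).rTensor X.V

/-- `x ⊗ z ↦ ε(z) x` -/
def rightCounit : X.V ⊗[k] (tensorUnit k A).V →ₗ[k] X.V :=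
  TensorProduct.rid k X.V ∘ₗ (unitCounit k A).lTensor X.V

lemma unitCounit_ρ (a : A) (z : (tensorUnit k A).V) :
    unitCounit k A ((tensorUnit k A).ρ a z) = counit (R := k) (a * incl k A z) :=
  counit_εt k _

lemma leftCounit_act₂ (h : A) (w : (tensorUnit k A).V ⊗[k] X.V) :
    leftCounit X (act₂ (tensorUnit k A) X (comul h) w) = X.ρ h (leftAct X w) := by
  induction w with
  | zero => simp
  | add w w' h h' => simp only [map_add, h, h']
  | tmul z x =>
    have key : ∀ t : A ⊗[k] A, leftCounit X (act₂ (tensorUnit k A) X t (z ⊗ₜ x)) =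
        X.ρ (counitL k A (t * (incl k A z ⊗ₜ 1))) x := by
      intro t
      induction t with
      | zero => simp
      | add w w' h h' => simp only [map_add, add_mul, LinearMap.add_apply, h, h']
      | tmul a b => simp [leftCounit, unitCounit_ρ, counitL_tmul]
    rw [key, counitL_comul_mul, leftAct_tmul, map_mul]
    rw [εt_incl]; rfl

lemma rightCounit_act₂ (h : A) (w : X.V ⊗[k] (tensorUnit k A).V) :
    rightCounit X (act₂ X (tensorUnit k A) (comul h) w) = X.ρ h (rightAct X w) := by
  induction w with
  | zero => simp
  | add w w' h h' => simp only [map_add, h, h']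
  | tmul x z =>
    have key : ∀ t : A ⊗[k] A, rightCounit X (act₂ X (tensorUnit k A) t (x ⊗ₜ z)) =
        X.ρ (counitR k A (t * (1 ⊗ₜ incl k A z))) x := by
      intro t
      induction t with
      | zero => simp
      | add w w' h h' => simp only [map_add, add_mul, LinearMap.add_apply, h, h']
      | tmul a b => simp [rightCounit, unitCounit_ρ, counitR_tmul]
    rw [key, counitR_comul_mul, rightAct_tmul, map_mul]
    rfl

lemma leftAct_ι (w) : leftAct X (ι (tensorUnit k A) X w) = leftCounit X (ι (tensorUnit k A) X w) := by
  have h := leftCounit_act₂ X 1 (ι (tensorUnit k A) X w)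
  rw [act₂_one_ι, map_one] at h
  exact h.symm

lemma rightAct_ι (w) :
    rightAct X (ι X (tensorUnit k A) w) = rightCounit X (ι X (tensorUnit k A) w) := by
  have h := rightCounit_act₂ X 1 (ι X (tensorUnit k A) w)
  rw [act₂_one_ι, map_one] at h
  exact h.symm

variable (k A) in
/-- The unit element of the target subalgebra. -/
def oneT : (tensorUnit k A).V := εt' k A 1

lemma incl_oneT : incl k A (oneT k A) = 1 := εt_one k

lemma oneT_ρ (a : A) : (tensorUnit k A).ρ a (oneT k A) = εt' k A a :=
  by rw [tensorUnit_ρ, incl_oneT, mul_one]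

lemma act₂_oneT_left (w : (tensorUnit k A).V ⊗[k] X.V) :
    act₂ (tensorUnit k A) X (comul (1 : A)) (oneT k A ⊗ₜ leftAct X w) =
      act₂ (tensorUnit k A) X (comul (1 : A)) w := by
  induction w with
  | zero => simp
  | add w w' h h' => simp only [map_add, TensorProduct.tmul_add, h, h']
  | tmul z x =>
    -- `a ⊗ b ↦ a ⊗ b x`
    let Q : (tensorUnit k A).V ⊗[k] A →ₗ[k] (tensorUnit k A).V ⊗[k] X.V :=
      (X.ρ.toLinearMap.flip x).lTensor _
    have k1 : ∀ t : A ⊗[k] A, act₂ (tensorUnit k A) X t (oneT k A ⊗ₜ leftAct X (z ⊗ₜ x)) =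
        Q ((εt' k A).rTensor A ((LinearMap.mulRight k (incl k A z)).lTensor A
          ((εt k A).rTensor A t))) := by
      intro t
      induction t with
      | zero => simp
      | add w w' h h' => simp only [map_add, LinearMap.add_apply, h, h']
      | tmul a b =>
        simp only [act₂_tmul, TensorProduct.map_tmul, oneT_ρ, leftAct_tmul,
          LinearMap.rTensor_tmul, LinearMap.lTensor_tmul, εt'_εt, LinearMap.mulRight_apply]
        change _ = εt' k A a ⊗ₜ X.ρ (b * _) x
        rw [map_mul]; rfl
    have k2 : ∀ t : A ⊗[k] A, act₂ (tensorUnit k A) X t (z ⊗ₜ x) =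
        Q ((εt' k A).rTensor A ((εt k A).rTensor A (t * (incl k A z ⊗ₜ 1)))) := by
      intro t
      induction t with
      | zero => simp
      | add w w' h h' => simp only [map_add, add_mul, LinearMap.add_apply, h, h']
      | tmul a b =>
        simp only [Algebra.TensorProduct.tmul_mul_tmul, act₂_tmul, TensorProduct.map_tmul,
          LinearMap.rTensor_tmul, εt'_εt, mul_one]
        rfl
    have hz : comul (R := k) (incl k A z) =
        comul (1 : A) * (incl k A z ⊗ₜ 1) := by
      rw [← εt_incl, ← comul_εt]
    rw [k1, k2, ← hz, ← rTensor_εt_comul]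

lemma act₂_oneT_right (w : X.V ⊗[k] (tensorUnit k A).V) :
    act₂ X (tensorUnit k A) (comul (1 : A)) (rightAct X w ⊗ₜ oneT k A) =
      act₂ X (tensorUnit k A) (comul (1 : A)) w := by
  induction w with
  | zero => simp
  | add w w' h h' => simp only [map_add, TensorProduct.add_tmul, h, h']
  | tmul x z =>
    let Q : A ⊗[k] A →ₗ[k] X.V ⊗[k] (tensorUnit k A).V :=
      TensorProduct.map (X.ρ.toLinearMap.flip x) (εt' k A)
    have k1 : ∀ t : A ⊗[k] A, act₂ X (tensorUnit k A) t (rightAct X (x ⊗ₜ z) ⊗ₜ oneT k A) =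
        Q (t * (εr k A (incl k A z) ⊗ₜ 1)) := by
      intro t
      induction t with
      | zero => simp
      | add w w' h h' => simp only [map_add, add_mul, LinearMap.add_apply, h, h']
      | tmul a b =>
        simp only [act₂_tmul, TensorProduct.map_tmul, oneT_ρ, rightAct_tmul,
          Algebra.TensorProduct.tmul_mul_tmul, mul_one]
        change _ = X.ρ (a * _) x ⊗ₜ εt' k A b
        rw [map_mul]; rfl
    have k2 : ∀ t : A ⊗[k] A, act₂ X (tensorUnit k A) t (x ⊗ₜ z) =
        Q ((εt k A ∘ₗ LinearMap.mulRight k (incl k A z)).lTensor A t) := by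
      intro t
      induction t with
      | zero => simp
      | add w w' h h' => simp only [map_add, LinearMap.add_apply, h, h']
      | tmul a b =>
        simp only [act₂_tmul, TensorProduct.map_tmul, LinearMap.lTensor_tmul, Q,
          LinearMap.comp_apply, LinearMap.mulRight_apply, εt'_εt]
        rfl
    rw [k1, k2, lTensor_εt_comul_one]

/-- The left unit constraint `z ⊗ x ↦ z x`. -/
def leftIso : tensor (tensorUnit k A) X ≅ X :=
  mkIso
    { hom := leftAct X ∘ₗ ι (tensorUnit k A) X
      comm := fun a w => by
        simp only [LinearMap.comp_apply]
        rw [leftAct_ι, ι_ρ, leftCounit_act₂] }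
    (π (tensorUnit k A) X ∘ₗ TensorProduct.mk k _ _ (oneT k A))
    (LinearMap.ext fun w => ι_injective _ _ (by
      simp only [LinearMap.comp_apply, LinearMap.id_apply, TensorProduct.mk_apply]
      rw [ι_π, act₂_oneT_left, act₂_one_ι]))
    (LinearMap.ext fun x => by
      simp only [LinearMap.comp_apply, LinearMap.id_apply, TensorProduct.mk_apply]
      rw [leftAct_ι, ι_π, leftCounit_act₂, leftAct_tmul, incl_oneT]
      simp)

/-- The right unit constraint `x ⊗ z ↦ ε(z) x = ε(1₂ z) 1₁ x` (for `x ⊗ z ∈ Δ(1)(X ⊗ A_t)`). -/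
def rightIso : tensor X (tensorUnit k A) ≅ X :=
  mkIso
    { hom := rightAct X ∘ₗ ι X (tensorUnit k A)
      comm := fun a w => by
        simp only [LinearMap.comp_apply]
        rw [rightAct_ι, ι_ρ, rightCounit_act₂] }
    (π X (tensorUnit k A) ∘ₗ (TensorProduct.mk k _ _).flip (oneT k A))
    (LinearMap.ext fun w => ι_injective _ _ (by
      simp only [LinearMap.comp_apply, LinearMap.id_apply, TensorProduct.mk_apply,
        LinearMap.flip_apply]
      rw [ι_π, act₂_oneT_right, act₂_one_ι]))
    (LinearMap.ext fun x => by
      simp only [LinearMap.comp_apply, LinearMap.id_apply, TensorProduct.mk_apply,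
        LinearMap.flip_apply]
      rw [rightAct_ι, ι_π, rightCounit_act₂, rightAct_tmul, incl_oneT, εr_one]
      simp)

end monoidal
end FinRep

namespace FinRep
section monoidal
open Coalgebra WeakBialgebra
variable {k A : Type u} [Field k] [Ring A] [Algebra k A] [WeakBialgebra k A]
variable (X Y Z : FinRep k A)

lemma tensorMap_id : tensorMap (𝟙 X) (𝟙 Y) = 𝟙 (tensor X Y) :=
  hom_ext (LinearMap.ext fun w => ι_injective _ _ (by
    rw [ι_tensorMap]; simp))

lemma tensorMap_comp {X X' X'' Y Y' Y'' : FinRep k A} (f : X ⟶ X') (f' : X' ⟶ X'')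
    (g : Y ⟶ Y') (g' : Y' ⟶ Y'') :
    tensorMap f g ≫ tensorMap f' g' = tensorMap (f ≫ f') (g ≫ g') :=
  hom_ext (LinearMap.ext fun w => ι_injective _ _ (by
    rw [comp_hom, LinearMap.comp_apply, ι_tensorMap, ι_tensorMap, ι_tensorMap]
    rw [comp_hom, comp_hom, TensorProduct.map_comp, LinearMap.comp_apply]))

lemma jL_apply (w) : jL X Y Z w = (ι X Y).rTensor Z.V (ι (tensor X Y) Z w) := rfl
lemma jR_apply (w) : jR X Y Z w = (ι Y Z).lTensor X.V (ι X (tensor Y Z) w) := rfl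

lemma rTensor_ι_map {X X' Y Y' Z Z' : FinRep k A} (f : X ⟶ X') (g : Y ⟶ Y') (h : Z ⟶ Z') (w) :
    (ι X' Y').rTensor Z'.V (TensorProduct.map (tensorMap f g).hom h.hom w) =
      TensorProduct.map (TensorProduct.map f.hom g.hom) h.hom ((ι X Y).rTensor Z.V w) := by
  induction w with
  | zero => simp
  | add w w' h h' => simp only [map_add, h, h']
  | tmul x z => simp [ι_tensorMap]

lemma lTensor_ι_map {X X' Y Y' Z Z' : FinRep k A} (f : X ⟶ X') (g : Y ⟶ Y') (h : Z ⟶ Z') (w) :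
    (ι Y' Z').lTensor X'.V (TensorProduct.map f.hom (tensorMap g h).hom w) =
      TensorProduct.map f.hom (TensorProduct.map g.hom h.hom) ((ι Y Z).lTensor X.V w) := by
  induction w with
  | zero => simp
  | add w w' h h' => simp only [map_add, h, h']
  | tmul x z => simp [ι_tensorMap]

lemma assocIso_natural {X X' Y Y' Z Z' : FinRep k A} (f : X ⟶ X') (g : Y ⟶ Y') (h : Z ⟶ Z') :
    tensorMap (tensorMap f g) h ≫ (assocIso X' Y' Z').hom =
      (assocIso X Y Z).hom ≫ tensorMap f (tensorMap g h) :=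
  hom_ext (LinearMap.ext fun w => jR_injective _ _ _ (by
    simp only [comp_hom, LinearMap.comp_apply]
    rw [jR_assocIso, jL_apply, ι_tensorMap, rTensor_ι_map, ← jL_apply,
      jR_apply, ι_tensorMap, lTensor_ι_map, ← jR_apply, jR_assocIso]
    generalize jL X Y Z w = v
    induction v with
    | zero => simp
    | add w w' h h' => simp only [map_add, h, h']
    | tmul v z =>
      induction v with
      | zero => simp
      | add w w' h h' => simp only [map_add, TensorProduct.add_tmul, h, h']
      | tmul x y => simp))

lemma pentagon_aux (W : FinRep k A) :
    tensorMap (assocIso W X Y).hom (𝟙 Z) ≫ (assocIso W (tensor X Y) Z).hom ≫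
      tensorMap (𝟙 W) (assocIso X Y Z).hom =
    (assocIso (tensor W X) Y Z).hom ≫ (assocIso W X (tensor Y Z)).hom :=
  hom_ext (LinearMap.ext fun w => by
    apply ι_injective
    have inj : Function.Injective ((jR X Y Z).lTensor W.V) :=
      Function.LeftInverse.injective (g := (pR X Y Z).lTensor W.V) fun v => by
        rw [← LinearMap.lTensor_comp_apply,
          show pR X Y Z ∘ₗ jR X Y Z = LinearMap.id from LinearMap.ext (pR_jR X Y Z),
          LinearMap.lTensor_id_apply]
    apply inj
    simp only [comp_hom, LinearMap.comp_apply]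
    rw [ι_tensorMap]
    -- the left-hand side
    have h1 : ∀ v, (jR X Y Z).lTensor W.V (TensorProduct.map (Hom.hom (𝟙 W))
        (assocIso X Y Z).hom.hom v) =
        (TensorProduct.assoc k X.V Y.V Z.V).toLinearMap.lTensor W.V
          (((ι X Y).rTensor Z.V).lTensor W.V ((ι (tensor X Y) Z).lTensor W.V v)) := by
      intro v
      induction v with
      | zero => simp
      | add w w' h h' => simp only [map_add, h, h']
      | tmul x z => simp [jR_assocIso, jL_apply]
    have h2 : ∀ v, ((ι X Y).rTensor Z.V).lTensor W.V (TensorProduct.assoc k _ _ _ v) =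
        TensorProduct.assoc k _ _ _ (((ι X Y).lTensor W.V).rTensor Z.V v) := by
      intro v
      induction v with
      | zero => simp
      | add w w' h h' => simp only [map_add, h, h']
      | tmul v z =>
        induction v with
        | zero => simp
        | add w w' h h' => simp only [map_add, TensorProduct.add_tmul, h, h']
        | tmul x y => simp
    have h3 : ∀ v, ((ι X Y).lTensor W.V).rTensor Z.V ((ι W (tensor X Y)).rTensor Z.V
        (TensorProduct.map (assocIso W X Y).hom.hom (Hom.hom (𝟙 Z)) v)) =
        (TensorProduct.assoc k W.V X.V Y.V).toLinearMap.rTensor Z.V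
          (((ι W X).rTensor Y.V).rTensor Z.V ((ι (tensor W X) Y).rTensor Z.V v)) := by
      intro v
      induction v with
      | zero => simp
      | add w w' h h' => simp only [map_add, h, h']
      | tmul x z =>
        have := jR_assocIso W X Y x
        rw [jR_apply, jL_apply] at this
        simp [this]
    rw [h1, ← jR_apply, jR_assocIso, h2, jL_apply, ι_tensorMap, h3, ← jL_apply]
    -- the right-hand side
    have h4 : ∀ v, (jR X Y Z).lTensor W.V v = ((ι Y Z).lTensor X.V).lTensor W.V
        ((ι X (tensor Y Z)).lTensor W.V v) := by
      intro v
      rw [← LinearMap.lTensor_comp_apply]; rfl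
    have h5 : ∀ v, ((ι Y Z).lTensor X.V).lTensor W.V (TensorProduct.assoc k _ _ _
        ((ι W X).rTensor (tensor Y Z).V v)) =
        TensorProduct.assoc k _ _ _ ((ι W X).rTensor (Y.V ⊗[k] Z.V)
          ((ι Y Z).lTensor (tensor W X).V v)) := by
      intro v
      induction v with
      | zero => simp
      | add w w' h h' => simp only [map_add, h, h']
      | tmul v z =>
        simp only [LinearMap.rTensor_tmul, LinearMap.lTensor_tmul]
        generalize ι W X v = v
        induction v with
        | zero => simp
        | add w w' h h' => simp only [map_add, TensorProduct.add_tmul, h, h']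
        | tmul x y => simp
    rw [h4, ← jR_apply, jR_assocIso, jL_apply W X (tensor Y Z), h5, ← jR_apply, jR_assocIso]
    generalize jL (tensor W X) Y Z w = v
    induction v with
    | zero => simp
    | add w w' h h' => simp only [map_add, h, h']
    | tmul v z =>
      induction v with
      | zero => simp
      | add w w' h h' => simp only [map_add, TensorProduct.add_tmul, h, h']
      | tmul v y =>
        simp only [LinearMap.rTensor_tmul, TensorProduct.assoc_tmul]
        generalize ι W X v = v
        induction v with
        | zero => simp
        | add w w' h h' => simp only [map_add, TensorProduct.add_tmul, h, h']
        | tmul x y => simp)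

variable [FiniteDimensional k A]

lemma leftIso_apply (w) : (leftIso X).hom.hom w = leftCounit X (ι _ _ w) := leftAct_ι X w
lemma rightIso_apply (w) : (rightIso X).hom.hom w = rightCounit X (ι _ _ w) := rightAct_ι X w

lemma leftIso_natural {X Y : FinRep k A} (f : X ⟶ Y) :
    tensorMap (𝟙 (tensorUnit k A)) f ≫ (leftIso Y).hom = (leftIso X).hom ≫ f :=
  hom_ext (LinearMap.ext fun w => by
    simp only [comp_hom, LinearMap.comp_apply]
    rw [leftIso_apply, leftIso_apply, ι_tensorMap]
    generalize ι _ _ w = v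
    induction v with
    | zero => simp
    | add w w' h h' => simp only [map_add, h, h']
    | tmul z x => simp [leftCounit])

lemma rightIso_natural {X Y : FinRep k A} (f : X ⟶ Y) :
    tensorMap f (𝟙 (tensorUnit k A)) ≫ (rightIso Y).hom = (rightIso X).hom ≫ f :=
  hom_ext (LinearMap.ext fun w => by
    simp only [comp_hom, LinearMap.comp_apply]
    rw [rightIso_apply, rightIso_apply, ι_tensorMap]
    generalize ι _ _ w = v
    induction v with
    | zero => simp
    | add w w' h h' => simp only [map_add, h, h']
    | tmul z x => simp [rightCounit])

lemma triangle_aux : (assocIso X (tensorUnit k A) Y).hom ≫ tensorMap (𝟙 X) (leftIso Y).hom =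
    tensorMap (rightIso X).hom (𝟙 Y) :=
  hom_ext (LinearMap.ext fun w => ι_injective _ _ (by
    simp only [comp_hom, LinearMap.comp_apply]
    rw [ι_tensorMap, ι_tensorMap]
    have h1 : ∀ v, TensorProduct.map (Hom.hom (𝟙 X)) (leftIso Y).hom.hom v =
        (leftCounit Y).lTensor X.V ((ι _ _).lTensor X.V v) := by
      intro v
      induction v with
      | zero => simp
      | add w w' h h' => simp only [map_add, h, h']
      | tmul x z => simp [leftIso_apply]
    have h2 : ∀ v, TensorProduct.map (rightIso X).hom.hom (Hom.hom (𝟙 Y)) v =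
        (rightCounit X).rTensor Y.V ((ι _ _).rTensor Y.V v) := by
      intro v
      induction v with
      | zero => simp
      | add w w' h h' => simp only [map_add, h, h']
      | tmul x z => simp [rightIso_apply]
    rw [h1, h2, ← jR_apply, ← jL_apply, jR_assocIso]
    generalize jL _ _ _ w = v
    induction v with
    | zero => simp
    | add w w' h h' => simp only [map_add, h, h']
    | tmul v z =>
      induction v with
      | zero => simp
      | add w w' h h' => simp only [map_add, TensorProduct.add_tmul, h, h']
      | tmul x y => simp [leftCounit, rightCounit, TensorProduct.smul_tmul']))

/-- The monoidal category of finite-dimensional representations of a finite-dimensional weak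
bialgebra. -/
instance : MonoidalCategory (FinRep k A) where
  tensorObj := tensor
  tensorHom f g := tensorMap f g
  whiskerLeft X _ _ f := tensorMap (𝟙 X) f
  whiskerRight f Y := tensorMap f (𝟙 Y)
  tensorUnit := tensorUnit k A
  associator X Y Z := assocIso X Y Z
  leftUnitor X := leftIso X
  rightUnitor X := rightIso X
  tensorHom_def f g := by rw [tensorMap_comp, Category.comp_id, Category.id_comp]
  id_tensorHom_id := tensorMap_id
  tensorHom_comp_tensorHom f g f' g' := tensorMap_comp f f' g g'
  whiskerLeft_id := tensorMap_id
  id_whiskerRight := tensorMap_id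
  associator_naturality := assocIso_natural
  leftUnitor_naturality := leftIso_natural
  rightUnitor_naturality := rightIso_natural
  pentagon W X Y Z := pentagon_aux X Y Z W
  triangle X Y := triangle_aux X Y

end monoidal
end FinRep

/-! ### Groupoids and double groupoids -/

/-- A (small) groupoid with set of arrows `Arr` and set of objects `Obj`. The composition `a b`
is written in diagrammatic order and is defined when `tgt a = src b`; the values of `comp` at
other pairs are irrelevant. -/
structure GroupoidOn (Arr Obj : Type u) where
  src : Arr → Obj
  tgt : Arr → Obj
  /-- identity arrows -/
  one : Obj → Arr
  comp : Arr → Arr → Arr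
  inv : Arr → Arr
  src_one : ∀ p, src (one p) = p
  tgt_one : ∀ p, tgt (one p) = p
  src_comp : ∀ a b, tgt a = src b → src (comp a b) = src a
  tgt_comp : ∀ a b, tgt a = src b → tgt (comp a b) = tgt b
  one_comp : ∀ a, comp (one (src a)) a = a
  comp_one : ∀ a, comp a (one (tgt a)) = a
  assoc : ∀ a b c, tgt a = src b → tgt b = src c → comp (comp a b) c = comp a (comp b c)
  src_inv : ∀ a, src (inv a) = tgt a
  tgt_inv : ∀ a, tgt (inv a) = src a
  comp_inv : ∀ a, comp a (inv a) = one (src a)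
  inv_comp : ∀ a, comp (inv a) a = one (tgt a)

namespace GroupoidOn

variable {Arr Obj : Type u} (G : GroupoidOn Arr Obj)

/-- A groupoid is connected if there is an arrow between any two objects. -/
def IsConnected : Prop := ∀ p q : Obj, ∃ a : Arr, G.src a = p ∧ G.tgt a = q

lemma inv_comp_cancel {a b : Arr} (h : G.tgt a = G.src b) : G.comp (G.inv a) (G.comp a b) = b := by
  rw [← G.assoc _ _ _ (G.tgt_inv a) h, G.inv_comp, h, G.one_comp]

lemma comp_inv_cancel {a b : Arr} (h : G.src a = G.src b) : G.comp a (G.comp (G.inv a) b) = b := by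
  rw [← G.assoc _ _ _ (G.src_inv a).symm ((G.tgt_inv a).trans h), G.comp_inv, h, G.one_comp]

lemma left_cancel {a b c : Arr} (h : G.tgt a = G.src b) (h' : G.tgt a = G.src c)
    (e : G.comp a b = G.comp a c) : b = c := by
  rw [← G.inv_comp_cancel h, e, G.inv_comp_cancel h']

lemma eq_inv {a b : Arr} (h : G.tgt a = G.src b) (e : G.comp a b = G.one (G.src a)) :
    b = G.inv a := by
  refine G.left_cancel h (G.src_inv a).symm ?_
  rw [e, G.comp_inv]

lemma inv_inv (a : Arr) : G.inv (G.inv a) = a := by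
  refine (G.eq_inv (G.tgt_inv a) ?_).symm
  rw [G.inv_comp, G.src_inv]

end GroupoidOn

/-- A double groupoid with boxes `B`, horizontal edges `H`, vertical edges `V` and points `P`. -/
structure DoubleGroupoid (B H V P : Type u) where
  /-- the groupoid `B ⇉ H`: vertical composition of boxes; source is top, target is bottom -/
  vBox : GroupoidOn B H
  /-- the groupoid `B ⇉ V`: horizontal composition of boxes; source is left, target is right -/
  hBox : GroupoidOn B V
  /-- the groupoid `H ⇉ P`: source is left, target is right -/
  hor : GroupoidOn H P
  /-- the groupoid `V ⇉ P`: source is top, target is bottom -/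
  ver : GroupoidOn V P
  nonempty : Nonempty P
  -- the four corners of a box
  top_left : ∀ A, ver.src (hBox.src A) = hor.src (vBox.src A)
  top_right : ∀ A, ver.src (hBox.tgt A) = hor.tgt (vBox.src A)
  bot_left : ∀ A, ver.tgt (hBox.src A) = hor.src (vBox.tgt A)
  bot_right : ∀ A, ver.tgt (hBox.tgt A) = hor.tgt (vBox.tgt A)
  -- boundaries of the compositions
  top_hcomp : ∀ A C, hBox.tgt A = hBox.src C →
    vBox.src (hBox.comp A C) = hor.comp (vBox.src A) (vBox.src C)
  bot_hcomp : ∀ A C, hBox.tgt A = hBox.src C →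
    vBox.tgt (hBox.comp A C) = hor.comp (vBox.tgt A) (vBox.tgt C)
  left_vcomp : ∀ A C, vBox.tgt A = vBox.src C →
    hBox.src (vBox.comp A C) = ver.comp (hBox.src A) (hBox.src C)
  right_vcomp : ∀ A C, vBox.tgt A = vBox.src C →
    hBox.tgt (vBox.comp A C) = ver.comp (hBox.tgt A) (hBox.tgt C)
  /-- the interchange law -/
  interchange : ∀ A C D E, hBox.tgt A = hBox.src C → hBox.tgt D = hBox.src E →
    vBox.tgt A = vBox.src D → vBox.tgt C = vBox.src E →
    vBox.comp (hBox.comp A C) (hBox.comp D E) = hBox.comp (vBox.comp A D) (vBox.comp C E)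
  -- boundaries of the identities
  left_vone : ∀ x, hBox.src (vBox.one x) = ver.one (hor.src x)
  right_vone : ∀ x, hBox.tgt (vBox.one x) = ver.one (hor.tgt x)
  top_hone : ∀ g, vBox.src (hBox.one g) = hor.one (ver.src g)
  bot_hone : ∀ g, vBox.tgt (hBox.one g) = hor.one (ver.tgt g)
  -- compatibilities of the identities
  vone_one : ∀ p, vBox.one (hor.one p) = hBox.one (ver.one p)
  hcomp_vone : ∀ x y, hor.tgt x = hor.src y →
    hBox.comp (vBox.one x) (vBox.one y) = vBox.one (hor.comp x y)
  vcomp_hone : ∀ f g, ver.tgt f = ver.src g →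
    vBox.comp (hBox.one f) (hBox.one g) = hBox.one (ver.comp f g)

/-- A vacant double groupoid: a double groupoid in which any horizontal edge `x` and vertical
edge `g` with `r(x) = t(g)` are the top and the right side of exactly one box. -/
structure VacantDoubleGroupoid (B H V P : Type u) extends DoubleGroupoid B H V P where
  vacant : ∀ (x : H) (g : V), hor.tgt x = ver.src g → ∃! A : B, vBox.src A = x ∧ hBox.tgt A = g

/-- A normalized 2-cocycle `(σ, τ)` on a double groupoid with values in `kˣ`. Only the values of
`σ` at vertically composable pairs and of `τ` at horizontally composable pairs are relevant. -/
structure DoubleGroupoid.Cocycle {B H V P : Type u} (T : DoubleGroupoid B H V P) (k : Type u)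
    [Field k] where
  σ : B → B → kˣ
  τ : B → B → kˣ
  σ_cocycle : ∀ A C D, T.vBox.tgt A = T.vBox.src C → T.vBox.tgt C = T.vBox.src D →
    σ A C * σ (T.vBox.comp A C) D = σ C D * σ A (T.vBox.comp C D)
  σ_vone_left : ∀ A, σ (T.vBox.one (T.vBox.src A)) A = 1
  σ_vone_right : ∀ A, σ A (T.vBox.one (T.vBox.tgt A)) = 1
  τ_cocycle : ∀ A C D, T.hBox.tgt A = T.hBox.src C → T.hBox.tgt C = T.hBox.src D →
    τ A C * τ (T.hBox.comp A C) D = τ C D * τ A (T.hBox.comp C D)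
  τ_hone_left : ∀ A, τ (T.hBox.one (T.hBox.src A)) A = 1
  τ_hone_right : ∀ A, τ A (T.hBox.one (T.hBox.tgt A)) = 1
  compat : ∀ A C D E, T.hBox.tgt A = T.hBox.src C → T.hBox.tgt D = T.hBox.src E →
    T.vBox.tgt A = T.vBox.src D → T.vBox.tgt C = T.vBox.src E →
    σ (T.hBox.comp A C) (T.hBox.comp D E) * τ (T.vBox.comp A D) (T.vBox.comp C E) =
      τ A C * τ D E * σ A D * σ C E

namespace VacantDoubleGroupoid

variable {B H V P : Type u} (T : VacantDoubleGroupoid B H V P)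

lemma top_hinv (A : B) : T.vBox.src (T.hBox.inv A) = T.hor.inv (T.vBox.src A) := by
  have h : T.hor.tgt (T.vBox.src A) = T.hor.src (T.vBox.src (T.hBox.inv A)) := by
    rw [← T.top_right, ← T.top_left, T.hBox.src_inv]
  apply T.hor.eq_inv h
  rw [← T.top_hcomp _ _ (T.hBox.src_inv A).symm, T.hBox.comp_inv, T.top_hone, T.top_left]

lemma bot_hinv (A : B) : T.vBox.tgt (T.hBox.inv A) = T.hor.inv (T.vBox.tgt A) := by
  have h : T.hor.tgt (T.vBox.tgt A) = T.hor.src (T.vBox.tgt (T.hBox.inv A)) := by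
    rw [← T.bot_right, ← T.bot_left, T.hBox.src_inv]
  apply T.hor.eq_inv h
  rw [← T.bot_hcomp _ _ (T.hBox.src_inv A).symm, T.hBox.comp_inv, T.bot_hone, T.bot_left]

lemma left_vinv (A : B) : T.hBox.src (T.vBox.inv A) = T.ver.inv (T.hBox.src A) := by
  have h : T.ver.tgt (T.hBox.src A) = T.ver.src (T.hBox.src (T.vBox.inv A)) := by
    rw [T.bot_left, T.top_left, T.vBox.src_inv]
  apply T.ver.eq_inv h
  rw [← T.left_vcomp _ _ (T.vBox.src_inv A).symm, T.vBox.comp_inv, T.left_vone, T.top_left]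

/-- A box is determined by its top and right sides. -/
lemma ext_top_right {A C : B} (h : T.vBox.src A = T.vBox.src C)
    (h' : T.hBox.tgt A = T.hBox.tgt C) : A = C :=
  (T.vacant (T.vBox.src C) (T.hBox.tgt C) (T.top_right C).symm).unique ⟨h, h'⟩ ⟨rfl, rfl⟩

/-- A box is determined by its top and left sides. -/
lemma ext_top_left {A C : B} (h : T.vBox.src A = T.vBox.src C)
    (h' : T.hBox.src A = T.hBox.src C) : A = C := by
  rw [← T.hBox.inv_inv A, ← T.hBox.inv_inv C]
  congr 1
  apply T.ext_top_right
  · rw [top_hinv, top_hinv, h]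
  · rw [T.hBox.tgt_inv, T.hBox.tgt_inv, h']

lemma exists_top_left (x : H) (f : V) (h : T.hor.src x = T.ver.src f) :
    ∃ A : B, T.vBox.src A = x ∧ T.hBox.src A = f := by
  obtain ⟨A, ⟨h1, h2⟩, -⟩ := T.vacant (T.hor.inv x) f (by rw [T.hor.tgt_inv, h])
  exact ⟨T.hBox.inv A, by rw [top_hinv, h1, T.hor.inv_inv], by rw [T.hBox.src_inv, h2]⟩

/-- Being a horizontal identity. -/
def IsHOne (A : B) : Prop := A = T.hBox.one (T.hBox.src A)

lemma isHOne_hone (g : V) : T.IsHOne (T.hBox.one g) := by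
  rw [IsHOne, T.hBox.src_one]

lemma isHOne_of_top {A : B} {p : P} (h : T.vBox.src A = T.hor.one p) : T.IsHOne A := by
  apply T.ext_top_left
  · rw [T.top_hone, T.top_left, h, T.hor.src_one]
  · rw [T.hBox.src_one]

variable {T}

lemma IsHOne.top {A : B} (h : T.IsHOne A) : ∃ p, T.vBox.src A = T.hor.one p :=
  ⟨_, by rw [h, T.top_hone]⟩

lemma IsHOne.bot {A : B} (h : T.IsHOne A) : ∃ p, T.vBox.tgt A = T.hor.one p :=
  ⟨_, by rw [h, T.bot_hone]⟩

lemma IsHOne.tgt {A : B} (h : T.IsHOne A) : T.hBox.tgt A = T.hBox.src A := by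
  conv_lhs => rw [h, T.hBox.tgt_one]

variable (T)

lemma isHOne_vcomp {A C : B} (h : T.vBox.tgt A = T.vBox.src C) :
    T.IsHOne (T.vBox.comp A C) ↔ T.IsHOne A ∧ T.IsHOne C := by
  constructor
  · intro hAC
    have hA : T.IsHOne A := by
      obtain ⟨p, hp⟩ := hAC.top
      rw [T.vBox.src_comp _ _ h] at hp
      exact T.isHOne_of_top hp
    refine ⟨hA, ?_⟩
    obtain ⟨p, hp⟩ := hA.bot
    exact T.isHOne_of_top (h.symm.trans hp)
  · rintro ⟨hA, -⟩
    obtain ⟨p, hp⟩ := hA.top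
    exact T.isHOne_of_top (p := p) (by rw [T.vBox.src_comp _ _ h, hp])

lemma eq_vone_of_hcomp {A C : B} {z : H} (h : T.hBox.tgt A = T.hBox.src C)
    (e : T.hBox.comp A C = T.vBox.one z) :
    A = T.vBox.one (T.vBox.src A) ∧ C = T.vBox.one (T.vBox.src C) := by
  have hl : T.hBox.src A = T.ver.one (T.hor.src z) := by
    rw [← T.left_vone, ← e, T.hBox.src_comp _ _ h]
  have hr : T.hBox.tgt C = T.ver.one (T.hor.tgt z) := by
    rw [← T.right_vone, ← e, T.hBox.tgt_comp _ _ h]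
  constructor
  · apply T.ext_top_left
    · rw [T.vBox.src_one]
    · rw [T.left_vone, ← T.top_left, hl, T.ver.src_one]
  · apply T.ext_top_right
    · rw [T.vBox.src_one]
    · rw [T.right_vone, ← T.top_right, hr, T.ver.src_one]

variable {T} {k : Type u} [Field k] (c : T.Cocycle k)

lemma τ_vone {x y : H} (h : T.hor.tgt x = T.hor.src y) :
    c.τ (T.vBox.one x) (T.vBox.one y) = 1 := by
  have hxy : T.hBox.tgt (T.vBox.one x) = T.hBox.src (T.vBox.one y) := by
    rw [T.right_vone, T.left_vone, h]
  have hx : ∀ x, T.vBox.tgt (T.vBox.one x) = T.vBox.src (T.vBox.one x) := fun x => by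
    rw [T.vBox.tgt_one, T.vBox.src_one]
  have hc : ∀ x, T.vBox.comp (T.vBox.one x) (T.vBox.one x) = T.vBox.one x := fun x => by
    conv_lhs => rw [← T.vBox.src_one x, T.vBox.src_one x]
    simpa only [T.vBox.src_one] using T.vBox.one_comp (T.vBox.one x)
  have hs : ∀ x, c.σ (T.vBox.one x) (T.vBox.one x) = 1 := fun x => by
    simpa only [T.vBox.src_one] using c.σ_vone_left (T.vBox.one x)
  have := c.compat _ _ _ _ hxy hxy (hx x) (hx y)
  rw [T.hcomp_vone _ _ h, hs, hs, hs, hc, hc, one_mul, mul_one, mul_one] at this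
  exact left_eq_mul.mp this

lemma σ_hone {f g : V} (h : T.ver.tgt f = T.ver.src g) :
    c.σ (T.hBox.one f) (T.hBox.one g) = 1 := by
  have hfg : T.vBox.tgt (T.hBox.one f) = T.vBox.src (T.hBox.one g) := by
    rw [T.bot_hone, T.top_hone, h]
  have hx : ∀ x, T.hBox.tgt (T.hBox.one x) = T.hBox.src (T.hBox.one x) := fun x => by
    rw [T.hBox.tgt_one, T.hBox.src_one]
  have hc : ∀ x, T.hBox.comp (T.hBox.one x) (T.hBox.one x) = T.hBox.one x := fun x => by
    simpa only [T.hBox.src_one] using T.hBox.one_comp (T.hBox.one x)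
  have hs : ∀ x, c.τ (T.hBox.one x) (T.hBox.one x) = 1 := fun x => by
    simpa only [T.hBox.src_one] using c.τ_hone_left (T.hBox.one x)
  have := c.compat _ _ _ _ (hx f) (hx g) hfg hfg
  rw [T.vcomp_hone _ _ h, hs, hs, hs, hc, hc, one_mul, one_mul, mul_one] at this
  exact left_eq_mul.mp this

lemma σ_isHOne {A C : B} (h : T.vBox.tgt A = T.vBox.src C) (hA : T.IsHOne A) (hC : T.IsHOne C) :
    c.σ A C = 1 := by
  rw [hA, hC]
  apply σ_hone
  rw [T.bot_left, T.top_left, h]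

end VacantDoubleGroupoid

/-! ### The weak bialgebra of a vacant double groupoid with a cocycle -/

/-- The vector space `k^τ_σ T` with basis the set of boxes. -/
def TwistedAlg {B H V P : Type u} (T : VacantDoubleGroupoid B H V P) {k : Type u} [Field k]
    (_c : T.Cocycle k) : Type u := B →₀ k

namespace TwistedAlg

variable {B H V P : Type u} {T : VacantDoubleGroupoid B H V P} {k : Type u} [Field k]
  {c : T.Cocycle k}

instance (priority := low) : AddCommGroup (TwistedAlg T c) := inferInstanceAs (AddCommGroup (B →₀ k))
instance (priority := low) : Module k (TwistedAlg T c) := inferInstanceAs (Module k (B →₀ k))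

variable (c) in
/-- The basis element of a box. -/
def box (A : B) : TwistedAlg T c := Finsupp.single A (1 : k)

variable (c) in
/-- The linear map with prescribed values on boxes. -/
def lift {M : Type*} [AddCommGroup M] [Module k M] (f : B → M) : TwistedAlg T c →ₗ[k] M :=
  Finsupp.linearCombination k f

@[simp] lemma lift_box {M : Type*} [AddCommGroup M] [Module k M] (f : B → M) (A : B) :
    lift c f (box c A) = f A :=
  (Finsupp.linearCombination_single k (1 : k) A).trans (one_smul k (f A))

@[elab_as_elim]
lemma induction {p : TwistedAlg T c → Prop} (a : TwistedAlg T c) (h0 : p 0)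
    (hadd : ∀ a b, p a → p b → p (a + b)) (hbox : ∀ (r : k) A, p (r • box c A)) : p a :=
  Finsupp.induction_linear (motive := p) a h0 hadd fun A r => by
    have : (Finsupp.single A r : B →₀ k) = r • Finsupp.single A (1 : k) := by simp
    rw [this]
    exact hbox r A

lemma hom_ext {M : Type*} [AddCommGroup M] [Module k M] {f g : TwistedAlg T c →ₗ[k] M}
    (h : ∀ A, f (box c A) = g (box c A)) : f = g :=
  Finsupp.lhom_ext' fun A => LinearMap.ext_ring (h A)

open Classical in
variable (c) in
/-- `A.C = σ(A, C) (A over C)` if `A` and `C` are vertically composable, and `0` otherwise. -/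
def mulBox (A C : B) : TwistedAlg T c :=
  if T.vBox.tgt A = T.vBox.src C then (c.σ A C : k) • box c (T.vBox.comp A C) else 0

variable (c) in
/-- The multiplication as a bilinear map. -/
def mulMap : TwistedAlg T c →ₗ[k] TwistedAlg T c →ₗ[k] TwistedAlg T c :=
  lift c fun A => lift c fun C => mulBox c A C

instance (priority := low) : Mul (TwistedAlg T c) := ⟨fun a b => mulMap c a b⟩

lemma mul_def (a b : TwistedAlg T c) : a * b = mulMap c a b := rfl

lemma box_mul_box (A C : B) : box c A * box c C = mulBox c A C := by
  rw [mul_def, mulMap, lift_box, lift_box]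

instance (priority := low) : NonUnitalNonAssocRing (TwistedAlg T c) :=
  { (inferInstance : AddCommGroup (TwistedAlg T c)), (inferInstance : Mul (TwistedAlg T c)) with
    left_distrib := fun a b c => by simp only [mul_def, map_add]
    right_distrib := fun a b c => by simp only [mul_def, map_add, LinearMap.add_apply]
    zero_mul := fun a => by simp only [mul_def, map_zero, LinearMap.zero_apply]
    mul_zero := fun a => by simp only [mul_def, map_zero] }

instance (priority := low) : IsScalarTower k (TwistedAlg T c) (TwistedAlg T c) :=
  ⟨fun r a b => by simp only [smul_eq_mul, mul_def, map_smul, LinearMap.smul_apply]⟩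

instance (priority := low) : SMulCommClass k (TwistedAlg T c) (TwistedAlg T c) :=
  ⟨fun r a b => by simp only [smul_eq_mul, mul_def, map_smul]⟩

lemma box_mul_box_of {A C : B} (h : T.vBox.tgt A = T.vBox.src C) :
    box c A * box c C = (c.σ A C : k) • box c (T.vBox.comp A C) := by
  rw [box_mul_box, mulBox, if_pos h]

lemma box_mul_box_of_ne {A C : B} (h : T.vBox.tgt A ≠ T.vBox.src C) :
    box c A * box c C = 0 := by
  rw [box_mul_box, mulBox, if_neg h]

lemma mul_assoc' (a b d : TwistedAlg T c) : a * b * d = a * (b * d) := by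
  induction a using induction with
  | h0 => simp
  | hadd a a' h h' => simp only [add_mul, h, h']
  | hbox r A =>
  induction b using induction with
  | h0 => simp
  | hadd a a' h h' => simp only [add_mul, mul_add, h, h']
  | hbox s C =>
  induction d using induction with
  | h0 => simp
  | hadd a a' h h' => simp only [mul_add, h, h']
  | hbox t D =>
  simp only [smul_mul_assoc, mul_smul_comm]
  congr 3
  by_cases h1 : T.vBox.tgt A = T.vBox.src C
  · by_cases h2 : T.vBox.tgt C = T.vBox.src D
    · rw [box_mul_box_of h1, box_mul_box_of h2, smul_mul_assoc, mul_smul_comm,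
        box_mul_box_of (by rw [T.vBox.tgt_comp _ _ h1, h2]),
        box_mul_box_of (by rw [T.vBox.src_comp _ _ h2, h1]), T.vBox.assoc _ _ _ h1 h2,
        smul_smul, smul_smul, ← Units.val_mul, ← Units.val_mul, c.σ_cocycle _ _ _ h1 h2]
    · rw [box_mul_box_of h1, box_mul_box_of_ne h2, smul_mul_assoc,
        box_mul_box_of_ne (by rwa [T.vBox.tgt_comp _ _ h1]), smul_zero, mul_zero]
  · by_cases h2 : T.vBox.tgt C = T.vBox.src D
    · rw [box_mul_box_of_ne h1, box_mul_box_of h2, mul_smul_comm,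
        box_mul_box_of_ne (by rwa [T.vBox.src_comp _ _ h2]), smul_zero, zero_mul]
    · rw [box_mul_box_of_ne h1, box_mul_box_of_ne h2, zero_mul, mul_zero]

variable [Fintype H]

/-- The unit is the sum of the vertical identities. -/
instance (priority := low) : One (TwistedAlg T c) := ⟨∑ x : H, box c (T.vBox.one x)⟩

lemma one_def : (1 : TwistedAlg T c) = ∑ x : H, box c (T.vBox.one x) := rfl

lemma one_mul' (a : TwistedAlg T c) : 1 * a = a := by
  induction a using induction with
  | h0 => simp
  | hadd a a' h h' => simp only [mul_add, h, h']
  | hbox r A =>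
    rw [mul_smul_comm, one_def, Finset.sum_mul, Finset.sum_eq_single (T.vBox.src A)]
    · rw [box_mul_box_of (T.vBox.tgt_one _), c.σ_vone_left, T.vBox.one_comp, Units.val_one, one_smul]
    · intro x _ hx
      rw [box_mul_box_of_ne (by rwa [T.vBox.tgt_one])]
    · simp

lemma mul_one' (a : TwistedAlg T c) : a * 1 = a := by
  induction a using induction with
  | h0 => simp
  | hadd a a' h h' => simp only [add_mul, h, h']
  | hbox r A =>
    rw [smul_mul_assoc, one_def, Finset.mul_sum, Finset.sum_eq_single (T.vBox.tgt A)]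
    · rw [box_mul_box_of (T.vBox.src_one _).symm, c.σ_vone_right, T.vBox.comp_one, Units.val_one,
        one_smul]
    · intro x _ hx
      rw [box_mul_box_of_ne (by rw [T.vBox.src_one]; exact hx.symm)]
    · simp

instance : Ring (TwistedAlg T c) :=
  { (inferInstance : NonUnitalNonAssocRing (TwistedAlg T c)) with
    one := 1
    mul_assoc := mul_assoc'
    one_mul := one_mul'
    mul_one := mul_one' }

instance : Algebra k (TwistedAlg T c) :=
  Algebra.ofModule (fun r a b => smul_mul_assoc r a b) (fun r a b => mul_smul_comm r a b)

variable [Fintype B]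

instance : FiniteDimensional k (TwistedAlg T c) :=
  inferInstanceAs (FiniteDimensional k (B →₀ k))

end TwistedAlg

namespace TwistedAlg
variable {B H V P : Type u} {T : VacantDoubleGroupoid B H V P} {k : Type u} [Field k]
  {c : T.Cocycle k}

/-- If both factors of a horizontal composition are horizontal identities, they agree with it. -/
lemma eq_of_isHOne {X Y A : B} (h : T.hBox.tgt X = T.hBox.src Y) (e : T.hBox.comp X Y = A)
    (hX : T.IsHOne X) (hY : T.IsHOne Y) : X = A ∧ Y = A := by
  have h1 : Y = A := by rw [← e, hX, ← hX.tgt, h, T.hBox.one_comp]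
  have h2 : X = A := by rw [← e, hY, ← h, T.hBox.comp_one]
  exact ⟨h2, h1⟩

variable [Fintype H]

lemma vone_mul_vone_self (x : H) : box c (T.vBox.one x) * box c (T.vBox.one x) =
    box c (T.vBox.one x) := by
  rw [box_mul_box_of (by rw [T.vBox.tgt_one, T.vBox.src_one])]
  have h1 := c.σ_vone_left (T.vBox.one x)
  have h2 := T.vBox.one_comp (T.vBox.one x)
  rw [T.vBox.src_one] at h1 h2
  rw [h1, h2, Units.val_one, one_smul]

lemma vone_mul_vone_ne {x y : H} (h : x ≠ y) :
    box c (T.vBox.one x) * box c (T.vBox.one y) = 0 :=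
  box_mul_box_of_ne (by rwa [T.vBox.tgt_one, T.vBox.src_one])

lemma mulLeft_add (a b : TwistedAlg T c) :
    LinearMap.mulLeft k (a + b) = LinearMap.mulLeft k a + LinearMap.mulLeft k b :=
  LinearMap.ext fun x => add_mul a b x

lemma mulRight_add (a b : TwistedAlg T c) :
    LinearMap.mulRight k (a + b) = LinearMap.mulRight k a + LinearMap.mulRight k b :=
  LinearMap.ext fun x => mul_add x a b

lemma mulLeft_smul (r : k) (a : TwistedAlg T c) :
    LinearMap.mulLeft k (r • a) = r • LinearMap.mulLeft k a :=
  LinearMap.ext fun x => smul_mul_assoc r a x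

lemma mulRight_smul (r : k) (a : TwistedAlg T c) :
    LinearMap.mulRight k (r • a) = r • LinearMap.mulRight k a :=
  LinearMap.ext fun x => mul_smul_comm r x a

lemma sum_mul_sum_three {α β : Type*} [Fintype α] [Fintype β]
    (f : α → TwistedAlg T c ⊗[k] (TwistedAlg T c ⊗[k] TwistedAlg T c))
    (g : β → TwistedAlg T c ⊗[k] (TwistedAlg T c ⊗[k] TwistedAlg T c)) :
    (∑ i, f i) * (∑ j, g j) = ∑ i, ∑ j, f i * g j :=
  Finset.sum_mul_sum Finset.univ Finset.univ f g

variable [Fintype B]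

open Classical in
variable (c) in
/-- `Δ(A) = ∑ τ(X, Y) X ⊗ Y`, the sum over all pairs of boxes with `X | Y` and `XY = A`. -/
def comulBox (A : B) : TwistedAlg T c ⊗[k] TwistedAlg T c :=
  ∑ X : B, ∑ Y : B, if T.hBox.tgt X = T.hBox.src Y ∧ T.hBox.comp X Y = A then
    (c.τ X Y : k) • (box c X ⊗ₜ[k] box c Y) else 0

open Classical in
/-- `ε(A) = 1` if `A` is a horizontal identity, and `0` otherwise. -/
def counitBox (_c : T.Cocycle k) (A : B) : k := if T.IsHOne A then 1 else 0

instance : CoalgebraStruct k (TwistedAlg T c) where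
  comul := lift c (comulBox c)
  counit := lift c (counitBox c)

open Coalgebra

lemma comul_box (A : B) : comul (R := k) (box c A) = comulBox c A := lift_box _ _

lemma counit_box (A : B) : counit (R := k) (box c A) = counitBox c A := lift_box _ _

open Classical in
lemma coassoc_box (A : B) : TensorProduct.assoc k _ _ _ (comul.rTensor (TwistedAlg T c)
    (comul (R := k) (box c A))) = comul.lTensor (TwistedAlg T c) (comul (R := k) (box c A)) := by
  have h1 : TensorProduct.assoc k _ _ _ (comul.rTensor (TwistedAlg T c)
      (comul (R := k) (box c A))) = ∑ X : B, ∑ Y : B, ∑ Z : B,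
      if T.hBox.tgt X = T.hBox.src Y ∧ T.hBox.tgt Y = T.hBox.src Z ∧
        T.hBox.comp (T.hBox.comp X Y) Z = A then
        ((c.τ X Y * c.τ (T.hBox.comp X Y) Z : kˣ) : k) •
          (box c X ⊗ₜ[k] (box c Y ⊗ₜ[k] box c Z)) else 0 := by
    calc _ = ∑ W : B, ∑ Z : B, ∑ X : B, ∑ Y : B,
          if (T.hBox.tgt W = T.hBox.src Z ∧ T.hBox.comp W Z = A) ∧
            (T.hBox.tgt X = T.hBox.src Y ∧ T.hBox.comp X Y = W) then
            ((c.τ X Y * c.τ W Z : kˣ) : k) • (box c X ⊗ₜ[k] (box c Y ⊗ₜ[k] box c Z)) else 0 := by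
          rw [comul_box, comulBox]
          simp only [map_sum]
          refine Finset.sum_congr rfl fun W _ => Finset.sum_congr rfl fun Z _ => ?_
          split_ifs with h
          · rw [map_smul, map_smul, LinearMap.rTensor_tmul, comul_box, comulBox]
            simp only [TensorProduct.sum_tmul, map_sum, Finset.smul_sum]
            refine Finset.sum_congr rfl fun X _ => Finset.sum_congr rfl fun Y _ => ?_
            by_cases h' : T.hBox.tgt X = T.hBox.src Y ∧ T.hBox.comp X Y = W
            · rw [if_pos h', if_pos ⟨h, h'⟩, ← TensorProduct.smul_tmul', map_smul,
                TensorProduct.assoc_tmul, smul_smul, Units.val_mul, mul_comm]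
            · rw [if_neg h', if_neg (fun h2 => h' h2.2)]
              simp
          · simp [h]
      _ = ∑ X : B, ∑ Y : B, ∑ Z : B, ∑ W : B,
          if (T.hBox.tgt W = T.hBox.src Z ∧ T.hBox.comp W Z = A) ∧
            (T.hBox.tgt X = T.hBox.src Y ∧ T.hBox.comp X Y = W) then
            ((c.τ X Y * c.τ W Z : kˣ) : k) • (box c X ⊗ₜ[k] (box c Y ⊗ₜ[k] box c Z)) else 0 := by
          rw [Finset.sum_comm' (t' := Finset.univ) (s' := fun _ => Finset.univ) (by simp)]
          have : ∀ Z : B, ∑ W : B, ∑ X : B, ∑ Y : B, (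
              if (T.hBox.tgt W = T.hBox.src Z ∧ T.hBox.comp W Z = A) ∧
              (T.hBox.tgt X = T.hBox.src Y ∧ T.hBox.comp X Y = W) then
              ((c.τ X Y * c.τ W Z : kˣ) : k) • (box c X ⊗ₜ[k] (box c Y ⊗ₜ[k] box c Z)) else 0) =
              ∑ X : B, ∑ Y : B, ∑ W : B, (
              if (T.hBox.tgt W = T.hBox.src Z ∧ T.hBox.comp W Z = A) ∧
              (T.hBox.tgt X = T.hBox.src Y ∧ T.hBox.comp X Y = W) then
              ((c.τ X Y * c.τ W Z : kˣ) : k) • (box c X ⊗ₜ[k] (box c Y ⊗ₜ[k] box c Z)) else 0) := by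
            intro Z
            rw [Finset.sum_comm]
            exact Finset.sum_congr rfl fun X _ => Finset.sum_comm
          simp only [this]
          rw [Finset.sum_comm]
          exact Finset.sum_congr rfl fun X _ => Finset.sum_comm
      _ = _ := by
          refine Finset.sum_congr rfl fun X _ => Finset.sum_congr rfl fun Y _ =>
            Finset.sum_congr rfl fun Z _ => ?_
          rw [Finset.sum_eq_single (T.hBox.comp X Y)]
          · by_cases h : T.hBox.tgt X = T.hBox.src Y
            · simp [h, T.hBox.tgt_comp _ _ h]
            · simp [h]
          · intro W _ hW
            rw [if_neg (fun h => hW h.2.2.symm)]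
          · simp
  have h2 : comul.lTensor (TwistedAlg T c) (comul (R := k) (box c A)) = ∑ X : B, ∑ Y : B, ∑ Z : B,
      if T.hBox.tgt X = T.hBox.src Y ∧ T.hBox.tgt Y = T.hBox.src Z ∧
        T.hBox.comp X (T.hBox.comp Y Z) = A then
        ((c.τ Y Z * c.τ X (T.hBox.comp Y Z) : kˣ) : k) •
          (box c X ⊗ₜ[k] (box c Y ⊗ₜ[k] box c Z)) else 0 := by
    calc _ = ∑ X : B, ∑ W : B, ∑ Y : B, ∑ Z : B,
          if (T.hBox.tgt X = T.hBox.src W ∧ T.hBox.comp X W = A) ∧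
            (T.hBox.tgt Y = T.hBox.src Z ∧ T.hBox.comp Y Z = W) then
            ((c.τ Y Z * c.τ X W : kˣ) : k) • (box c X ⊗ₜ[k] (box c Y ⊗ₜ[k] box c Z)) else 0 := by
          rw [comul_box, comulBox]
          simp only [map_sum]
          refine Finset.sum_congr rfl fun X _ => Finset.sum_congr rfl fun W _ => ?_
          split_ifs with h
          · rw [map_smul, LinearMap.lTensor_tmul, comul_box, comulBox]
            simp only [TensorProduct.tmul_sum, Finset.smul_sum]
            refine Finset.sum_congr rfl fun Y _ => Finset.sum_congr rfl fun Z _ => ?_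
            by_cases h' : T.hBox.tgt Y = T.hBox.src Z ∧ T.hBox.comp Y Z = W
            · rw [if_pos h', if_pos ⟨h, h'⟩, TensorProduct.tmul_smul, smul_smul, Units.val_mul,
                mul_comm]
            · rw [if_neg h', if_neg (fun h2 => h' h2.2)]
              simp
          · simp [h]
      _ = ∑ X : B, ∑ Y : B, ∑ Z : B, ∑ W : B,
          if (T.hBox.tgt X = T.hBox.src W ∧ T.hBox.comp X W = A) ∧
            (T.hBox.tgt Y = T.hBox.src Z ∧ T.hBox.comp Y Z = W) then
            ((c.τ Y Z * c.τ X W : kˣ) : k) • (box c X ⊗ₜ[k] (box c Y ⊗ₜ[k] box c Z)) else 0 := by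
          refine Finset.sum_congr rfl fun X _ => ?_
          rw [Finset.sum_comm]
          exact Finset.sum_congr rfl fun X _ => Finset.sum_comm
      _ = _ := by
          refine Finset.sum_congr rfl fun X _ => Finset.sum_congr rfl fun Y _ =>
            Finset.sum_congr rfl fun Z _ => ?_
          rw [Finset.sum_eq_single (T.hBox.comp Y Z)]
          · by_cases h : T.hBox.tgt Y = T.hBox.src Z
            · simp [h, T.hBox.src_comp _ _ h]
            · simp [h]
          · intro W _ hW
            rw [if_neg (fun h => hW h.2.2.symm)]
          · simp
  rw [h1, h2]
  refine Finset.sum_congr rfl fun X _ => Finset.sum_congr rfl fun Y _ =>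
    Finset.sum_congr rfl fun Z _ => ?_
  by_cases hXY : T.hBox.tgt X = T.hBox.src Y
  · by_cases hYZ : T.hBox.tgt Y = T.hBox.src Z
    · rw [T.hBox.assoc _ _ _ hXY hYZ, c.τ_cocycle _ _ _ hXY hYZ]
    · simp [hYZ]
  · simp [hXY]

lemma rTensor_counit_box (A : B) : counit.rTensor (TwistedAlg T c) (comul (R := k) (box c A)) =
    (1 : k) ⊗ₜ[k] box c A := by
  rw [comul_box, comulBox]
  simp only [map_sum]
  rw [Finset.sum_eq_single (T.hBox.one (T.hBox.src A)), Finset.sum_eq_single A]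
  · rw [if_pos ⟨T.hBox.tgt_one _, T.hBox.one_comp A⟩, c.τ_hone_left, Units.val_one, one_smul,
      LinearMap.rTensor_tmul, counit_box, counitBox, if_pos (T.isHOne_hone _)]
  · intro Y _ hY
    rw [if_neg, map_zero]
    rintro ⟨h1, h2⟩
    rw [T.hBox.tgt_one] at h1
    rw [h1, T.hBox.one_comp] at h2
    exact hY h2
  · simp
  · intro X _ hX
    refine Finset.sum_eq_zero fun Y _ => ?_
    split_ifs with h
    · rw [map_smul, LinearMap.rTensor_tmul, counit_box, counitBox, if_neg, TensorProduct.zero_tmul,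
        smul_zero]
      intro h'
      apply hX
      rw [← h.2, T.hBox.src_comp _ _ h.1]
      exact h'
    · simp
  · simp

lemma lTensor_counit_box (A : B) : counit.lTensor (TwistedAlg T c) (comul (R := k) (box c A)) =
    box c A ⊗ₜ[k] (1 : k) := by
  rw [comul_box, comulBox]
  simp only [map_sum]
  rw [Finset.sum_eq_single A, Finset.sum_eq_single (T.hBox.one (T.hBox.tgt A))]
  · rw [if_pos ⟨(T.hBox.src_one _).symm, T.hBox.comp_one A⟩, c.τ_hone_right, Units.val_one, one_smul,
      LinearMap.lTensor_tmul, counit_box, counitBox, if_pos (T.isHOne_hone _)]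
  · intro Y _ hY
    split_ifs with h
    · rw [map_smul, LinearMap.lTensor_tmul, counit_box, counitBox, if_neg, TensorProduct.tmul_zero,
        smul_zero]
      intro h'
      apply hY
      rw [h.1]
      exact h'
    · simp
  · simp
  · intro X _ hX
    refine Finset.sum_eq_zero fun Y _ => ?_
    split_ifs with h
    · rw [map_smul, LinearMap.lTensor_tmul, counit_box, counitBox, if_neg, TensorProduct.tmul_zero,
        smul_zero]
      intro h'
      apply hX
      rw [← h.2, h', ← h.1, T.hBox.comp_one]
    · simp
  · simp

instance : Coalgebra k (TwistedAlg T c) where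
  coassoc := hom_ext coassoc_box
  rTensor_counit_comp_comul := hom_ext rTensor_counit_box
  lTensor_counit_comp_comul := hom_ext lTensor_counit_box

open Classical in
lemma comul_mul_box (A C : B) : comul (R := k) (box c A * box c C) =
    comul (R := k) (box c A) * comul (R := k) (box c C) := by
  have hR : comul (R := k) (box c A) * comul (R := k) (box c C) =
      ∑ q : (B × B) × (B × B), if (T.hBox.tgt q.1.1 = T.hBox.src q.1.2 ∧
        T.hBox.comp q.1.1 q.1.2 = A) ∧ (T.hBox.tgt q.2.1 = T.hBox.src q.2.2 ∧
        T.hBox.comp q.2.1 q.2.2 = C) ∧ T.vBox.tgt q.1.1 = T.vBox.src q.2.1 ∧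
        T.vBox.tgt q.1.2 = T.vBox.src q.2.2 then
        ((c.τ q.1.1 q.1.2 * c.τ q.2.1 q.2.2 * c.σ q.1.1 q.2.1 * c.σ q.1.2 q.2.2 : kˣ) : k) •
          (box c (T.vBox.comp q.1.1 q.2.1) ⊗ₜ[k] box c (T.vBox.comp q.1.2 q.2.2)) else 0 := by
    rw [comul_box, comul_box, comulBox, comulBox, ← Fintype.sum_prod_type', ← Fintype.sum_prod_type',
      Finset.sum_mul_sum, ← Fintype.sum_prod_type']
    refine Finset.sum_congr rfl fun q _ => ?_
    by_cases h1 : T.hBox.tgt q.1.1 = T.hBox.src q.1.2 ∧ T.hBox.comp q.1.1 q.1.2 = A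
    · by_cases h2 : T.hBox.tgt q.2.1 = T.hBox.src q.2.2 ∧ T.hBox.comp q.2.1 q.2.2 = C
      · rw [if_pos h1, if_pos h2, smul_mul_smul_comm, Algebra.TensorProduct.tmul_mul_tmul]
        by_cases h3 : T.vBox.tgt q.1.1 = T.vBox.src q.2.1
        · by_cases h4 : T.vBox.tgt q.1.2 = T.vBox.src q.2.2
          · rw [if_pos ⟨h1, h2, h3, h4⟩, box_mul_box_of h3, box_mul_box_of h4,
              TensorProduct.smul_tmul_smul, smul_smul]
            congr 1
            push_cast
            ring
          · rw [if_neg (fun h => h4 h.2.2.2), box_mul_box_of_ne h4, TensorProduct.tmul_zero,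
              smul_zero]
        · rw [if_neg (fun h => h3 h.2.2.1), box_mul_box_of_ne h3, TensorProduct.zero_tmul,
            smul_zero]
      · rw [if_neg h2, mul_zero, if_neg (fun h => h2 h.2.1)]
    · rw [if_neg h1, zero_mul, if_neg (fun h => h1 h.1)]
  rw [hR]
  by_cases hAC : T.vBox.tgt A = T.vBox.src C
  · rw [box_mul_box_of hAC, map_smul, comul_box, comulBox, ← Fintype.sum_prod_type',
      Finset.smul_sum, ← Finset.sum_filter]
    simp only [smul_ite, smul_zero]
    rw [← Finset.sum_filter]
    symm
    refine Finset.sum_nbij (fun q => (T.vBox.comp q.1.1 q.2.1, T.vBox.comp q.1.2 q.2.2)) ?_ ?_ ?_ ?_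
    · rintro ⟨⟨X, Y⟩, ⟨R, S⟩⟩ hq
      simp only [Finset.mem_filter, Finset.mem_univ, true_and] at hq ⊢
      obtain ⟨⟨h1, h2⟩, ⟨h3, h4⟩, h5, h6⟩ := hq
      refine ⟨?_, ?_⟩
      · rw [T.right_vcomp _ _ h5, T.left_vcomp _ _ h6, h1, h3]
      · rw [← T.interchange _ _ _ _ h1 h3 h5 h6, h2, h4]
    · rintro ⟨⟨X, Y⟩, ⟨R, S⟩⟩ hq ⟨⟨X', Y'⟩, ⟨R', S'⟩⟩ hq' he
      simp only [Finset.coe_filter, Finset.mem_univ, true_and, Set.mem_ofPred_eq] at hq hq'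
      obtain ⟨⟨h1, h2⟩, ⟨h3, h4⟩, h5, h6⟩ := hq
      obtain ⟨⟨h1', h2'⟩, ⟨h3', h4'⟩, h5', h6'⟩ := hq'
      simp only [Prod.mk.injEq] at he
      obtain ⟨e1, e2⟩ := he
      have eX : X = X' := by
        apply T.ext_top_left
        · rw [← T.vBox.src_comp _ _ h5, e1, T.vBox.src_comp _ _ h5']
        · rw [← T.hBox.src_comp _ _ h1, h2, ← h2', T.hBox.src_comp _ _ h1']
      subst eX
      obtain rfl : Y = Y' := T.hBox.left_cancel h1 h1' (h2.trans h2'.symm)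
      obtain rfl : R = R' := T.vBox.left_cancel h5 h5' e1
      obtain rfl : S = S' := T.vBox.left_cancel h6 h6' e2
      rfl
    · rintro ⟨U, W⟩ hUW
      simp only [Finset.coe_filter, Finset.mem_univ, true_and, Set.mem_ofPred_eq] at hUW
      obtain ⟨h1, h2⟩ := hUW
      have hlA : T.ver.tgt (T.hBox.src A) = T.ver.src (T.hBox.src C) := by
        rw [T.bot_left, T.top_left, hAC]
      have hU : T.hBox.src U = T.ver.comp (T.hBox.src A) (T.hBox.src C) := by
        rw [← T.left_vcomp _ _ hAC, ← h2, T.hBox.src_comp _ _ h1]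
      obtain ⟨X, hX1, hX2⟩ := T.exists_top_left (T.vBox.src U) (T.hBox.src A)
        (by rw [← T.top_left, hU, T.ver.src_comp _ _ hlA])
      set R := T.vBox.comp (T.vBox.inv X) U with hRdef
      have hXU : T.vBox.tgt (T.vBox.inv X) = T.vBox.src U := by rw [T.vBox.tgt_inv, hX1]
      have hXR : T.vBox.tgt X = T.vBox.src R := by
        rw [hRdef, T.vBox.src_comp _ _ hXU, T.vBox.src_inv]
      have eU : T.vBox.comp X R = U := T.vBox.comp_inv_cancel hX1
      have hR2 : T.hBox.src R = T.hBox.src C := by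
        rw [hRdef, T.left_vcomp _ _ hXU, T.left_vinv, hX2, hU, T.ver.inv_comp_cancel hlA]
      set Y := T.hBox.comp (T.hBox.inv X) A with hYdef
      set S := T.hBox.comp (T.hBox.inv R) C with hSdef
      have hXA : T.hBox.tgt (T.hBox.inv X) = T.hBox.src A := by rw [T.hBox.tgt_inv, hX2]
      have hRC : T.hBox.tgt (T.hBox.inv R) = T.hBox.src C := by rw [T.hBox.tgt_inv, hR2]
      have hXY : T.hBox.tgt X = T.hBox.src Y := by
        rw [hYdef, T.hBox.src_comp _ _ hXA, T.hBox.src_inv]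
      have hRS : T.hBox.tgt R = T.hBox.src S := by
        rw [hSdef, T.hBox.src_comp _ _ hRC, T.hBox.src_inv]
      have eA : T.hBox.comp X Y = A := T.hBox.comp_inv_cancel hX2
      have eC : T.hBox.comp R S = C := T.hBox.comp_inv_cancel hR2
      have hYS : T.vBox.tgt Y = T.vBox.src S := by
        rw [hYdef, T.bot_hcomp _ _ hXA, hSdef, T.top_hcomp _ _ hRC, T.bot_hinv, T.top_hinv, hXR,
          hAC]
      have eW : T.vBox.comp Y S = W := by
        have := T.interchange _ _ _ _ hXY hRS hXR hYS
        rw [eA, eC, eU, ← h2] at this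
        refine (T.hBox.left_cancel h1 ?_ this).symm
        rw [← eU, T.right_vcomp _ _ hXR, T.left_vcomp _ _ hYS, hXY, hRS]
      refine ⟨((X, Y), (R, S)), ?_, ?_⟩
      · simp only [Finset.coe_filter, Finset.mem_univ, true_and, Set.mem_ofPred_eq]
        exact ⟨⟨hXY, eA⟩, ⟨hRS, eC⟩, hXR, hYS⟩
      · simp only [eU, eW]
    · rintro ⟨⟨X, Y⟩, ⟨R, S⟩⟩ hq
      simp only [Finset.mem_filter, Finset.mem_univ, true_and] at hq ⊢
      obtain ⟨⟨h1, h2⟩, ⟨h3, h4⟩, h5, h6⟩ := hq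
      rw [← c.compat _ _ _ _ h1 h3 h5 h6, h2, h4, smul_smul, Units.val_mul]
  · rw [box_mul_box_of_ne hAC, map_zero]
    symm
    refine Finset.sum_eq_zero fun q _ => if_neg ?_
    rintro ⟨⟨h1, h2⟩, ⟨h3, h4⟩, h5, h6⟩
    apply hAC
    rw [← h2, ← h4, T.bot_hcomp _ _ h1, T.top_hcomp _ _ h3, h5, h6]

lemma comul_mul' (a b : TwistedAlg T c) :
    comul (R := k) (a * b) = comul (R := k) a * comul (R := k) b := by
  induction a using induction with
  | h0 => simp
  | hadd a a' h h' => simp only [add_mul, map_add, h, h']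
  | hbox r A =>
  induction b using induction with
  | h0 => simp
  | hadd a a' h h' => simp only [mul_add, map_add, h, h']
  | hbox s C =>
  simp only [smul_mul_assoc, mul_smul_comm, map_smul, comul_mul_box]

open Classical in
lemma comul_vone (z : H) : comul (R := k) (box c (T.vBox.one z)) =
    ∑ x : H, ∑ y : H, if T.hor.tgt x = T.hor.src y ∧ T.hor.comp x y = z then
      box c (T.vBox.one x) ⊗ₜ[k] box c (T.vBox.one y) else 0 := by
  rw [comul_box, comulBox, ← Fintype.sum_prod_type', ← Fintype.sum_prod_type',
    ← Finset.sum_filter, ← Finset.sum_filter]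
  symm
  refine Finset.sum_nbij (fun q => (T.vBox.one q.1, T.vBox.one q.2)) ?_ ?_ ?_ ?_
  · rintro ⟨x, y⟩ hq
    simp only [Finset.mem_filter, Finset.mem_univ, true_and] at hq ⊢
    rw [T.right_vone, T.left_vone, hq.1, T.hcomp_vone _ _ hq.1, hq.2]
    exact ⟨rfl, rfl⟩
  · rintro ⟨x, y⟩ - ⟨x', y'⟩ - he
    simp only [Prod.mk.injEq] at he
    rw [← T.vBox.src_one x, ← T.vBox.src_one y, he.1, he.2, T.vBox.src_one, T.vBox.src_one]
  · rintro ⟨X, Y⟩ hq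
    simp only [Finset.coe_filter, Finset.mem_univ, true_and, Set.mem_ofPred_eq] at hq
    obtain ⟨h1, h2⟩ := T.eq_vone_of_hcomp hq.1 hq.2
    refine ⟨(T.vBox.src X, T.vBox.src Y), ?_, ?_⟩
    · simp only [Finset.coe_filter, Finset.mem_univ, true_and, Set.mem_ofPred_eq]
      refine ⟨by rw [← T.top_right, ← T.top_left, hq.1], ?_⟩
      rw [← T.top_hcomp _ _ hq.1, hq.2, T.vBox.src_one]
    · simp only [← h1, ← h2]
  · rintro ⟨x, y⟩ hq
    simp only [Finset.mem_filter, Finset.mem_univ, true_and] at hq ⊢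
    rw [VacantDoubleGroupoid.τ_vone c hq.1, Units.val_one, one_smul]

open Classical in
lemma comul_one : comul (R := k) (1 : TwistedAlg T c) =
    ∑ x : H, ∑ y : H, if T.hor.tgt x = T.hor.src y then
      box c (T.vBox.one x) ⊗ₜ[k] box c (T.vBox.one y) else 0 := by
  rw [one_def, map_sum]
  simp only [comul_vone]
  rw [Finset.sum_comm]
  refine Finset.sum_congr rfl fun x _ => ?_
  rw [Finset.sum_comm]
  refine Finset.sum_congr rfl fun y _ => ?_
  rw [Finset.sum_eq_single (T.hor.comp x y)]
  · simp
  · intro z _ hz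
    rw [if_neg (fun h => hz h.2.symm)]
  · simp

open Classical in
lemma comul_comul_one_eq : comul.lTensor (TwistedAlg T c) (comul (R := k) (1 : TwistedAlg T c)) =
    ∑ x : H, ∑ y : H, ∑ z : H, if T.hor.tgt x = T.hor.src y ∧ T.hor.tgt y = T.hor.src z then
      box c (T.vBox.one x) ⊗ₜ[k] (box c (T.vBox.one y) ⊗ₜ[k] box c (T.vBox.one z)) else 0 := by
  rw [comul_one]
  simp only [map_sum]
  refine Finset.sum_congr rfl fun x _ => ?_
  calc _ = ∑ w : H, ∑ y : H, ∑ z : H, if T.hor.tgt x = T.hor.src w ∧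
        (T.hor.tgt y = T.hor.src z ∧ T.hor.comp y z = w) then
        box c (T.vBox.one x) ⊗ₜ[k] (box c (T.vBox.one y) ⊗ₜ[k] box c (T.vBox.one z)) else 0 := by
        refine Finset.sum_congr rfl fun w _ => ?_
        by_cases h : T.hor.tgt x = T.hor.src w
        · rw [if_pos h, LinearMap.lTensor_tmul, comul_vone]
          simp only [TensorProduct.tmul_sum]
          refine Finset.sum_congr rfl fun y _ => Finset.sum_congr rfl fun z _ => ?_
          by_cases h' : T.hor.tgt y = T.hor.src z ∧ T.hor.comp y z = w
          · rw [if_pos h', if_pos ⟨h, h'⟩]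
          · rw [if_neg h', if_neg (fun h2 => h' h2.2), TensorProduct.tmul_zero]
        · simp [h]
    _ = _ := by
        rw [Finset.sum_comm]
        refine Finset.sum_congr rfl fun y _ => ?_
        rw [Finset.sum_comm]
        refine Finset.sum_congr rfl fun z _ => ?_
        rw [Finset.sum_eq_single (T.hor.comp y z)]
        · by_cases h : T.hor.tgt y = T.hor.src z
          · simp [h, T.hor.src_comp _ _ h]
          · simp [h]
        · intro w _ hw
          rw [if_neg (fun h => hw h.2.2.symm)]
        · simp

open Classical in
lemma assoc_comul_one_tmul : TensorProduct.assoc k _ _ _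
    (comul (R := k) (1 : TwistedAlg T c) ⊗ₜ[k] (1 : TwistedAlg T c)) =
    ∑ x : H, ∑ y : H, if T.hor.tgt x = T.hor.src y then
      box c (T.vBox.one x) ⊗ₜ[k] (box c (T.vBox.one y) ⊗ₜ[k] (1 : TwistedAlg T c)) else 0 := by
  rw [comul_one]
  simp only [TensorProduct.sum_tmul, map_sum]
  refine Finset.sum_congr rfl fun x _ => Finset.sum_congr rfl fun y _ => ?_
  split_ifs <;> simp

open Classical in
lemma tmul_comul_one : (1 : TwistedAlg T c) ⊗ₜ[k] comul (R := k) (1 : TwistedAlg T c) =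
    ∑ x : H, ∑ y : H, if T.hor.tgt x = T.hor.src y then
      (1 : TwistedAlg T c) ⊗ₜ[k] (box c (T.vBox.one x) ⊗ₜ[k] box c (T.vBox.one y)) else 0 := by
  rw [comul_one]
  simp only [TensorProduct.tmul_sum]
  refine Finset.sum_congr rfl fun x _ => Finset.sum_congr rfl fun y _ => ?_
  split_ifs <;> simp

lemma weak_unit : comul.lTensor (TwistedAlg T c) (comul (R := k) (1 : TwistedAlg T c)) =
    TensorProduct.assoc k _ _ _
      (comul (R := k) (1 : TwistedAlg T c) ⊗ₜ[k] (1 : TwistedAlg T c)) *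
      ((1 : TwistedAlg T c) ⊗ₜ[k] comul (R := k) (1 : TwistedAlg T c)) := by
  classical
  rw [comul_comul_one_eq, assoc_comul_one_tmul, tmul_comul_one]
  conv_rhs => rw [← Fintype.sum_prod_type', ← Fintype.sum_prod_type', sum_mul_sum_three,
    Fintype.sum_prod_type]
  refine Finset.sum_congr rfl fun x _ => Finset.sum_congr rfl fun y _ => ?_
  symm
  rw [Fintype.sum_prod_type, Finset.sum_eq_single y]
  · refine Finset.sum_congr rfl fun z _ => ?_
    by_cases h1 : T.hor.tgt x = T.hor.src y
    · by_cases h2 : T.hor.tgt y = T.hor.src z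
      · simp [h1, h2, vone_mul_vone_self]
      · simp [h2]
    · simp [h1]
  · intro y' _ hy
    refine Finset.sum_eq_zero fun z _ => ?_
    split_ifs <;> simp [vone_mul_vone_ne (c := c) hy.symm]
  · simp

lemma weak_unit' : comul.lTensor (TwistedAlg T c) (comul (R := k) (1 : TwistedAlg T c)) =
    ((1 : TwistedAlg T c) ⊗ₜ[k] comul (R := k) (1 : TwistedAlg T c)) *
      TensorProduct.assoc k _ _ _
      (comul (R := k) (1 : TwistedAlg T c) ⊗ₜ[k] (1 : TwistedAlg T c)) := by
  classical
  have : TensorProduct.assoc k _ _ _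
      (comul (R := k) (1 : TwistedAlg T c) ⊗ₜ[k] (1 : TwistedAlg T c)) *
      ((1 : TwistedAlg T c) ⊗ₜ[k] comul (R := k) (1 : TwistedAlg T c)) =
      ((1 : TwistedAlg T c) ⊗ₜ[k] comul (R := k) (1 : TwistedAlg T c)) *
      TensorProduct.assoc k _ _ _
      (comul (R := k) (1 : TwistedAlg T c) ⊗ₜ[k] (1 : TwistedAlg T c)) := by
    rw [assoc_comul_one_tmul, tmul_comul_one]
    simp only [← Fintype.sum_prod_type']
    rw [sum_mul_sum_three, sum_mul_sum_three, Finset.sum_comm]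
    refine Finset.sum_congr rfl fun q _ => Finset.sum_congr rfl fun r _ => ?_
    by_cases h : r.2 = q.1
    · split_ifs <;> simp [h]
    · split_ifs <;> simp [vone_mul_vone_ne (c := c) h, vone_mul_vone_ne (c := c) (Ne.symm h)]
  rw [weak_unit, this]

open Classical in
lemma counit_mul_box (A C : B) : counit (R := k) (box c A * box c C) =
    if T.vBox.tgt A = T.vBox.src C ∧ T.IsHOne A ∧ T.IsHOne C then 1 else 0 := by
  by_cases h : T.vBox.tgt A = T.vBox.src C
  · rw [box_mul_box_of h, map_smul, counit_box, counitBox, T.isHOne_vcomp h]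
    by_cases h' : T.IsHOne A ∧ T.IsHOne C
    · rw [if_pos h', if_pos ⟨h, h'⟩, VacantDoubleGroupoid.σ_isHOne c h h'.1 h'.2]
      simp
    · rw [if_neg h', if_neg (fun h2 => h' h2.2), smul_zero]
  · rw [box_mul_box_of_ne h, map_zero, if_neg (fun h2 => h h2.1)]

open Classical in
lemma counit_mul_mul_box (A C D : B) : counit (R := k) (box c A * box c C * box c D) =
    if (T.vBox.tgt A = T.vBox.src C ∧ T.vBox.tgt C = T.vBox.src D) ∧
      T.IsHOne A ∧ T.IsHOne C ∧ T.IsHOne D then 1 else 0 := by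
  by_cases h : T.vBox.tgt A = T.vBox.src C
  · rw [box_mul_box_of h, smul_mul_assoc, map_smul, counit_mul_box, T.isHOne_vcomp h,
      T.vBox.tgt_comp _ _ h]
    by_cases h' : T.IsHOne A ∧ T.IsHOne C
    · rw [VacantDoubleGroupoid.σ_isHOne c h h'.1 h'.2]
      simp [h, h']
    · rw [if_neg (fun h2 => h' h2.2.1), if_neg (fun h2 => h' ⟨h2.2.1, h2.2.2.1⟩), smul_zero]
  · rw [box_mul_box_of_ne h, zero_mul, map_zero, if_neg (fun h2 => h h2.1.1)]

lemma sum_counit (F : B → B → k) (hF : ∀ X Y, F X Y ≠ 0 → T.IsHOne X ∧ T.IsHOne Y) (C : B)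
    (φ : TwistedAlg T c ⊗[k] TwistedAlg T c →ₗ[k] k)
    (hφ : ∀ X Y, φ (box c X ⊗ₜ[k] box c Y) = F X Y) :
    φ (comul (R := k) (box c C)) = F C C := by
  rw [comul_box, comulBox]
  simp only [map_sum]
  rw [Finset.sum_eq_single C, Finset.sum_eq_single C]
  · by_cases h : F C C = 0
    · rw [h]
      split_ifs <;> simp [hφ, h]
    · have hC := (hF _ _ h).1
      have h1 := T.hBox.one_comp C
      have h2 := c.τ_hone_left C
      rw [← hC] at h1 h2
      rw [if_pos ⟨hC.tgt, h1⟩, h2, Units.val_one, one_smul, hφ]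
  · intro Y _ hY
    split_ifs with h
    · rw [map_smul, hφ]
      by_cases h0 : F C Y = 0
      · rw [h0, smul_zero]
      · obtain ⟨h1, h2⟩ := hF _ _ h0
        exact absurd (eq_of_isHOne h.1 h.2 h1 h2).2 hY
    · simp
  · simp
  · intro X _ hX
    refine Finset.sum_eq_zero fun Y _ => ?_
    split_ifs with h
    · rw [map_smul, hφ]
      by_cases h0 : F X Y = 0
      · rw [h0, smul_zero]
      · obtain ⟨h1, h2⟩ := hF _ _ h0
        exact absurd (eq_of_isHOne h.1 h.2 h1 h2).1 hX
    · simp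
  · simp

lemma weak_counit_box (A C D : B) : counit (R := k) (box c A * box c C * box c D) =
    LinearMap.mul' k k (TensorProduct.map (counit ∘ₗ LinearMap.mulLeft k (box c A))
      (counit ∘ₗ LinearMap.mulRight k (box c D)) (comul (R := k) (box c C))) := by
  classical
  symm
  refine (sum_counit (fun X Y => counit (R := k) (box c A * box c X) *
    counit (R := k) (box c Y * box c D)) ?_ C (LinearMap.mul' k k ∘ₗ TensorProduct.map _ _)
    (fun X Y => by simp)).trans ?_
  · intro X Y
    simp only [counit_mul_box]
    split_ifs with h1 h2 <;> simp_all
  · simp only [counit_mul_box, counit_mul_mul_box]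
    split_ifs <;> simp_all

lemma weak_counit_box' (A C D : B) : counit (R := k) (box c A * box c C * box c D) =
    LinearMap.mul' k k (TensorProduct.map (counit ∘ₗ LinearMap.mulRight k (box c D))
      (counit ∘ₗ LinearMap.mulLeft k (box c A)) (comul (R := k) (box c C))) := by
  classical
  symm
  refine (sum_counit (fun X Y => counit (R := k) (box c X * box c D) *
    counit (R := k) (box c A * box c Y)) ?_ C (LinearMap.mul' k k ∘ₗ TensorProduct.map _ _)
    (fun X Y => by simp)).trans ?_
  · intro X Y
    simp only [counit_mul_box]
    split_ifs with h1 h2 <;> simp_all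
  · simp only [counit_mul_box, counit_mul_mul_box]
    split_ifs <;> simp_all

lemma weak_counit (a b d : TwistedAlg T c) : counit (R := k) (a * b * d) =
    LinearMap.mul' k k (TensorProduct.map (counit ∘ₗ LinearMap.mulLeft k a)
      (counit ∘ₗ LinearMap.mulRight k d) (comul (R := k) b)) := by
  induction a using induction with
  | h0 => simp
  | hadd a a' h h' =>
    rw [add_mul, add_mul, map_add, h, h', mulLeft_add, LinearMap.comp_add,
      TensorProduct.map_add_left, LinearMap.add_apply, map_add]
  | hbox r A =>
  induction d using induction with
  | h0 => simp
  | hadd a a' h h' =>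
    rw [mul_add, map_add, h, h', mulRight_add, LinearMap.comp_add,
      TensorProduct.map_add_right, LinearMap.add_apply, map_add]
  | hbox t D =>
  induction b using induction with
  | h0 => simp
  | hadd a a' h h' => simp only [mul_add, add_mul, map_add, h, h']
  | hbox s C =>
    simp only [smul_mul_assoc, mul_smul_comm, map_smul, weak_counit_box,
      mulLeft_smul, mulRight_smul, LinearMap.comp_smul,
      TensorProduct.map_smul_left, TensorProduct.map_smul_right, LinearMap.smul_apply]
    simp only [smul_smul]; congr 1; ring

lemma weak_counit' (a b d : TwistedAlg T c) : counit (R := k) (a * b * d) =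
    LinearMap.mul' k k (TensorProduct.map (counit ∘ₗ LinearMap.mulRight k d)
      (counit ∘ₗ LinearMap.mulLeft k a) (comul (R := k) b)) := by
  induction a using induction with
  | h0 => simp
  | hadd a a' h h' =>
    rw [add_mul, add_mul, map_add, h, h', mulLeft_add, LinearMap.comp_add,
      TensorProduct.map_add_right, LinearMap.add_apply, map_add]
  | hbox r A =>
  induction d using induction with
  | h0 => simp
  | hadd a a' h h' =>
    rw [mul_add, map_add, h, h', mulRight_add, LinearMap.comp_add,
      TensorProduct.map_add_left, LinearMap.add_apply, map_add]
  | hbox t D =>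
  induction b using induction with
  | h0 => simp
  | hadd a a' h h' => simp only [mul_add, add_mul, map_add, h, h']
  | hbox s C =>
    simp only [smul_mul_assoc, mul_smul_comm, map_smul, weak_counit_box',
      mulLeft_smul, mulRight_smul, LinearMap.comp_smul,
      TensorProduct.map_smul_left, TensorProduct.map_smul_right, LinearMap.smul_apply]
    simp only [smul_smul]; congr 1; ring

instance : WeakBialgebra k (TwistedAlg T c) where
  comul_mul := comul_mul'
  comul_comul_one := weak_unit
  comul_comul_one' := weak_unit'
  counit_mul_mul := weak_counit
  counit_mul_mul' := weak_counit'

end TwistedAlg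

/-! ### Multifusion and fusion categories -/

/-- A multifusion category over `k`: a semisimple `k`-linear rigid tensor category with finitely
many isomorphism classes of simple objects and finite-dimensional spaces of morphisms. -/
structure IsMultifusion (k : Type*) [Field k] (C : Type*) [Category* C] [Preadditive C]
    [Linear k C] [MonoidalCategory C] : Prop where
  /-- the tensor product is `k`-bilinear on morphisms -/
  monoidalPreadditive : MonoidalPreadditive C
  monoidalLinear : MonoidalLinear k C
  /-- the category, with its given additive structure, is abelian -/
  abelian : ∃ h : Abelian C, h.toPreadditive = ‹Preadditive C›
  /-- every object is a finite direct sum of simple objects -/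
  semisimple : ∀ X : C, ∃ (n : ℕ) (S : Fin n → C) (b : Limits.Bicone S),
    (∀ i, Simple (S i)) ∧ Nonempty b.IsBilimit ∧ Nonempty (X ≅ b.pt)
  /-- there are finitely many simple objects up to isomorphism -/
  finite_simples : ∃ (n : ℕ) (S : Fin n → C), ∀ X : C, Simple X → ∃ i, Nonempty (X ≅ S i)
  finiteDimensional_hom : ∀ X Y : C, FiniteDimensional k (X ⟶ Y)
  /-- every object has a left and a right dual -/
  rigid : Nonempty (RigidCategory C)

/-- A fusion category over `k`: a multifusion category whose unit object is simple. -/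
structure IsFusion (k : Type*) [Field k] (C : Type*) [Category* C] [Preadditive C]
    [Linear k C] [MonoidalCategory C] : Prop extends IsMultifusion k C where
  simple_unit : Simple (𝟙_ C)

/-- The category `Rep k^τ_σ T` of finite-dimensional `k^τ_σ T`-modules. -/
abbrev RepTwisted {B H V P k : Type u} [Fintype H] [Field k] (T : VacantDoubleGroupoid B H V P)
    (c : T.Cocycle k) : Type (u + 1) := FinRep k (TwistedAlg T c)

end

/-! Everything is computed in the basis of boxes. Vacancy says that a box is determined by a
horizontal side and an adjacent vertical side, so sums over boxes with a given left side become sums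
over horizontal edges.

The unit object. The target map kills every box that is not a horizontal identity, and it sends the
horizontal identity of a vertical edge `g` to the idempotent `srcIdem` of the top end of `g`
(`εt_box_of`, `εt_box_of_not`). Hence the unit object is spanned by nonzero vectors `unitElt p`, one
for each point. Only horizontal identities act nontrivially: the one of `g` carries the vector of
the bottom end of `g` to that of its top end and kills the other vectors. This is the linearized
action of the groupoid of vertical edges on its own points. The identities of points act as
coordinate projections, so an invariant subspace is spanned by the vectors of a union of connected
components. Simplicity is therefore connectedness, over any field.

Semisimplicity. The algebra is a twisted groupoid algebra for vertical composition. The sum of `A ⊗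
A⁻¹` over all boxes, each term divided by the number of boxes with the same top, is a separability
element (`mul_casimir`, `mul_casimir_comm`). It averages a linear retraction onto a left ideal into
a linear map over the algebra. Characteristic zero serves only to invert these numbers.
Decompositions into simple objects and the finiteness of their number follow, the latter from the
regular representation.

Rigidity. The weak bialgebra has a bijective antipode: up to a unit scalar, a box goes to the box
inverted in both directions. It reverses products because of the compatibility between `σ` and `τ`.
The identity `h₁ S(h₂) = ε_t(h)` (`mul_antipode`) makes the coevaluation linear over the algebra,
and `sum_antipode_tgtIdem` does the same for the evaluation. In both zigzag identities the composite
reduces to the fact that the idempotents `tgtIdem p` sum to one. The inverse of the antipode gives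
the duals on the other side. -/

noncomputable section

/-! ### Inverses in groupoids and double groupoids -/

namespace GroupoidOn

variable {Arr Obj : Type u} (G : GroupoidOn Arr Obj)

lemma inv_one (p : Obj) : G.inv (G.one p) = G.one p := by
  symm
  apply G.eq_inv
  · rw [G.tgt_one, G.src_one]
  · simpa only [G.src_one] using G.one_comp (G.one p)

lemma comp_eq_one_iff {a b : Arr} (h : G.tgt a = G.src b) {p : Obj} :
    G.comp a b = G.one p ↔ b = G.inv a ∧ G.src a = p := by
  constructor
  · intro e
    have hp : G.src a = p := by rw [← G.src_comp _ _ h, e, G.src_one]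
    exact ⟨G.eq_inv h (by rw [e, hp]), hp⟩
  · rintro ⟨rfl, rfl⟩
    exact G.comp_inv a

end GroupoidOn

namespace VacantDoubleGroupoid

variable {B H V P : Type u} (T : VacantDoubleGroupoid B H V P)

/-- By interchange, composing the vertical composite with the composite of the two inverses gives a
vertical composite of horizontal identities, which is again a horizontal identity; inverses are
unique. -/
lemma hinv_vcomp {A C : B} (h : T.vBox.tgt A = T.vBox.src C) :
    T.hBox.inv (T.vBox.comp A C) = T.vBox.comp (T.hBox.inv A) (T.hBox.inv C) := by
  have h' : T.vBox.tgt (T.hBox.inv A) = T.vBox.src (T.hBox.inv C) := by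
    rw [T.bot_hinv, T.top_hinv, h]
  have hA := (T.hBox.src_inv A).symm
  have hC := (T.hBox.src_inv C).symm
  symm
  apply T.hBox.eq_inv
  · rw [T.right_vcomp _ _ h, T.left_vcomp _ _ h', hA, hC]
  · rw [← T.interchange _ _ _ _ hA hC h h', T.hBox.comp_inv, T.hBox.comp_inv,
      T.vcomp_hone _ _ (by rw [T.bot_left, T.top_left, h]), T.left_vcomp _ _ h]

lemma hinv_vone (x : H) : T.hBox.inv (T.vBox.one x) = T.vBox.one (T.hor.inv x) := by
  symm
  apply T.hBox.eq_inv
  · rw [T.right_vone, T.left_vone, T.hor.src_inv]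
  · rw [T.hcomp_vone _ _ (T.hor.src_inv x).symm, T.hor.comp_inv, T.vone_one, T.left_vone]

/-- A box is determined by its bottom and left sides. -/
lemma ext_bot_left {A C : B} (h : T.vBox.tgt A = T.vBox.tgt C)
    (h' : T.hBox.src A = T.hBox.src C) : A = C := by
  rw [← T.vBox.inv_inv A, ← T.vBox.inv_inv C]
  congr 1
  apply T.ext_top_left
  · rw [T.vBox.src_inv, T.vBox.src_inv, h]
  · rw [left_vinv, left_vinv, h']

lemma exists_bot_left (x : H) (f : V) (h : T.hor.src x = T.ver.tgt f) :
    ∃ A : B, T.vBox.tgt A = x ∧ T.hBox.src A = f := by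
  obtain ⟨A, h1, h2⟩ := T.exists_top_left x (T.ver.inv f) (by rw [T.ver.src_inv, h])
  exact ⟨T.vBox.inv A, by rw [T.vBox.tgt_inv, h1], by rw [left_vinv, h2, T.ver.inv_inv]⟩

/-- The horizontal identity of the left side of `A` has the same bottom and left sides as `A`. -/
lemma isHOne_of_bot {A : B} {p : P} (h : T.vBox.tgt A = T.hor.one p) : T.IsHOne A := by
  apply T.ext_bot_left
  · rw [T.bot_hone, T.bot_left, h, T.hor.src_one]
  · rw [T.hBox.src_one]

lemma isHOne_vone_one (p : P) : T.IsHOne (T.vBox.one (T.hor.one p)) :=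
  T.isHOne_of_top (T.vBox.src_one _)

variable {T}

lemma IsHOne.top_eq {A : B} (h : T.IsHOne A) :
    T.vBox.src A = T.hor.one (T.ver.src (T.hBox.src A)) := by
  conv_lhs => rw [h, T.top_hone]

lemma IsHOne.hinv_hcomp {A X : B} (hA : T.IsHOne A) (h : T.hBox.src X = T.hBox.src A) :
    T.hBox.comp (T.hBox.inv X) A = T.hBox.inv X := by
  rw [hA, ← h, ← T.hBox.tgt_inv, T.hBox.comp_one]

end VacantDoubleGroupoid

/-! ### The twisted groupoid algebra -/

namespace DoubleGroupoid.Cocycle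

variable {B H V P : Type u} {T : DoubleGroupoid B H V P} {k : Type u} [Field k] (c : T.Cocycle k)

/-- This is the cocycle identity for `A`, `A⁻¹`, `A`, where normalization removes two of the four
factors. It makes the left inverse `vinvBox` a right inverse as well. -/
lemma σ_inv_comm (A : B) : c.σ A (T.vBox.inv A) = c.σ (T.vBox.inv A) A := by
  have h := c.σ_cocycle A (T.vBox.inv A) A (T.vBox.src_inv A).symm (T.vBox.tgt_inv A)
  rwa [T.vBox.comp_inv, T.vBox.inv_comp, c.σ_vone_left, c.σ_vone_right, mul_one, mul_one] at h

lemma τ_inv_comm (A : B) : c.τ A (T.hBox.inv A) = c.τ (T.hBox.inv A) A := by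
  have h := c.τ_cocycle A (T.hBox.inv A) A (T.hBox.src_inv A).symm (T.hBox.tgt_inv A)
  rwa [T.hBox.comp_inv, T.hBox.inv_comp, c.τ_hone_left, c.τ_hone_right, mul_one, mul_one] at h

end DoubleGroupoid.Cocycle

namespace TwistedAlg

variable {B H V P : Type u} {T : VacantDoubleGroupoid B H V P} {k : Type u} [Field k]
  {c : T.Cocycle k}

variable (c) in
/-- The inverse of a box in the twisted groupoid algebra. -/
def vinvBox (A : B) : TwistedAlg T c :=
  (((c.σ (T.vBox.inv A) A)⁻¹ : kˣ) : k) • box c (T.vBox.inv A)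

lemma vone_mul_box_of {x : H} {A : B} (h : x = T.vBox.src A) :
    box c (T.vBox.one x) * box c A = box c A := by
  subst h
  rw [box_mul_box_of (T.vBox.tgt_one _), c.σ_vone_left, T.vBox.one_comp, Units.val_one, one_smul]

lemma vone_mul_box_of_ne {x : H} {A : B} (h : x ≠ T.vBox.src A) :
    box c (T.vBox.one x) * box c A = 0 := box_mul_box_of_ne (by rwa [T.vBox.tgt_one])

lemma box_mul_vone_of {x : H} {A : B} (h : T.vBox.tgt A = x) :
    box c A * box c (T.vBox.one x) = box c A := by
  subst h
  rw [box_mul_box_of (T.vBox.src_one _).symm, c.σ_vone_right, T.vBox.comp_one, Units.val_one,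
    one_smul]

lemma box_mul_vone_of_ne {x : H} {A : B} (h : T.vBox.tgt A ≠ x) :
    box c A * box c (T.vBox.one x) = 0 := box_mul_box_of_ne (by rwa [T.vBox.src_one])

lemma vinvBox_mul_box (A : B) : vinvBox c A * box c A = box c (T.vBox.one (T.vBox.tgt A)) := by
  rw [vinvBox, smul_mul_assoc, box_mul_box_of (T.vBox.tgt_inv A), T.vBox.inv_comp, smul_smul,
    ← Units.val_mul, inv_mul_cancel, Units.val_one, one_smul]

lemma box_mul_vinvBox (A : B) : box c A * vinvBox c A = box c (T.vBox.one (T.vBox.src A)) := by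
  rw [vinvBox, mul_smul_comm, box_mul_box_of (T.vBox.src_inv A).symm, T.vBox.comp_inv, smul_smul,
    ← c.σ_inv_comm, ← Units.val_mul, inv_mul_cancel, Units.val_one, one_smul]

lemma vinvBox_mul_box_of_ne {A C : B} (h : T.vBox.src A ≠ T.vBox.src C) :
    vinvBox c A * box c C = 0 := by
  rw [vinvBox, smul_mul_assoc, box_mul_box_of_ne (by rwa [T.vBox.tgt_inv]), smul_zero]

lemma box_mul_vinvBox_of_ne {A C : B} (h : T.vBox.tgt C ≠ T.vBox.tgt A) :
    box c C * vinvBox c A = 0 := by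
  rw [vinvBox, mul_smul_comm, box_mul_box_of_ne (by rwa [T.vBox.src_inv]), smul_zero]

lemma vinvBox_mul_vinvBox_of_ne {A C : B} (h : T.vBox.tgt A ≠ T.vBox.src C) :
    vinvBox c C * vinvBox c A = 0 := by
  rw [vinvBox, smul_mul_assoc, box_mul_vinvBox_of_ne (by rw [T.vBox.tgt_inv]; exact h.symm),
    smul_zero]

lemma vinvBox_mul_vone (A : B) :
    vinvBox c A * box c (T.vBox.one (T.vBox.src A)) = vinvBox c A := by
  rw [vinvBox, smul_mul_assoc, box_mul_vone_of (T.vBox.tgt_inv A)]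

lemma vone_mul_vinvBox (A : B) :
    box c (T.vBox.one (T.vBox.tgt A)) * vinvBox c A = vinvBox c A := by
  rw [vinvBox, mul_smul_comm, vone_mul_box_of (T.vBox.src_inv A).symm]

lemma vinvBox_vone (x : H) : vinvBox c (T.vBox.one x) = box c (T.vBox.one x) := by
  have h := c.σ_vone_left (T.vBox.one x)
  rw [T.vBox.src_one] at h
  rw [vinvBox, T.vBox.inv_one, h, inv_one, Units.val_one, one_smul]

/-! ### The antipode and its multiplicative properties. -/

section ring

variable [Fintype H]

/-- Derived from uniqueness of inverses rather than from the cocycle identity: the product of the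
two inverses, in reverse order, is a left inverse of the product of the two boxes. -/
lemma vinvBox_vcomp {A C : B} (h : T.vBox.tgt A = T.vBox.src C) :
    vinvBox c (T.vBox.comp A C) = (c.σ A C : k) • (vinvBox c C * vinvBox c A) := by
  have h1 : vinvBox c C * vinvBox c A * (box c A * box c C) =
      box c (T.vBox.one (T.vBox.tgt C)) := by
    rw [mul_assoc, ← mul_assoc (vinvBox c A), vinvBox_mul_box, vone_mul_box_of h, vinvBox_mul_box]
  -- Multiplying by the inverse of the composite on the right cancels the composite on one side and
  -- is absorbed by the vertical identity on the other.
  have h2 := congrArg (· * vinvBox c (T.vBox.comp A C)) h1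
  have h3 := vone_mul_vinvBox (c := c) (T.vBox.comp A C)
  rw [T.vBox.tgt_comp _ _ h] at h3
  rw [h3, box_mul_box_of h, mul_smul_comm, smul_mul_assoc, mul_assoc, box_mul_vinvBox, mul_assoc,
    T.vBox.src_comp _ _ h, vinvBox_mul_vone] at h2
  exact h2.symm

variable (c) in
/-- The antipode. -/
def antipode : TwistedAlg T c →ₗ[k] TwistedAlg T c :=
  lift c fun A => (((c.τ A (T.hBox.inv A))⁻¹ : kˣ) : k) • vinvBox c (T.hBox.inv A)

lemma antipode_box (A : B) : antipode c (box c A) =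
    (((c.τ A (T.hBox.inv A))⁻¹ : kˣ) : k) • vinvBox c (T.hBox.inv A) := lift_box _ _

/-- The compatibility of `σ` and `τ` is applied to the square with rows `A, A⁻¹` and `C, C⁻¹`
(horizontal inverses). Both rows compose to horizontal identities, so the `σ` of the rows is 1 and
what is left is the relation between the scalars of the antipode. If the boxes are not composable,
neither are the inverses in the opposite order, and both sides vanish. -/
lemma antipode_mul_box (A C : B) :
    antipode c (box c A * box c C) = antipode c (box c C) * antipode c (box c A) := by
  by_cases h : T.vBox.tgt A = T.vBox.src C
  · have h' : T.vBox.tgt (T.hBox.inv A) = T.vBox.src (T.hBox.inv C) := by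
      rw [T.bot_hinv, T.top_hinv, h]
    have key := c.compat _ _ _ _ (T.hBox.src_inv A).symm (T.hBox.src_inv C).symm h h'
    rw [T.hBox.comp_inv, T.hBox.comp_inv, VacantDoubleGroupoid.σ_hone c
      (by rw [T.bot_left, T.top_left, h]), one_mul] at key
    rw [box_mul_box_of h, map_smul]
    simp only [antipode_box]
    rw [T.hinv_vcomp h, vinvBox_vcomp h', smul_smul, smul_smul, smul_mul_smul_comm, key]
    congr 1
    simp only [← Units.val_mul]
    congr 1
    rw [mul_inv_rev, mul_inv_rev, mul_inv_rev]
    group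
    simp [mul_comm, mul_left_comm]
  · rw [box_mul_box_of_ne h, map_zero, antipode_box, antipode_box, smul_mul_smul_comm,
      vinvBox_mul_vinvBox_of_ne, smul_zero]
    rw [T.bot_hinv, T.top_hinv]
    intro e
    exact h (by rw [← T.hor.inv_inv (T.vBox.tgt A), e, T.hor.inv_inv])

lemma antipode_mul (a b : TwistedAlg T c) :
    antipode c (a * b) = antipode c b * antipode c a := by
  induction a using induction with
  | h0 => simp
  | hadd a a' h h' => simp only [add_mul, mul_add, map_add, h, h']
  | hbox r A =>
  induction b using induction with
  | h0 => simp
  | hadd a a' h h' => simp only [add_mul, mul_add, map_add, h, h']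
  | hbox s C =>
  simp only [smul_mul_assoc, mul_smul_comm, map_smul, antipode_mul_box, smul_comm r s]

lemma antipode_vone (x : H) :
    antipode c (box c (T.vBox.one x)) = box c (T.vBox.one (T.hor.inv x)) := by
  rw [antipode_box, T.hinv_vone, VacantDoubleGroupoid.τ_vone c (T.hor.src_inv x).symm, inv_one,
    Units.val_one, one_smul, vinvBox_vone]

/-- Inversion permutes the horizontal edges, hence the summands of the unit. -/
lemma antipode_one : antipode c 1 = 1 := by
  rw [one_def, map_sum]
  simp only [antipode_vone]
  exact Function.Bijective.sum_comp (Function.Involutive.bijective T.hor.inv_inv)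
    fun x => box c (T.vBox.one x)

lemma antipode_surjective : Function.Surjective (antipode c) := by
  intro a
  induction a using induction with
  | h0 => exact ⟨0, map_zero _⟩
  | hadd a a' h h' =>
    obtain ⟨b, rfl⟩ := h
    obtain ⟨b', rfl⟩ := h'
    exact ⟨b + b', map_add _ _ _⟩
  | hbox r A =>
    -- Inverting `C` horizontally and then vertically gives back `A`, so the antipode sends the box
    -- `C` to a unit multiple of the box `A`; the witness divides by that unit.
    set C := T.hBox.inv (T.vBox.inv A) with hC
    set s : kˣ := (c.τ C (T.hBox.inv C))⁻¹ * (c.σ (T.vBox.inv (T.hBox.inv C)) (T.hBox.inv C))⁻¹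
    refine ⟨(r * ((s⁻¹ : kˣ) : k)) • box c C, ?_⟩
    rw [map_smul, antipode_box, vinvBox, smul_smul, smul_smul]
    congr 1
    · rw [mul_assoc, ← Units.val_mul, mul_assoc, ← Units.val_mul, inv_mul_cancel, Units.val_one,
        mul_one]
    · rw [hC, T.hBox.inv_inv, T.vBox.inv_inv]

lemma antipode_bijective [Fintype B] : Function.Bijective (antipode c) :=
  ⟨LinearMap.injective_iff_surjective.mpr antipode_surjective, antipode_surjective⟩

variable (c) in
/-- The antipode as a linear equivalence. -/
def antipodeEquiv [Fintype B] : TwistedAlg T c ≃ₗ[k] TwistedAlg T c :=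
  LinearEquiv.ofBijective (antipode c) antipode_bijective

lemma antipodeEquiv_symm_one [Fintype B] : (antipodeEquiv c).symm 1 = 1 :=
  (antipodeEquiv c).symm_apply_eq.mpr antipode_one.symm

lemma antipodeEquiv_symm_mul [Fintype B] (a b : TwistedAlg T c) :
    (antipodeEquiv c).symm (a * b) = (antipodeEquiv c).symm b * (antipodeEquiv c).symm a := by
  rw [LinearEquiv.symm_apply_eq]
  refine Eq.trans ?_ (antipode_mul _ _).symm
  congr 1
  · exact ((antipodeEquiv c).apply_symm_apply a).symm
  · exact ((antipodeEquiv c).apply_symm_apply b).symm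

/-! ### The idempotents attached to the points. -/

open Classical in
variable (c) in
/-- The sum of the vertical identities of the horizontal edges starting at a point. -/
def srcIdem (p : P) : TwistedAlg T c :=
  ∑ x : H, if T.hor.src x = p then box c (T.vBox.one x) else 0

open Classical in
variable (c) in
/-- The sum of the vertical identities of the horizontal edges ending at a point. -/
def tgtIdem (p : P) : TwistedAlg T c :=
  ∑ x : H, if T.hor.tgt x = p then box c (T.vBox.one x) else 0

open Classical in
-- Right multiplication selects the boxes by their lower left corner; in `tgtIdem_mul_box`, left
-- multiplication selects them by their upper right corner.
lemma box_mul_srcIdem (A : B) (p : P) :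
    box c A * srcIdem c p = if T.hor.src (T.vBox.tgt A) = p then box c A else 0 := by
  rw [srcIdem, Finset.mul_sum, Finset.sum_eq_single (T.vBox.tgt A)]
  · split_ifs
    · rw [box_mul_vone_of rfl]
    · rw [mul_zero]
  · intro x _ hx
    split_ifs
    · rw [box_mul_vone_of_ne hx.symm]
    · rw [mul_zero]
  · simp

open Classical in
lemma tgtIdem_mul_box (A : B) (p : P) :
    tgtIdem c p * box c A = if T.hor.tgt (T.vBox.src A) = p then box c A else 0 := by
  rw [tgtIdem, Finset.sum_mul, Finset.sum_eq_single (T.vBox.src A)]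
  · split_ifs
    · rw [vone_mul_box_of rfl]
    · rw [zero_mul]
  · intro x _ hx
    split_ifs
    · rw [vone_mul_box_of_ne hx]
    · rw [zero_mul]
  · simp

lemma tgtIdem_mul_self (p : P) : tgtIdem c p * tgtIdem c p = tgtIdem c p := by
  classical
  conv_lhs => rw [tgtIdem.eq_1 c p, Finset.mul_sum]
  rw [tgtIdem]
  refine Finset.sum_congr rfl fun x _ => ?_
  split_ifs with h
  · rw [← tgtIdem, tgtIdem_mul_box, T.vBox.src_one, if_pos h]
  · rw [mul_zero]

lemma sum_tgtIdem [Fintype P] : ∑ p : P, tgtIdem c p = 1 := by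
  simp only [tgtIdem]
  rw [Finset.sum_comm, one_def]
  refine Finset.sum_congr rfl fun x _ => ?_
  rw [Finset.sum_eq_single (T.hor.tgt x) (fun p _ h => if_neg h.symm) (by simp), if_pos rfl]

/-- Inverting a horizontal edge exchanges its two ends. Through this, `srcIdem` acts on a dual
representation as the transpose of `tgtIdem`. -/
lemma antipode_srcIdem (p : P) : antipode c (srcIdem c p) = tgtIdem c p := by
  classical
  rw [srcIdem, map_sum, tgtIdem]
  refine Eq.trans ?_ (Function.Bijective.sum_comp (Function.Involutive.bijective T.hor.inv_inv) _)
  refine Finset.sum_congr rfl fun x _ => ?_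
  rw [T.hor.tgt_inv]
  split_ifs
  · rw [antipode_vone]
  · rw [map_zero]

end ring

end TwistedAlg

/-! ### Boxes with a prescribed left side. -/

namespace VacantDoubleGroupoid

variable {B H V P : Type u} (T : VacantDoubleGroupoid B H V P) [Fintype B] [Fintype H]

open Classical in
-- Vacancy in the form of a reindexing: taking the top is a bijection from the boxes with left side
-- `g` to the horizontal edges that start at the top end of `g`.
lemma sum_left_top {M : Type*} [AddCommMonoid M] (g : V) (F : H → M) :
    (∑ A : B, if T.hBox.src A = g then F (T.vBox.src A) else 0) =
      ∑ x : H, if T.hor.src x = T.ver.src g then F x else 0 := by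
  rw [← Finset.sum_filter, ← Finset.sum_filter]
  refine Finset.sum_nbij T.vBox.src ?_ ?_ ?_ (fun _ _ => rfl)
  · intro A hA
    simp only [Finset.mem_filter, Finset.mem_univ, true_and] at hA ⊢
    rw [← T.top_left, hA]
  · intro A hA C hC h
    simp only [Finset.coe_filter, Finset.mem_univ, true_and, Set.mem_ofPred_eq] at hA hC
    exact T.ext_top_left h (hA.trans hC.symm)
  · intro x hx
    simp only [Finset.coe_filter, Finset.mem_univ, true_and, Set.mem_ofPred_eq] at hx
    obtain ⟨A, h1, h2⟩ := T.exists_top_left x g hx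
    exact ⟨A, by simpa using h2, h1⟩

open Classical in
lemma sum_left_bot {M : Type*} [AddCommMonoid M] (g : V) (F : H → M) :
    (∑ A : B, if T.hBox.src A = g then F (T.vBox.tgt A) else 0) =
      ∑ x : H, if T.hor.src x = T.ver.tgt g then F x else 0 := by
  rw [← Finset.sum_filter, ← Finset.sum_filter]
  refine Finset.sum_nbij T.vBox.tgt ?_ ?_ ?_ (fun _ _ => rfl)
  · intro A hA
    simp only [Finset.mem_filter, Finset.mem_univ, true_and] at hA ⊢
    rw [← T.bot_left, hA]
  · intro A hA C hC h
    simp only [Finset.coe_filter, Finset.mem_univ, true_and, Set.mem_ofPred_eq] at hA hC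
    exact T.ext_bot_left h (hA.trans hC.symm)
  · intro x hx
    simp only [Finset.coe_filter, Finset.mem_univ, true_and, Set.mem_ofPred_eq] at hx
    obtain ⟨A, h1, h2⟩ := T.exists_bot_left x g hx
    exact ⟨A, by simpa using h2, h1⟩

end VacantDoubleGroupoid

namespace TwistedAlg

/-! ### Counting boxes by their top side. -/

section count

variable {B H V P : Type u} {T : VacantDoubleGroupoid B H V P} [Fintype B]

open Classical in
variable (T) in
/-- The number of boxes with a given top. -/
def boxCount (x : H) : ℕ := (Finset.univ.filter fun A : B => T.vBox.src A = x).card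

lemma boxCount_pos (x : H) : 0 < boxCount T x :=
  Finset.card_pos.mpr ⟨T.vBox.one x, by simp [T.vBox.src_one]⟩

open Classical in
-- Composition with `C` from above is a bijection onto the boxes with the same top as `C`, with
-- inverse the composition with `C⁻¹`.
lemma sum_src_comp {M : Type*} [AddCommMonoid M] (C : B) (F : B → M) :
    (∑ A : B, if T.vBox.tgt C = T.vBox.src A then F (T.vBox.comp C A) else 0) =
      ∑ A : B, if T.vBox.src A = T.vBox.src C then F A else 0 := by
  rw [← Finset.sum_filter, ← Finset.sum_filter]
  refine Finset.sum_nbij (T.vBox.comp C) ?_ ?_ ?_ (fun _ _ => rfl)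
  · intro A hA
    simp only [Finset.mem_filter, Finset.mem_univ, true_and] at hA ⊢
    rw [T.vBox.src_comp _ _ hA]
  · intro A hA D hD h
    simp only [Finset.coe_filter, Finset.mem_univ, true_and, Set.mem_ofPred_eq] at hA hD
    exact T.vBox.left_cancel hA hD h
  · intro A hA
    simp only [Finset.coe_filter, Finset.mem_univ, true_and, Set.mem_ofPred_eq] at hA
    refine ⟨T.vBox.comp (T.vBox.inv C) A, ?_, T.vBox.comp_inv_cancel hA.symm⟩
    simp only [Finset.coe_filter, Finset.mem_univ, true_and, Set.mem_ofPred_eq]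
    rw [T.vBox.src_comp _ _ (by rw [T.vBox.tgt_inv, hA]), T.vBox.src_inv]

/-- The count is constant on the connected components of the groupoid of vertical composition, so
dividing by it does not disturb the translation argument in `box_mul_casimir`. -/
lemma boxCount_src (C : B) : boxCount T (T.vBox.src C) = boxCount T (T.vBox.tgt C) := by
  classical
  have h := sum_src_comp (T := T) C fun _ => 1
  rw [boxCount, boxCount, Finset.card_filter, Finset.card_filter, ← h]
  simp only [eq_comm]

end count

/-! ### The target map on boxes and the antipode identities. -/

open Coalgebra WeakBialgebra

variable {B H V P : Type u} {T : VacantDoubleGroupoid B H V P} {k : Type u} [Field k]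
  {c : T.Cocycle k} [Fintype B] [Fintype H]

open Classical in
-- In a factorization `XY = A` the right factor is `X⁻¹A`, so the double sum collapses to one over
-- the boxes with the same left side as `A`.
lemma comul_box_eq_sum (A : B) : comul (R := k) (box c A) =
    ∑ X : B, if T.hBox.src X = T.hBox.src A then
      (c.τ X (T.hBox.comp (T.hBox.inv X) A) : k) •
        (box c X ⊗ₜ[k] box c (T.hBox.comp (T.hBox.inv X) A)) else 0 := by
  rw [comul_box, comulBox]
  refine Finset.sum_congr rfl fun X _ => ?_
  rw [Finset.sum_eq_single (T.hBox.comp (T.hBox.inv X) A)]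
  · by_cases h : T.hBox.src X = T.hBox.src A
    · have h' : T.hBox.tgt X = T.hBox.src (T.hBox.comp (T.hBox.inv X) A) := by
        rw [T.hBox.src_comp _ _ (by rw [T.hBox.tgt_inv, h]), T.hBox.src_inv]
      rw [if_pos h, if_pos ⟨h', T.hBox.comp_inv_cancel h⟩]
    · rw [if_neg h, if_neg]
      rintro ⟨h1, h2⟩
      exact h (by rw [← h2, T.hBox.src_comp _ _ h1])
  · intro Y _ hY
    refine if_neg ?_
    rintro ⟨h1, h2⟩
    exact hY (by rw [← h2, T.hBox.inv_comp_cancel h1])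
  · simp

/-- In `Δ(1)(A ⊗ 1)` only the first leg indexed by the top of `A` survives. This top is the identity
edge of a point, and the second leg then runs over all edges starting there. -/
lemma εt_box_of {A : B} (hA : T.IsHOne A) :
    εt k (TwistedAlg T c) (box c A) = srcIdem c (T.ver.src (T.hBox.src A)) := by
  classical
  rw [εt_apply, comul_one]
  simp only [Finset.sum_mul, map_sum]
  rw [Finset.sum_eq_single (T.vBox.src A), srcIdem]
  · refine Finset.sum_congr rfl fun y _ => ?_
    have h1 : T.hor.tgt (T.vBox.src A) = T.ver.src (T.hBox.src A) := by
      rw [hA.top_eq, T.hor.tgt_one]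
    have h2 : counit (R := k) (box c A) = 1 := by rw [counit_box, counitBox, if_pos hA]
    by_cases h : T.hor.src y = T.ver.src (T.hBox.src A)
    · rw [if_pos h, if_pos (h1.trans h.symm), Algebra.TensorProduct.tmul_mul_tmul, mul_one,
        counitL_tmul, vone_mul_box_of rfl, h2, one_smul]
    · rw [if_neg h, if_neg (fun h' => h (h'.symm.trans h1)), zero_mul, map_zero]
  · intro x _ hx
    refine Finset.sum_eq_zero fun y _ => ?_
    split_ifs
    · rw [Algebra.TensorProduct.tmul_mul_tmul, counitL_tmul, vone_mul_box_of_ne hx, map_zero,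
        zero_smul]
    · rw [zero_mul, map_zero]
  · simp

lemma εt_box_of_not {A : B} (hA : ¬ T.IsHOne A) : εt k (TwistedAlg T c) (box c A) = 0 := by
  classical
  rw [εt_apply, comul_one]
  simp only [Finset.sum_mul, map_sum]
  refine Finset.sum_eq_zero fun x _ => Finset.sum_eq_zero fun y _ => ?_
  split_ifs
  · rw [Algebra.TensorProduct.tmul_mul_tmul, counitL_tmul, counit_mul_box,
      if_neg (fun h => hA h.2.2), zero_smul]
  · rw [zero_mul, map_zero]

/-- Shows that `srcIdem p` lies in the target subalgebra, hence is fixed by the target map. -/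
lemma srcIdem_eq_εt (p : P) : εt k (TwistedAlg T c) (box c (T.vBox.one (T.hor.one p))) =
    srcIdem c p := by
  rw [εt_box_of (T.isHOne_vone_one p), T.left_vone, T.ver.src_one, T.hor.src_one]

/-- The right unit constraint acts through `εr`, so this is how the vectors of the unit object act
from the right. The counit sees a single second leg of `Δ(1)`, the identity edge of `p`; the first
leg then runs over the edges ending at `p`. -/
lemma εr_srcIdem (p : P) : εr k (TwistedAlg T c) (srcIdem c p) = tgtIdem c p := by
  classical
  rw [εr_apply, comul_one]
  simp only [Finset.sum_mul, map_sum]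
  rw [tgtIdem]
  refine Finset.sum_congr rfl fun x _ => ?_
  have h1 (y : H) : counit (R := k) (box c (T.vBox.one y) * srcIdem c p) =
      if y = T.hor.one p then 1 else 0 := by
    rw [box_mul_srcIdem, T.vBox.tgt_one]
    by_cases hy : y = T.hor.one p
    · subst hy
      rw [if_pos (T.hor.src_one p), if_pos rfl, counit_box, counitBox,
        if_pos (T.isHOne_vone_one p)]
    · rw [if_neg hy]
      split_ifs with h
      · rw [counit_box, counitBox, if_neg]
        intro h'
        have h2 := h'.top_eq
        rw [T.vBox.src_one, T.left_vone, T.ver.src_one, h] at h2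
        exact hy h2
      · rw [map_zero]
  rw [Finset.sum_eq_single (T.hor.one p)]
  · rw [T.hor.src_one]
    split_ifs
    · rw [Algebra.TensorProduct.tmul_mul_tmul, mul_one, counitR_tmul, h1, if_pos rfl, one_smul]
    · rw [zero_mul, map_zero]
  · intro y _ hy
    split_ifs
    · rw [Algebra.TensorProduct.tmul_mul_tmul, counitR_tmul, h1, if_neg hy, zero_smul]
    · rw [zero_mul, map_zero]
  · simp

/-- A term `X S(X⁻¹A)` is nonzero only if the bottoms of `X` and `X⁻¹A` are mutually inverse, which
makes the bottom of `A` an identity and `A` a horizontal identity. In that case `X⁻¹A = X⁻¹`, the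
scalars cancel, and the term is the vertical identity of the top of `X`; these tops run over all
edges starting at the top end of the left side of `A`. -/
lemma mul_antipode_box (A : B) : LinearMap.mul' k (TwistedAlg T c)
    ((antipode c).lTensor _ (comul (R := k) (box c A))) = εt k _ (box c A) := by
  classical
  rw [comul_box_eq_sum]
  simp only [map_sum]
  by_cases hA : T.IsHOne A
  · rw [εt_box_of hA, srcIdem, ← T.sum_left_top]
    refine Finset.sum_congr rfl fun X _ => ?_
    split_ifs with h
    · rw [hA.hinv_hcomp h, map_smul, map_smul, LinearMap.lTensor_tmul,
        LinearMap.mul'_apply, antipode_box, T.hBox.inv_inv, mul_smul_comm, box_mul_vinvBox,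
        smul_smul, c.τ_inv_comm, ← Units.val_mul, mul_inv_cancel, Units.val_one, one_smul]
    · simp
  · rw [εt_box_of_not hA]
    refine Finset.sum_eq_zero fun X _ => ?_
    split_ifs with h
    · have h1 : T.hBox.tgt (T.hBox.inv X) = T.hBox.src A := by rw [T.hBox.tgt_inv, h]
      rw [map_smul, map_smul, LinearMap.lTensor_tmul, LinearMap.mul'_apply, antipode_box,
        mul_smul_comm, box_mul_vinvBox_of_ne, smul_zero, smul_zero]
      intro e
      apply hA
      have h2 : T.hor.tgt (T.vBox.tgt X) = T.hor.src (T.vBox.tgt (T.hBox.comp (T.hBox.inv X) A)) := by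
        rw [← T.bot_right, ← T.bot_left, T.hBox.src_comp _ _ h1, T.hBox.src_inv]
      have h3 : T.hBox.tgt X = T.hBox.src (T.hBox.comp (T.hBox.inv X) A) := by
        rw [T.hBox.src_comp _ _ h1, T.hBox.src_inv]
      refine T.isHOne_of_bot (p := T.hor.src (T.vBox.tgt X)) ?_
      conv_lhs => rw [← T.hBox.comp_inv_cancel h, T.bot_hcomp _ _ h3]
      rw [T.hor.comp_eq_one_iff h2]
      refine ⟨?_, rfl⟩
      rw [e, T.bot_hinv, T.hor.inv_inv]
    · simp

/-- `h₁ S(h₂) = ε_t(h)` -/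
lemma mul_antipode (h : TwistedAlg T c) : LinearMap.mul' k (TwistedAlg T c)
    ((antipode c).lTensor _ (comul (R := k) h)) = εt k _ h :=
  LinearMap.congr_fun (f := LinearMap.mul' k _ ∘ₗ (antipode c).lTensor _ ∘ₗ comul)
    (hom_ext mul_antipode_box) h

/-- The second factor of each term is the horizontal inverse of `X`. Its upper right corner is the
top end of the left side of `A`, so the idempotent fixes it. The product is the vertical identity of
the inverse of the bottom of `X`, and these bottoms run over the edges starting at the bottom end of
that side. -/
lemma antipode_tgtIdem_mul_box_of {A : B} (hA : T.IsHOne A) :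
    LinearMap.mul' k (TwistedAlg T c) (TensorProduct.map (antipode c)
      (LinearMap.mulLeft k (tgtIdem c (T.ver.src (T.hBox.src A)))) (comul (R := k) (box c A))) =
    tgtIdem c (T.ver.tgt (T.hBox.src A)) := by
  classical
  have h0 : tgtIdem c (T.ver.tgt (T.hBox.src A)) = ∑ x : H, if T.hor.src x =
      T.ver.tgt (T.hBox.src A) then box c (T.vBox.one (T.hor.inv x)) else 0 := by
    rw [← antipode_srcIdem, srcIdem, map_sum]
    refine Finset.sum_congr rfl fun x _ => ?_
    split_ifs
    · rw [antipode_vone]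
    · rw [map_zero]
  rw [comul_box_eq_sum, h0, ← T.sum_left_bot (T.hBox.src A)
    fun x => box c (T.vBox.one (T.hor.inv x))]
  simp only [map_sum]
  refine Finset.sum_congr rfl fun X _ => ?_
  split_ifs with h
  · rw [hA.hinv_hcomp h, map_smul, map_smul, TensorProduct.map_tmul,
      LinearMap.mul'_apply, antipode_box, smul_mul_assoc, LinearMap.mulLeft_apply,
      tgtIdem_mul_box, if_pos, vinvBox_mul_box, T.bot_hinv, smul_smul, ← Units.val_mul,
      mul_inv_cancel, Units.val_one, one_smul]
    rw [T.top_hinv, T.hor.tgt_inv, ← T.top_left, h]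
  · simp

lemma antipode_tgtIdem_mul_box_of_ne {A : B} {p : P}
    (hA : ¬ (T.IsHOne A ∧ p = T.ver.src (T.hBox.src A))) :
    LinearMap.mul' k (TwistedAlg T c) (TensorProduct.map (antipode c)
      (LinearMap.mulLeft k (tgtIdem c p)) (comul (R := k) (box c A))) = 0 := by
  classical
  rw [comul_box_eq_sum]
  simp only [map_sum]
  refine Finset.sum_eq_zero fun X _ => ?_
  split_ifs with h
  · have h1 : T.hBox.tgt (T.hBox.inv X) = T.hBox.src A := by rw [T.hBox.tgt_inv, h]
    rw [map_smul, map_smul, TensorProduct.map_tmul, LinearMap.mul'_apply, antipode_box,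
      smul_mul_assoc, LinearMap.mulLeft_apply, tgtIdem_mul_box]
    split_ifs with h2
    · rw [vinvBox_mul_box_of_ne, smul_zero, smul_zero]
      intro e
      apply hA
      -- A nonzero product forces equal tops. The left sides agree already, so vacancy identifies
      -- the two boxes and `A` cancels to an identity.
      have h3 : T.hBox.comp (T.hBox.inv X) A = T.hBox.inv X :=
        T.ext_top_left e.symm (T.hBox.src_comp _ _ h1)
      have h4 : A = T.hBox.one (T.hBox.src X) := by
        rw [← T.hBox.comp_inv X, ← h3, T.hBox.comp_inv_cancel h]
      refine ⟨by rw [h4]; exact T.isHOne_hone _, ?_⟩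
      rw [← h2, h3, T.top_hinv, T.hor.tgt_inv, ← T.top_left, h]
    · simp
  · simp

/-- `S(h₁) 1₁ h₂ ⊗ 1₂ = 1₁ ⊗ ε_t(h 1₂)` -/
lemma sum_antipode_tgtIdem [Fintype P] (h : TwistedAlg T c) :
    (∑ p : P, LinearMap.mul' k (TwistedAlg T c) (TensorProduct.map (antipode c)
      (LinearMap.mulLeft k (tgtIdem c p)) (comul (R := k) h)) ⊗ₜ[k] srcIdem c p) =
    ∑ p : P, tgtIdem c p ⊗ₜ[k] εt k _ (h * srcIdem c p) := by
  induction h using induction with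
  | h0 => simp
  | hadd a b ha hb =>
    simp only [map_add, add_mul, TensorProduct.add_tmul, TensorProduct.tmul_add,
      Finset.sum_add_distrib, ha, hb]
  | hbox r A =>
    simp only [map_smul, smul_mul_assoc, TensorProduct.tmul_smul, ← TensorProduct.smul_tmul',
      ← Finset.smul_sum]
    congr 1
    by_cases hA : T.IsHOne A
    -- The two sums are supported at different points: the left one at the top end of the vertical
    -- edge, the right one at its bottom end. Both surviving terms are `tgtIdem` of the bottom end
    -- tensor `srcIdem` of the top end.
    · rw [Finset.sum_eq_single (T.ver.src (T.hBox.src A)),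
        Finset.sum_eq_single (T.ver.tgt (T.hBox.src A)), antipode_tgtIdem_mul_box_of hA,
        box_mul_srcIdem, if_pos (T.bot_left A).symm, εt_box_of hA]
      · intro p _ hp
        rw [box_mul_srcIdem, if_neg (by rw [← T.bot_left]; exact hp.symm), map_zero,
          TensorProduct.tmul_zero]
      · simp
      · intro p _ hp
        rw [antipode_tgtIdem_mul_box_of_ne (fun h => hp h.2), TensorProduct.zero_tmul]
      · simp
    · rw [Finset.sum_eq_zero, Finset.sum_eq_zero]
      · intro p _
        rw [box_mul_srcIdem]
        split_ifs
        · rw [εt_box_of_not hA, TensorProduct.tmul_zero]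
        · rw [map_zero, TensorProduct.tmul_zero]
      · intro p _
        rw [antipode_tgtIdem_mul_box_of_ne (fun h => hA h.1), TensorProduct.zero_tmul]

/-! ### Semisimplicity -/

variable (c) in
/-- The separability element `∑ A ⊗ A⁻¹`, normalized. -/
def casimir : TwistedAlg T c ⊗[k] TwistedAlg T c :=
  ∑ A : B, (boxCount T (T.vBox.src A) : k)⁻¹ • (box c A ⊗ₜ[k] vinvBox c A)

/-- Grouping by the top `x`, there are `boxCount T x` equal terms, each the vertical identity of `x`
divided by this number. -/
lemma mul_casimir [CharZero k] : LinearMap.mul' k _ (casimir c) = 1 := by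
  classical
  rw [casimir, map_sum, one_def]
  simp only [map_smul, LinearMap.mul'_apply, box_mul_vinvBox]
  rw [← Finset.sum_fiberwise Finset.univ T.vBox.src]
  refine Finset.sum_congr rfl fun x _ => ?_
  rw [Finset.sum_congr rfl (g := fun _ => (boxCount T x : k)⁻¹ • box c (T.vBox.one x)),
    Finset.sum_const, ← Nat.cast_smul_eq_nsmul k, smul_smul]
  · have : (boxCount T x : k) ≠ 0 := Nat.cast_ne_zero.mpr (boxCount_pos x).ne'
    rw [boxCount] at *
    rw [mul_inv_cancel₀ this, one_smul]
  · intro A hA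
    rw [(Finset.mem_filter.mp hA).2]

/-- Translation by `C` reindexes the sum. The factor `σ(C, A)` produced by the product in the first
leg is the same as the one produced by inverting the composite in the second. -/
lemma box_mul_casimir (C : B) :
    (box c C ⊗ₜ[k] 1) * casimir c = casimir c * (1 ⊗ₜ[k] box c C) := by
  classical
  rw [casimir, Finset.mul_sum, Finset.sum_mul]
  have h1 : ∀ A : B, (boxCount T (T.vBox.src A) : k)⁻¹ • (box c A ⊗ₜ[k] vinvBox c A) *
      (1 ⊗ₜ[k] box c C) = if T.vBox.src A = T.vBox.src C then
      (boxCount T (T.vBox.src A) : k)⁻¹ • (box c A ⊗ₜ[k] (vinvBox c A * box c C)) else 0 := by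
    intro A
    split_ifs with h
    · rw [smul_mul_assoc, Algebra.TensorProduct.tmul_mul_tmul, mul_one]
    · rw [smul_mul_assoc, Algebra.TensorProduct.tmul_mul_tmul, mul_one,
        vinvBox_mul_box_of_ne h, TensorProduct.tmul_zero, smul_zero]
  simp only [h1]
  rw [← sum_src_comp]
  refine Finset.sum_congr rfl fun A _ => ?_
  rw [mul_smul_comm, Algebra.TensorProduct.tmul_mul_tmul, one_mul]
  split_ifs with h
  · rw [T.vBox.src_comp _ _ h, boxCount_src C, h, vinvBox_vcomp h, box_mul_box_of h,
      smul_mul_assoc, mul_assoc, vinvBox_mul_box, h, vinvBox_mul_vone, TensorProduct.tmul_smul,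
      ← TensorProduct.smul_tmul']
  · rw [box_mul_box_of_ne h, TensorProduct.zero_tmul, smul_zero]

lemma mul_casimir_comm (a : TwistedAlg T c) :
    (a ⊗ₜ[k] 1) * casimir c = casimir c * (1 ⊗ₜ[k] a) := by
  induction a using induction with
  | h0 => simp
  | hadd a b ha hb => simp only [TensorProduct.add_tmul, TensorProduct.tmul_add, add_mul, mul_add,
      ha, hb]
  | hbox r A =>
    rw [← TensorProduct.smul_tmul', TensorProduct.tmul_smul, smul_mul_assoc, mul_smul_comm,
      box_mul_casimir]

end TwistedAlg

/-- An algebra over a field with a separability element is semisimple. -/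
lemma isSemisimpleRing_of_separability {k A : Type*} [Field k] [Ring A] [Algebra k A]
    (e : A ⊗[k] A) (he : LinearMap.mul' k A e = 1)
    (hc : ∀ a : A, (a ⊗ₜ[k] 1) * e = e * (1 ⊗ₜ[k] a)) : IsSemisimpleRing A := by
  refine (isSemisimpleModule_iff A A).mpr ⟨fun I => ?_⟩
  -- A retraction onto the left ideal exists over the field. Writing `e = ∑ aᵢ ⊗ bᵢ`, it is averaged
  -- to `m ↦ ∑ aᵢ p(bᵢ m)`: the commutation `hc` makes this linear over `A`, and `he` makes it the
  -- identity on `I`.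
  obtain ⟨p, hp⟩ := ((I.restrictScalars k).subtype).exists_leftInverse_of_injective
    (Submodule.ker_subtype _)
  replace hp : ∀ x : I, p x = x := fun x => LinearMap.congr_fun hp x
  let Φ (m : A) : A ⊗[k] A →ₗ[k] A := TensorProduct.lift ((LinearMap.mul k A).compl₂
    ((I.restrictScalars k).subtype ∘ₗ p ∘ₗ LinearMap.mulRight k m))
  have hΦ : ∀ m a b, Φ m (a ⊗ₜ b) = a * (p (b * m) : A) := fun m a b => rfl
  have hmem : ∀ m t, Φ m t ∈ I := by
    intro m t
    induction t with
    | zero => rw [map_zero]; exact I.zero_mem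
    | add s t hs ht => rw [map_add]; exact I.add_mem hs ht
    | tmul a b => rw [hΦ]; exact I.smul_mem a (p (b * m)).2
  have h1 : ∀ m a t, Φ m ((a ⊗ₜ 1) * t) = a * Φ m t := by
    intro m a t
    induction t with
    | zero => simp
    | add s t hs ht => simp only [mul_add, map_add, hs, ht]
    | tmul x y => simp [hΦ, mul_assoc]
  have h2 : ∀ m a t, Φ m (t * (1 ⊗ₜ a)) = Φ (a * m) t := by
    intro m a t
    induction t with
    | zero => simp
    | add s t hs ht => simp only [add_mul, map_add, hs, ht]
    | tmul x y => simp [hΦ, mul_assoc]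
  have h3 : ∀ (m : I) t, Φ m t = LinearMap.mul' k A t * m := by
    intro m t
    induction t with
    | zero => simp
    | add s t hs ht => simp only [add_mul, map_add, hs, ht]
    | tmul x y =>
      rw [hΦ, LinearMap.mul'_apply, mul_assoc]
      exact congrArg (x * ((·) : I → A) ·) (hp (y • m))
  have hadd : ∀ m m' t, Φ (m + m') t = Φ m t + Φ m' t := by
    intro m m' t
    induction t with
    | zero => simp
    | add s t hs ht => simp only [map_add, hs, ht]; abel
    | tmul x y => simp [hΦ, mul_add]
  let q : A →ₗ[A] I :=
    { toFun := fun m => ⟨Φ m e, hmem m e⟩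
      map_add' := fun m m' => Subtype.ext (hadd m m' e)
      map_smul' := fun a m => Subtype.ext (by
        change Φ (a * m) e = a * Φ m e
        rw [← h2, ← hc, h1]) }
  exact ⟨_, LinearMap.isCompl_of_proj (f := q) fun x => Subtype.ext (by
    change Φ x e = x
    rw [h3, he, one_mul])⟩

instance {B H V P : Type u} {T : VacantDoubleGroupoid B H V P} {k : Type u} [Field k] [CharZero k]
    {c : T.Cocycle k} [Fintype B] [Fintype H] : IsSemisimpleRing (TwistedAlg T c) :=
  isSemisimpleRing_of_separability _ TwistedAlg.mul_casimir TwistedAlg.mul_casimir_comm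

/-! ### Representations form an abelian category -/

namespace FinRep

section category

variable {k A : Type u} [Field k] [Ring A] [Algebra k A]

/-- The subrepresentation on an invariant subspace. -/
def sub (X : FinRep k A) (W : Submodule k X.V) (hW : ∀ a, ∀ v ∈ W, X.ρ a v ∈ W) :
    FinRep k A where
  V := W
  ρ := AlgHom.ofLinearMap
    { toFun := fun a => (X.ρ a).restrict (hW a)
      map_add' := fun a b => LinearMap.ext fun v => Subtype.ext (by
        change X.ρ (a + b) v = X.ρ a v + X.ρ b v
        rw [map_add]; rfl)
      map_smul' := fun r a => LinearMap.ext fun v => Subtype.ext (by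
        change X.ρ (r • a) v = r • X.ρ a v
        rw [map_smul]; rfl) }
    (LinearMap.ext fun v => Subtype.ext (by
      change X.ρ 1 v = v
      rw [map_one]; rfl))
    (fun a b => LinearMap.ext fun v => Subtype.ext (by
      change X.ρ (a * b) v = X.ρ a (X.ρ b v)
      rw [map_mul]; rfl))

/-- The inclusion of a subrepresentation. -/
def subι (X : FinRep k A) (W : Submodule k X.V) (hW : ∀ a, ∀ v ∈ W, X.ρ a v ∈ W) :
    X.sub W hW ⟶ X where
  hom := W.subtype
  comm _ _ := rfl

/-- The quotient by an invariant subspace. -/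
def quot (X : FinRep k A) (W : Submodule k X.V) (hW : ∀ a, ∀ v ∈ W, X.ρ a v ∈ W) :
    FinRep k A where
  V := X.V ⧸ W
  ρ := AlgHom.ofLinearMap
    { toFun := fun a => W.mapQ W (X.ρ a) (hW a)
      map_add' := fun a b => Submodule.linearMap_qext _ (LinearMap.ext fun v => by simp)
      map_smul' := fun r a => Submodule.linearMap_qext _ (LinearMap.ext fun v => by simp) }
    (Submodule.linearMap_qext _ (LinearMap.ext fun v => by simp))
    (fun a b => Submodule.linearMap_qext _ (LinearMap.ext fun v => by simp))

/-- The projection onto a quotient representation. -/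
def quotπ (X : FinRep k A) (W : Submodule k X.V) (hW : ∀ a, ∀ v ∈ W, X.ρ a v ∈ W) :
    X ⟶ X.quot W hW where
  hom := W.mkQ
  comm _ _ := rfl

/-- The direct sum of a finite family of representations. -/
def pi {n : ℕ} (X : Fin n → FinRep k A) : FinRep k A where
  V := ∀ i, (X i).V
  ρ := AlgHom.ofLinearMap
    { toFun := fun a => LinearMap.pi fun i => (X i).ρ a ∘ₗ LinearMap.proj i
      map_add' := fun a b => LinearMap.ext fun v => funext fun i => by simp
      map_smul' := fun r a => LinearMap.ext fun v => funext fun i => by simp }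
    (LinearMap.ext fun v => funext fun i => by simp)
    (fun a b => LinearMap.ext fun v => funext fun i => by simp)

variable {X Y : FinRep k A}

lemma ker_invariant (f : X ⟶ Y) (a : A) (v : X.V) (hv : v ∈ LinearMap.ker f.hom) :
    X.ρ a v ∈ LinearMap.ker f.hom := by
  rw [LinearMap.mem_ker] at *
  rw [f.comm, hv, map_zero]

lemma range_invariant (f : X ⟶ Y) (a : A) (v : Y.V) (hv : v ∈ LinearMap.range f.hom) :
    Y.ρ a v ∈ LinearMap.range f.hom := by
  obtain ⟨x, rfl⟩ := hv
  exact ⟨X.ρ a x, f.comm a x⟩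

lemma hom_congr {f g : X ⟶ Y} (h : f = g) (x : X.V) : f.hom x = g.hom x := by rw [h]

lemma mono_of_injective {f : X ⟶ Y} (hf : Function.Injective f.hom) : Mono f :=
  ⟨fun _ _ e => hom_ext (LinearMap.ext fun v => hf (hom_congr e v))⟩

/-- The inclusion of the kernel and the zero map become equal after composing with `f`. -/
lemma injective_of_mono (f : X ⟶ Y) [Mono f] : Function.Injective f.hom := by
  have h : X.subι _ (ker_invariant f) ≫ f = 0 ≫ f :=
    hom_ext (LinearMap.ext fun v => v.2.trans (map_zero f.hom).symm)
  exact (injective_iff_map_eq_zero f.hom).mpr fun v hv => hom_congr ((cancel_mono f).mp h) ⟨v, hv⟩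

/-- The projection onto the quotient by the range and the zero map become equal after precomposing
with `f`. -/
lemma surjective_of_epi (f : X ⟶ Y) [Epi f] : Function.Surjective f.hom := by
  rw [← LinearMap.range_eq_top]
  have h : f ≫ Y.quotπ _ (range_invariant f) = f ≫ 0 :=
    hom_ext (LinearMap.ext fun v => (Submodule.Quotient.mk_eq_zero _).mpr ⟨v, rfl⟩)
  have h' := congrArg Hom.hom ((cancel_epi f).mp h)
  rw [← Submodule.ker_mkQ (LinearMap.range f.hom)]
  exact LinearMap.ker_eq_top.mpr h'

lemma isIso_of_bijective {f : X ⟶ Y} (hf : Function.Bijective f.hom) : IsIso f :=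
  (mkIso f (LinearEquiv.ofBijective f.hom hf).symm.toLinearMap
    (LinearMap.ext fun x => (LinearEquiv.ofBijective f.hom hf).symm_apply_apply x)
    (LinearMap.ext fun y => (LinearEquiv.ofBijective f.hom hf).apply_symm_apply y)).isIso_hom

lemma bijective_of_isIso (f : X ⟶ Y) [IsIso f] : Function.Bijective f.hom :=
  ⟨injective_of_mono f, surjective_of_epi f⟩

/-- The subrepresentation on the kernel is a kernel. -/
def kernelIsLimit (f : X ⟶ Y) : Limits.IsLimit (Limits.KernelFork.ofι (f := f)
    (X.subι _ (ker_invariant f)) (hom_ext (LinearMap.ext fun v => v.2))) :=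
  Limits.KernelFork.IsLimit.ofι _ _
    (fun g h => ⟨g.hom.codRestrict _ fun v => hom_congr h v, fun a v => Subtype.ext (g.comm a v)⟩)
    (fun _ _ => rfl)
    (fun _ _ _ e => hom_ext (LinearMap.ext fun v => Subtype.ext (hom_congr e v)))

/-- The quotient by the range is a cokernel. -/
def cokernelIsColimit (f : X ⟶ Y) : Limits.IsColimit (Limits.CokernelCofork.ofπ (f := f)
    (Y.quotπ _ (range_invariant f)) (hom_ext (LinearMap.ext fun v =>
      (Submodule.Quotient.mk_eq_zero _).mpr ⟨v, rfl⟩))) :=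
  Limits.CokernelCofork.IsColimit.ofπ _ _
    (fun g h => ⟨(LinearMap.range f.hom).liftQ g.hom (by
      rintro _ ⟨x, rfl⟩
      exact hom_congr h x), fun a v => by
        obtain ⟨v, rfl⟩ := Submodule.mkQ_surjective _ v
        exact g.comm a v⟩)
    (fun _ _ => rfl)
    (fun _ _ _ e => hom_ext (LinearMap.ext fun v => by
      obtain ⟨v, rfl⟩ := Submodule.mkQ_surjective _ v
      exact hom_congr e v))

/-- A monomorphism is the kernel of its cokernel. -/
lemma nonempty_normalMono (f : X ⟶ Y) [Mono f] : Nonempty (NormalMono f) :=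
  have hf := injective_of_mono f
  -- The retraction is only linear over the field. Composed with a map into the range of `f` it
  -- becomes equivariant, because this may be checked after applying the injective map `f`.
  have hr : ∃ r : Y.V →ₗ[k] X.V, r ∘ₗ f.hom = LinearMap.id :=
    f.hom.exists_leftInverse_of_injective (LinearMap.ker_eq_bot.mpr hf)
  have key : ∀ {Z : FinRep k A} (g : Z ⟶ Y) (_ : g ≫ Y.quotπ _ (range_invariant f) = 0) (z : Z.V),
      f.hom (hr.choose (g.hom z)) = g.hom z := by
    intro Z g h z
    have hz : g.hom z ∈ LinearMap.range f.hom :=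
      (Submodule.Quotient.mk_eq_zero _).mp (hom_congr h z)
    obtain ⟨x, hx⟩ := hz
    rw [← hx]
    congr 1
    exact LinearMap.congr_fun hr.choose_spec x
  ⟨{
    Z := Y.quot _ (range_invariant f)
    g := Y.quotπ _ (range_invariant f)
    w := hom_ext (LinearMap.ext fun v => (Submodule.Quotient.mk_eq_zero _).mpr ⟨v, rfl⟩)
    isLimit := Limits.KernelFork.IsLimit.ofι _ _
      (fun g h => ⟨hr.choose ∘ₗ g.hom, fun a z => hf (by
        rw [f.comm, LinearMap.comp_apply, LinearMap.comp_apply, key g h, key g h, g.comm])⟩)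
      (fun g h => hom_ext (LinearMap.ext (key g h)))
      (fun g h m e => hom_ext (LinearMap.ext fun z => hf
        ((hom_congr e z).trans (key g h z).symm))) }⟩

/-- An epimorphism is the cokernel of its kernel. -/
lemma nonempty_normalEpi (f : X ⟶ Y) [Epi f] : Nonempty (NormalEpi f) :=
  have hf := surjective_of_epi f
  -- The section is only linear over the field. Its failure to invert `f` lies in the kernel of `f`,
  -- which the maps to be factored annihilate.
  have hs : ∃ s : Y.V →ₗ[k] X.V, f.hom ∘ₗ s = LinearMap.id :=
    f.hom.exists_rightInverse_of_surjective (LinearMap.range_eq_top.mpr hf)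
  have key : ∀ {Z : FinRep k A} (g : X ⟶ Z) (_ : X.subι _ (ker_invariant f) ≫ g = 0) (x : X.V),
      g.hom (hs.choose (f.hom x)) = g.hom x := by
    intro Z g h x
    have hx : hs.choose (f.hom x) - x ∈ LinearMap.ker f.hom := by
      rw [LinearMap.mem_ker, map_sub, sub_eq_zero]
      exact LinearMap.congr_fun hs.choose_spec (f.hom x)
    rw [← sub_eq_zero, ← map_sub]
    exact hom_congr h ⟨_, hx⟩
  ⟨{
    W := X.sub _ (ker_invariant f)
    g := X.subι _ (ker_invariant f)
    w := hom_ext (LinearMap.ext fun v => v.2)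
    isColimit := Limits.CokernelCofork.IsColimit.ofπ _ _
      (fun g h => ⟨g.hom ∘ₗ hs.choose, fun a y => by
        obtain ⟨x, rfl⟩ := hf y
        rw [← f.comm, LinearMap.comp_apply, LinearMap.comp_apply, key g h, key g h, g.comm]⟩)
      (fun g h => hom_ext (LinearMap.ext (key g h)))
      (fun g h m e => hom_ext (LinearMap.ext fun y => by
        obtain ⟨x, rfl⟩ := hf y
        exact (hom_congr e x).trans (key g h x).symm)) }⟩

lemma sum_hom {ι : Type*} (s : Finset ι) (f : ι → (X ⟶ Y)) :
    Hom.hom (∑ i ∈ s, f i : X ⟶ Y) = ∑ i ∈ s, (f i).hom :=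
  map_sum (AddMonoidHom.mk' (fun f : X ⟶ Y => f.hom) fun _ _ => rfl) f s

/-- The direct sum as a bicone. -/
def piBicone {n : ℕ} (X : Fin n → FinRep k A) : Limits.Bicone X where
  pt := pi X
  π i := ⟨LinearMap.proj i, fun _ _ => rfl⟩
  ι i := ⟨LinearMap.single k (fun i => (X i).V) i, fun a v => funext fun j => by
    change Pi.single (M := fun i => (X i).V) i ((X i).ρ a v) j =
      (X j).ρ a (Pi.single (M := fun i => (X i).V) i v j)
    by_cases h : j = i
    · subst h; simp
    · simp [h]⟩
  ι_π i j := by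
    split_ifs with h
    · subst h
      exact hom_ext (LinearMap.ext fun v => Pi.single_eq_same (M := fun i => (X i).V) i v)
    · exact hom_ext (LinearMap.ext fun v =>
        Pi.single_eq_of_ne (M := fun i => (X i).V) (Ne.symm h) v)

instance : Limits.HasFiniteBiproducts (FinRep k A) where
  out n := ⟨fun X => Limits.HasBiproduct.mk
    { bicone := piBicone X
      isBilimit := Limits.isBilimitOfTotal _ (hom_ext (LinearMap.ext fun v => by
        rw [sum_hom, LinearMap.sum_apply]
        exact Finset.univ_sum_single (M := fun i => (X i).V) v)) }⟩

instance : Abelian (FinRep k A) where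
  normalMonoOfMono f _ := nonempty_normalMono f
  normalEpiOfEpi f _ := nonempty_normalEpi f
  has_finite_products := inferInstance
  has_kernels := ⟨fun f => ⟨⟨_, kernelIsLimit f⟩⟩⟩
  has_cokernels := ⟨fun f => ⟨⟨_, cokernelIsColimit f⟩⟩⟩

instance finiteDimensional_hom (X Y : FinRep k A) : FiniteDimensional k (X ⟶ Y) :=
  FiniteDimensional.of_injective
    (⟨⟨fun f : X ⟶ Y => f.hom, fun _ _ => rfl⟩, fun _ _ => rfl⟩ : (X ⟶ Y) →ₗ[k] (X.V →ₗ[k] Y.V))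
    hom_injective

/-- Invariant subspaces are tested by the inclusion of the corresponding subrepresentation in one
direction, and by the range of a monomorphism in the other. -/
lemma simple_iff (X : FinRep k A) : Simple X ↔ Nontrivial X.V ∧
    ∀ W : Submodule k X.V, (∀ a, ∀ v ∈ W, X.ρ a v ∈ W) → W = ⊥ ∨ W = ⊤ := by
  constructor
  · intro hX
    constructor
    · by_contra h
      rw [not_nontrivial_iff_subsingleton] at h
      exact id_nonzero X (hom_ext (LinearMap.ext fun v => Subsingleton.elim _ _))
    · intro W hW
      have : Mono (X.subι W hW) := mono_of_injective Subtype.val_injective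
      by_cases h : X.subι W hW = 0
      · left
        exact (Submodule.eq_bot_iff W).mpr fun v hv => hom_congr h ⟨v, hv⟩
      · right
        have := isIso_of_mono_of_nonzero h
        rw [← Submodule.range_subtype W]
        exact LinearMap.range_eq_top.mpr (bijective_of_isIso (X.subι W hW)).2
  · rintro ⟨hX, hW⟩
    refine ⟨fun {Y} f hf => ⟨?_, ?_⟩⟩
    · rintro hi rfl
      obtain ⟨x, hx⟩ := exists_ne (0 : X.V)
      obtain ⟨y, hy⟩ := (bijective_of_isIso (0 : Y ⟶ X)).2 x
      exact hx hy.symm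
    · intro h
      refine isIso_of_bijective ⟨injective_of_mono f, ?_⟩
      rw [← LinearMap.range_eq_top]
      refine (hW _ (range_invariant f)).resolve_left fun h' => h (hom_ext ?_)
      exact LinearMap.range_eq_bot.mp h'

/-- A representation as a module over the algebra. -/
instance (X : FinRep k A) : Module A X.V := Module.compHom X.V X.ρ.toRingHom

lemma smul_def (X : FinRep k A) (a : A) (v : X.V) : a • v = X.ρ a v := rfl

instance (X : FinRep k A) : IsScalarTower k A X.V :=
  ⟨fun r a v => by rw [smul_def, map_smul]; rfl⟩

instance (X : FinRep k A) : Module.Finite A X.V := Module.Finite.of_restrictScalars_finite k A X.V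

/-- The regular representation. -/
def regular (k A : Type u) [Field k] [Ring A] [Algebra k A] [FiniteDimensional k A] :
    FinRep k A where
  V := A
  ρ := Algebra.lmul k A

/-- Over a semisimple algebra, every representation is a finite direct sum of simple ones. -/
lemma exists_bicone [IsSemisimpleRing A] (X : FinRep k A) :
    ∃ (n : ℕ) (S : Fin n → FinRep k A) (b : Limits.Bicone S),
      (∀ i, Simple (S i)) ∧ Nonempty b.IsBilimit ∧ Nonempty (X ≅ b.pt) := by
  obtain ⟨n, S, e, hS⟩ := IsSemisimpleModule.exists_linearEquiv_fin_dfinsupp A X.V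
  have hinv : ∀ i a, ∀ v ∈ (S i).restrictScalars k, X.ρ a v ∈ (S i).restrictScalars k :=
    fun i a v hv => (S i).smul_mem a hv
  let R : Fin n → FinRep k A := fun i => X.sub ((S i).restrictScalars k) (hinv i)
  -- The bicone has point `X` itself, with injections and projections carried over from the direct
  -- sum of simple submodules.
  let b : Limits.Bicone R :=
    { pt := X
      π := fun i => ⟨((DFinsupp.lapply i) ∘ₗ e.toLinearMap).restrictScalars k,
        fun a v => ((DFinsupp.lapply i) ∘ₗ e.toLinearMap).map_smul a v⟩
      ι := fun i => ⟨(e.symm.toLinearMap ∘ₗ DFinsupp.lsingle i).restrictScalars k,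
        fun a v => (e.symm.toLinearMap ∘ₗ DFinsupp.lsingle i).map_smul a v⟩
      ι_π := fun i j => by
        split_ifs with h
        · subst h
          exact hom_ext (LinearMap.ext fun v : S i =>
            (congrArg (· i) (e.apply_symm_apply (DFinsupp.single i v))).trans
              DFinsupp.single_eq_same)
        · exact hom_ext (LinearMap.ext fun v : S i =>
            (congrArg (· j) (e.apply_symm_apply (DFinsupp.single i v))).trans
              (DFinsupp.single_eq_of_ne (Ne.symm h))) }
  refine ⟨n, R, b, fun i => ?_, ⟨Limits.isBilimitOfTotal b ?_⟩, ⟨Iso.refl X⟩⟩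
  · rw [simple_iff]
    refine ⟨IsSimpleModule.nontrivial A (S i), fun W hW => ?_⟩
    let W' : Submodule A (S i) :=
      { carrier := {x | x ∈ W}
        add_mem' := W.add_mem
        zero_mem' := W.zero_mem
        smul_mem' := fun a x hx => hW a x hx }
    rcases eq_bot_or_eq_top W' with h | h
    · left
      exact (Submodule.eq_bot_iff _).mpr fun x hx => (Submodule.eq_bot_iff _).mp h x hx
    · right
      exact Submodule.eq_top_iff'.mpr fun x => Submodule.eq_top_iff'.mp h x
  · refine hom_ext (LinearMap.ext fun v => ?_)
    rw [sum_hom, LinearMap.sum_apply]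
    change ∑ i, e.symm (DFinsupp.single i (e v i)) = v
    rw [← map_sum, e.symm_apply_eq]
    classical
    refine DFinsupp.ext fun j => ?_
    rw [DFinsupp.finsetSum_apply, Finset.sum_eq_single j]
    · rw [DFinsupp.single_eq_same]
    · intro i _ h
      rw [DFinsupp.single_eq_of_ne (Ne.symm h)]
    · simp

/-- A semisimple algebra has finitely many simple representations. -/
lemma exists_simples [FiniteDimensional k A] [IsSemisimpleRing A] :
    ∃ (n : ℕ) (S : Fin n → FinRep k A), ∀ X : FinRep k A, Simple X → ∃ i, Nonempty (X ≅ S i) := by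
  obtain ⟨n, S, b, hS, ⟨hb⟩, ⟨e⟩⟩ := exists_bicone (regular k A)
  refine ⟨n, S, fun X hX => ?_⟩
  obtain ⟨x, hx⟩ := @exists_ne X.V ((simple_iff X).mp hX).1 0
  -- The orbit map of a nonzero vector, nonzero because it sends 1 to `x`.
  let f : regular k A ⟶ X := ⟨X.ρ.toLinearMap.flip x, fun a (v : A) => by
    change X.ρ (a * v) x = X.ρ a (X.ρ v x)
    rw [map_mul]; rfl⟩
  have hf : f ≠ 0 := by
    intro h
    refine hx (Eq.trans ?_ (hom_congr h (1 : A)))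
    change x = X.ρ 1 x
    rw [map_one]; rfl
  -- By Schur's lemma a nonzero map from a simple summand of the regular representation to `X` is an
  -- isomorphism, so if `X` matches no summand then `f` vanishes on each of them.
  by_contra! hn
  apply hf
  have h0 : e.inv ≫ f = 0 := by
    rw [← Category.id_comp (e.inv ≫ f), ← Limits.IsBilimit.total hb, Preadditive.sum_comp]
    refine Finset.sum_eq_zero fun i _ => ?_
    rw [Category.assoc]
    have := hS i
    by_cases h : b.ι i ≫ e.inv ≫ f = 0
    · rw [h, Limits.comp_zero]
    · have := isIso_of_hom_simple h
      exact ((hn i).false (asIso (b.ι i ≫ e.inv ≫ f)).symm).elim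
  rw [← e.hom_inv_id_assoc f, h0, Limits.comp_zero]

end category

/-! ### Bilinearity of the tensor product of morphisms. -/

section monoidal

variable {k A : Type u} [Field k] [Ring A] [Algebra k A] [WeakBialgebra k A]
  [FiniteDimensional k A]

lemma ι_whiskerLeft (X : FinRep k A) {Y Z : FinRep k A} (f : Y ⟶ Z) (w : (tensor X Y).V) :
    ι X Z ((X ◁ f).hom w) = f.hom.lTensor X.V (ι X Y w) := ι_tensorMap (𝟙 X) f w

lemma ι_whiskerRight {Y Z : FinRep k A} (f : Y ⟶ Z) (X : FinRep k A) (w : (tensor Y X).V) :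
    ι Z X ((f ▷ X).hom w) = f.hom.rTensor X.V (ι Y X w) := ι_tensorMap f (𝟙 X) w

instance : MonoidalPreadditive (FinRep k A) where
  whiskerLeft_zero := hom_ext (LinearMap.ext fun w => ι_injective _ _ (by
    rw [ι_whiskerLeft]; simp))
  zero_whiskerRight := hom_ext (LinearMap.ext fun w => ι_injective _ _ (by
    rw [ι_whiskerRight]; simp))
  whiskerLeft_add f g := hom_ext (LinearMap.ext fun w => ι_injective _ _ (by
    rw [add_hom, LinearMap.add_apply, map_add, ι_whiskerLeft, ι_whiskerLeft, ι_whiskerLeft,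
      add_hom, LinearMap.lTensor_add]; rfl))
  add_whiskerRight f g := hom_ext (LinearMap.ext fun w => ι_injective _ _ (by
    rw [add_hom, LinearMap.add_apply, map_add, ι_whiskerRight, ι_whiskerRight, ι_whiskerRight,
      add_hom, LinearMap.rTensor_add]; rfl))

instance : MonoidalLinear k (FinRep k A) where
  whiskerLeft_smul X _ _ r f := hom_ext (LinearMap.ext fun w => ι_injective _ _ (by
    rw [smul_hom, LinearMap.smul_apply, map_smul, ι_whiskerLeft, ι_whiskerLeft,
      smul_hom, LinearMap.lTensor_smul]; rfl))
  smul_whiskerRight r _ _ f X := hom_ext (LinearMap.ext fun w => ι_injective _ _ (by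
    rw [smul_hom, LinearMap.smul_apply, map_smul, ι_whiskerRight, ι_whiskerRight,
      smul_hom, LinearMap.rTensor_smul]; rfl))

end monoidal

end FinRep

/-! ### Duals -/

namespace FinRep

open Coalgebra WeakBialgebra

section dual

variable {k A : Type u} [Field k] [Ring A] [Algebra k A]

/-- The dual space of a representation, on which `a` acts by the transpose of `S a`, for an
anti-endomorphism `S` of the algebra. -/
def dual (S : A →ₗ[k] A) (h1 : S 1 = 1) (hm : ∀ a b, S (a * b) = S b * S a) (X : FinRep k A) :
    FinRep k A where
  V := Module.Dual k X.V
  ρ := AlgHom.ofLinearMap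
    { toFun := fun a => (X.ρ (S a)).dualMap
      map_add' := fun a b => LinearMap.ext fun f => LinearMap.ext fun v => by simp
      map_smul' := fun r a => LinearMap.ext fun f => LinearMap.ext fun v => by simp }
    (LinearMap.ext fun f => LinearMap.ext fun v => by simp [h1])
    (fun a b => LinearMap.ext fun f => LinearMap.ext fun v => by simp [hm])

variable {S : A →ₗ[k] A} {h1 : S 1 = 1} {hm : ∀ a b, S (a * b) = S b * S a}

/-- The elements of the dual representation as linear forms. -/
def dualForm (X : FinRep k A) : (dual S h1 hm X).V ≃ₗ[k] Module.Dual k X.V :=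
  LinearEquiv.refl k (Module.Dual k X.V)

lemma dualForm_ρ (X : FinRep k A) (a : A) (f : (dual S h1 hm X).V) (v : X.V) :
    dualForm X ((dual S h1 hm X).ρ a f) v = dualForm X f (X.ρ (S a) v) := rfl

/-- `x ⊗ f ↦ (v ↦ f(v) x)` -/
def tensorDualEquiv (X : FinRep k A) : X.V ⊗[k] (dual S h1 hm X).V ≃ₗ[k] Module.End k X.V :=
  TensorProduct.congr (LinearEquiv.refl k X.V) (dualForm X) ≪≫ₗ TensorProduct.comm k _ _ ≪≫ₗ
    dualTensorHomEquiv k X.V X.V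

lemma tensorDualEquiv_tmul (X : FinRep k A) (x v : X.V) (f : (dual S h1 hm X).V) :
    tensorDualEquiv X (x ⊗ₜ f) v = dualForm X f v • x := by
  simp [tensorDualEquiv]

/-- A representation is isomorphic to its double dual with respect to inverse
anti-automorphisms. -/
def doubleDualIso {S' : A →ₗ[k] A} {h1' : S' 1 = 1} {hm' : ∀ a b, S' (a * b) = S' b * S' a}
    (hS : ∀ a, S' (S a) = a) (X : FinRep k A) : X ≅ dual S h1 hm (dual S' h1' hm' X) :=
  mkIso ⟨Module.Dual.eval k X.V, fun a v => LinearMap.ext fun f : Module.Dual k X.V => by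
      change f (X.ρ a v) = f (X.ρ (S' (S a)) v)
      rw [hS]⟩
    (Module.evalEquiv k X.V).symm.toLinearMap
    (LinearMap.ext fun v => (Module.evalEquiv k X.V).symm_apply_apply v)
    (LinearMap.ext fun v => (Module.evalEquiv k X.V).apply_symm_apply v)

end dual

/-! ### Constraints evaluated on projections of unrestricted tensors. -/

section monoidal

variable {k A : Type u} [Field k] [Ring A] [Algebra k A] [WeakBialgebra k A]

lemma tensorMap_π {X X' Y Y' : FinRep k A} (f : X ⟶ X') (g : Y ⟶ Y') (w : X.V ⊗[k] Y.V) :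
    (tensorMap f g).hom (π X Y w) = π X' Y' (TensorProduct.map f.hom g.hom w) := by
  apply ι_injective
  rw [ι_tensorMap, ι_π, ι_π, act₂_natural]

lemma ρ_π (X Y : FinRep k A) (a : A) (w : X.V ⊗[k] Y.V) :
    (tensor X Y).ρ a (π X Y w) = π X Y (act₂ X Y (comul a) w) := by
  apply ι_injective
  rw [ι_ρ, ι_π, ι_π, act₂_mul_apply, act₂_mul_apply, comul_mul_comul_one, comul_one_mul_comul]

/-- Allows the zigzags to be computed on the full tensor products of vector spaces, the projections
being applied only at the ends. -/
lemma assocIso_hom_pL (X Y Z : FinRep k A) (w : (X.V ⊗[k] Y.V) ⊗[k] Z.V) :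
    (assocIso X Y Z).hom.hom (pL X Y Z w) = pR X Y Z (TensorProduct.assoc k _ _ _ w) := by
  apply jR_injective
  rw [jR_assocIso, jL_pL, jR_pR]

lemma assocIso_inv_pR (X Y Z : FinRep k A) (w : X.V ⊗[k] (Y.V ⊗[k] Z.V)) :
    (assocIso X Y Z).inv.hom (pR X Y Z w) = pL X Y Z ((TensorProduct.assoc k _ _ _).symm w) := by
  have h := assocIso_hom_pL X Y Z ((TensorProduct.assoc k _ _ _).symm w)
  rw [LinearEquiv.apply_symm_apply] at h
  rw [← h]
  exact hom_congr (assocIso X Y Z).hom_inv_id _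

variable [FiniteDimensional k A]

lemma leftIso_hom_π (X : FinRep k A) (w : (tensorUnit k A).V ⊗[k] X.V) :
    (leftIso X).hom.hom (π _ _ w) = leftAct X w := by
  rw [leftIso_apply, ι_π, leftCounit_act₂, map_one]; rfl

lemma rightIso_hom_π (X : FinRep k A) (w : X.V ⊗[k] (tensorUnit k A).V) :
    (rightIso X).hom.hom (π _ _ w) = rightAct X w := by
  rw [rightIso_apply, ι_π, rightCounit_act₂, map_one]; rfl

lemma leftIso_inv_apply (X : FinRep k A) (x : X.V) :
    (leftIso X).inv.hom x = π (tensorUnit k A) X (oneT k A ⊗ₜ x) := rfl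

lemma rightIso_inv_apply (X : FinRep k A) (x : X.V) :
    (rightIso X).inv.hom x = π X (tensorUnit k A) (x ⊗ₜ oneT k A) := rfl

lemma incl_εt' (a : A) : incl k A (εt' k A a) = εt k A a := rfl

end monoidal

end FinRep

/-! ### Evaluation, coevaluation and rigidity. -/

namespace TwistedAlg

open Coalgebra WeakBialgebra FinRep

variable {B H V P : Type u} {T : VacantDoubleGroupoid B H V P} {k : Type u} [Field k]
  {c : T.Cocycle k} [Fintype H]

/-- The dual representation, defined by the antipode. -/
abbrev rightDual (X : RepTwisted T c) : RepTwisted T c :=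
  dual (antipode c) antipode_one antipode_mul X

/-- The element of `X ⊗ X*` corresponding to the identity. -/
def coevElt (X : RepTwisted T c) : X.V ⊗[k] (rightDual X).V := (tensorDualEquiv X).symm 1

/-- In terms of endomorphisms, `a ⊗ b` acts by `φ ↦ a φ S(b)`; here `φ` is the identity. -/
lemma tensorDualEquiv_act₂ (X : RepTwisted T c) (t : TwistedAlg T c ⊗[k] TwistedAlg T c) :
    tensorDualEquiv X (act₂ X (rightDual X) t (coevElt X)) =
      X.ρ (LinearMap.mul' k _ ((antipode c).lTensor _ t)) := by
  have key : ∀ (a b : TwistedAlg T c) (w : X.V ⊗[k] (rightDual X).V),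
      tensorDualEquiv X (act₂ X (rightDual X) (a ⊗ₜ b) w) =
      X.ρ a ∘ₗ tensorDualEquiv X w ∘ₗ X.ρ (antipode c b) := by
    intro a b w
    induction w with
    | zero => simp
    | add w w' h h' => simp only [map_add, h, h', LinearMap.add_comp, LinearMap.comp_add]
    | tmul x f =>
      ext v
      rw [act₂_tmul, TensorProduct.map_tmul]
      rw [tensorDualEquiv_tmul, LinearMap.comp_apply, LinearMap.comp_apply, tensorDualEquiv_tmul,
        dualForm_ρ, map_smul]
  induction t with
  | zero => simp
  | add s t hs ht => simp only [map_add, LinearMap.add_apply, hs, ht]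
  | tmul a b =>
    rw [key, coevElt, LinearEquiv.apply_symm_apply, LinearMap.lTensor_tmul, LinearMap.mul'_apply,
      map_mul]
    rfl

lemma sum_tgtIdem_apply [Fintype P] (X : RepTwisted T c) (x : X.V) :
    ∑ p : P, X.ρ (tgtIdem c p) (X.ρ (tgtIdem c p) x) = x := by
  have h : ∀ p : P, X.ρ (tgtIdem c p) (X.ρ (tgtIdem c p) x) = X.ρ (tgtIdem c p) x := fun p => by
    rw [← Module.End.mul_apply, ← map_mul, tgtIdem_mul_self]
  simp only [h]
  rw [← LinearMap.sum_apply, ← map_sum, sum_tgtIdem, map_one]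
  rfl

variable [Fintype B]

lemma incl_srcIdem (p : P) : incl k (TwistedAlg T c) (εt' k _ (srcIdem c p)) = srcIdem c p := by
  rw [incl_εt', ← srcIdem_eq_εt, εt_εt]

/-- The action on the canonical element is given by `h₁ S(h₂) = ε_t(h)`, so it depends on `h` only
through `ε_t(h)`. This is the equivariance of the coevaluation, since the unit object carries the
action `h · z = ε_t(hz)`. -/
lemma act₂_εt_coevElt (X : RepTwisted T c) (h : TwistedAlg T c) :
    act₂ X (rightDual X) (comul (εt k _ h)) (coevElt X) =
      act₂ X (rightDual X) (comul h) (coevElt X) := by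
  apply (tensorDualEquiv X).injective
  rw [tensorDualEquiv_act₂, tensorDualEquiv_act₂, mul_antipode, mul_antipode, εt_εt]

/-- The coevaluation. -/
def coev (X : RepTwisted T c) : tensorUnit k (TwistedAlg T c) ⟶ tensor X (rightDual X) where
  hom := (tensor X (rightDual X)).ρ.toLinearMap.flip (π _ _ (coevElt X)) ∘ₗ incl k _
  comm a z := by
    change (tensor X (rightDual X)).ρ (εt k _ (a * incl k _ z)) (π _ _ (coevElt X)) =
      (tensor X (rightDual X)).ρ a ((tensor X (rightDual X)).ρ (incl k _ z) (π _ _ (coevElt X)))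
    rw [ρ_π, act₂_εt_coevElt, ← ρ_π, map_mul]
    rfl

lemma coev_oneT (X : RepTwisted T c) :
    (coev X).hom (oneT k _) = π X (rightDual X) (coevElt X) := by
  change (tensor X (rightDual X)).ρ (incl k _ (oneT k _)) (π _ _ (coevElt X)) = _
  rw [incl_oneT, map_one]
  rfl

variable [Fintype P]

/-- `f ⊗ v ↦ f(1₁ v) 1₂` -/
def evFull (X : RepTwisted T c) :
    (rightDual X).V ⊗[k] X.V →ₗ[k] (tensorUnit k (TwistedAlg T c)).V :=
  ∑ p : P, (LinearMap.toSpanSingleton k _ (εt' k _ (srcIdem c p))) ∘ₗ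
    contractLeft k X.V ∘ₗ TensorProduct.map (dualForm X).toLinearMap (X.ρ (tgtIdem c p))

lemma evFull_tmul (X : RepTwisted T c) (f : (rightDual X).V) (v : X.V) :
    evFull X (f ⊗ₜ v) = ∑ p : P, dualForm X f (X.ρ (tgtIdem c p) v) • εt' k _ (srcIdem c p) := by
  rw [evFull, LinearMap.sum_apply]
  rfl

/-- This is `sum_antipode_tgtIdem` with the matrix coefficient `a ↦ f(a v)` applied to the first
leg. -/
lemma evFull_act₂ (X : RepTwisted T c) (h : TwistedAlg T c) (w : (rightDual X).V ⊗[k] X.V) :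
    evFull X (act₂ (rightDual X) X (comul h) w) = (tensorUnit k _).ρ h (evFull X w) := by
  induction w with
  | zero => simp
  | add w w' h h' => simp only [map_add, h, h']
  | tmul f v =>
    let E : TwistedAlg T c ⊗[k] TwistedAlg T c →ₗ[k] (tensorUnit k (TwistedAlg T c)).V :=
      (TensorProduct.lid k _).toLinearMap ∘ₗ TensorProduct.map (dualForm X f ∘ₗ X.ρ.toLinearMap.flip v) (εt' k _)
    have hE : ∀ a b, E (a ⊗ₜ b) = dualForm X f (X.ρ a v) • εt' k _ b := fun a b => rfl
    have key : ∀ t : TwistedAlg T c ⊗[k] TwistedAlg T c,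
        evFull X (act₂ (rightDual X) X t (f ⊗ₜ v)) =
        E (∑ p : P, LinearMap.mul' k (TwistedAlg T c) (TensorProduct.map (antipode c)
          (LinearMap.mulLeft k (tgtIdem c p)) t) ⊗ₜ[k] srcIdem c p) := by
      intro t
      induction t with
      | zero => simp
      | add s t hs ht =>
        simp only [map_add, LinearMap.add_apply, hs, ht, TensorProduct.add_tmul,
          Finset.sum_add_distrib]
      | tmul a b =>
        rw [act₂_tmul, TensorProduct.map_tmul, map_sum, evFull_tmul]
        refine Finset.sum_congr rfl fun p _ => ?_
        rw [hE, dualForm_ρ, TensorProduct.map_tmul, LinearMap.mul'_apply, LinearMap.mulLeft_apply, map_mul,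
          map_mul]
        rfl
    rw [key, sum_antipode_tgtIdem, map_sum, evFull_tmul, map_sum]
    refine Finset.sum_congr rfl fun p _ => ?_
    rw [hE, map_smul, tensorUnit_ρ, incl_srcIdem, εt'_εt]

/-- The evaluation. -/
def ev (X : RepTwisted T c) : tensor (rightDual X) X ⟶ tensorUnit k (TwistedAlg T c) where
  hom := evFull X ∘ₗ ι _ _
  comm a w := by
    rw [LinearMap.comp_apply, LinearMap.comp_apply, ι_ρ, evFull_act₂]

/-- The projection is the action of `Δ(1)`, which `evFull` turns into the trivial action of 1 on the
unit object. -/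
lemma ev_π (X : RepTwisted T c) (w : (rightDual X).V ⊗[k] X.V) :
    (ev X).hom (π _ _ w) = evFull X w := by
  change evFull X (ι _ _ (π _ _ w)) = _
  rw [ι_π, evFull_act₂, map_one]
  rfl

lemma ev_comp_π (X : RepTwisted T c) : (ev X).hom ∘ₗ π _ _ = evFull X :=
  LinearMap.ext (ev_π X)

/-- One of the two idempotents comes from the definition of the evaluation, the other from the right
action of `srcIdem p`, which is through `εr_srcIdem`. -/
lemma rightAct_evFull (X : RepTwisted T c) (x : X.V) (w : X.V ⊗[k] (rightDual X).V) :
    rightAct X ((evFull X).lTensor X.V (TensorProduct.assoc k _ _ _ (w ⊗ₜ x))) =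
      ∑ p : P, X.ρ (tgtIdem c p) (tensorDualEquiv X w (X.ρ (tgtIdem c p) x)) := by
  induction w with
  | zero => simp
  | add w w' h h' =>
    simp only [TensorProduct.add_tmul, map_add, h, h', LinearMap.add_apply, Finset.sum_add_distrib]
  | tmul v f =>
    rw [TensorProduct.assoc_tmul, LinearMap.lTensor_tmul, evFull_tmul, TensorProduct.tmul_sum, map_sum]
    refine Finset.sum_congr rfl fun p _ => ?_
    rw [TensorProduct.tmul_smul, map_smul, rightAct_tmul, incl_srcIdem, εr_srcIdem,
      tensorDualEquiv_tmul, map_smul]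

/-- Here `srcIdem p` acts on the dual, hence through the antipode, which turns it into `tgtIdem p`
on the original space. -/
lemma leftAct_evFull (X : RepTwisted T c) (f : (rightDual X).V)
    (w : X.V ⊗[k] (rightDual X).V) :
    dualForm X (leftAct (rightDual X) ((evFull X).rTensor (rightDual X).V
      ((TensorProduct.assoc k (rightDual X).V X.V (rightDual X).V).symm (f ⊗ₜ w)))) =
      ∑ p : P, dualForm X f ∘ₗ X.ρ (tgtIdem c p) ∘ₗ tensorDualEquiv X w ∘ₗ
        X.ρ (tgtIdem c p) := by
  induction w with
  | zero => simp
  | add w w' h h' =>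
    simp only [TensorProduct.tmul_add, map_add, h, h', LinearMap.add_comp, LinearMap.comp_add,
      Finset.sum_add_distrib]
  | tmul v g =>
    rw [TensorProduct.assoc_symm_tmul, LinearMap.rTensor_tmul, evFull_tmul,
      TensorProduct.sum_tmul, map_sum, map_sum]
    refine Finset.sum_congr rfl fun p _ => LinearMap.ext fun y => ?_
    rw [← TensorProduct.smul_tmul', map_smul, leftAct_tmul, incl_srcIdem, map_smul,
      LinearMap.smul_apply, dualForm_ρ, antipode_srcIdem, LinearMap.comp_apply,
      LinearMap.comp_apply, LinearMap.comp_apply, tensorDualEquiv_tmul, map_smul, map_smul,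
      smul_eq_mul, smul_eq_mul, mul_comm]

lemma zigzag (X : RepTwisted T c) :
    (leftIso X).inv ≫ tensorMap (coev X) (𝟙 X) ≫ (assocIso X (rightDual X) X).hom ≫
      tensorMap (𝟙 X) (ev X) ≫ (rightIso X).hom = 𝟙 X := by
  refine FinRep.hom_ext (LinearMap.ext fun x => ?_)
  simp only [comp_hom, LinearMap.comp_apply]
  rw [leftIso_inv_apply, tensorMap_π, TensorProduct.map_tmul, coev_oneT]
  have h1 : π (tensor X (rightDual X)) X (π X (rightDual X) (coevElt X) ⊗ₜ (Hom.hom (𝟙 X)) x) =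
    pL X (rightDual X) X (coevElt X ⊗ₜ x) := rfl
  rw [h1, assocIso_hom_pL, pR, LinearMap.comp_apply, tensorMap_π, rightIso_hom_π]
  have h2 : ∀ w, TensorProduct.map (Hom.hom (𝟙 X)) (ev X).hom
      ((π (rightDual X) X).lTensor X.V w) = (evFull X).lTensor X.V w := by
    intro w
    rw [← ev_comp_π, LinearMap.lTensor_comp]
    rfl
  -- For the canonical element the endomorphism is the identity, leaving a sum of squares of
  -- idempotents that add up to one.
  rw [h2, rightAct_evFull, coevElt, LinearEquiv.apply_symm_apply]
  exact sum_tgtIdem_apply X x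

lemma zigzag_dual (X : RepTwisted T c) :
    (rightIso (rightDual X)).inv ≫ tensorMap (𝟙 (rightDual X)) (coev X) ≫
      (assocIso (rightDual X) X (rightDual X)).inv ≫
      tensorMap (ev X) (𝟙 (rightDual X)) ≫ (leftIso (rightDual X)).hom = 𝟙 (rightDual X) := by
  refine FinRep.hom_ext (LinearMap.ext fun f => (dualForm X).injective ?_)
  simp only [comp_hom, LinearMap.comp_apply]
  rw [rightIso_inv_apply, tensorMap_π, TensorProduct.map_tmul, coev_oneT]
  have h1 : π (rightDual X) (tensor X (rightDual X))
      ((Hom.hom (𝟙 (rightDual X))) f ⊗ₜ π X (rightDual X) (coevElt X)) =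
    pR (rightDual X) X (rightDual X) (f ⊗ₜ coevElt X) := rfl
  rw [h1, assocIso_inv_pR, pL, LinearMap.comp_apply, tensorMap_π, leftIso_hom_π]
  have h2 : ∀ w, TensorProduct.map (ev X).hom (Hom.hom (𝟙 (rightDual X)))
      ((π (rightDual X) X).rTensor (rightDual X).V w) = (evFull X).rTensor (rightDual X).V w := by
    intro w
    rw [← ev_comp_π, LinearMap.rTensor_comp]
    rfl
  rw [h2, leftAct_evFull, coevElt, LinearEquiv.apply_symm_apply]
  refine LinearMap.ext fun x => ?_
  rw [LinearMap.sum_apply]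
  refine (map_sum (dualForm X f) _ _).symm.trans ?_
  exact congrArg (dualForm X f) (sum_tgtIdem_apply X x)

instance exactPairing (X : RepTwisted T c) : ExactPairing X (rightDual X) where
  coevaluation' := coev X
  evaluation' := ev X
  coevaluation_evaluation' := by
    have h : (ρ_ (rightDual X)).inv ≫ rightDual X ◁ coev X ≫ (α_ (rightDual X) X (rightDual X)).inv ≫
      ev X ▷ rightDual X ≫ (λ_ (rightDual X)).hom = 𝟙 (rightDual X) := zigzag_dual X
    rw [← Iso.inv_comp_eq, ← cancel_mono (λ_ (rightDual X)).hom, Iso.inv_hom_id]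
    simpa only [Category.assoc] using h
  evaluation_coevaluation' := by
    have h : (λ_ X).inv ≫ coev X ▷ X ≫ (α_ X (rightDual X) X).hom ≫ X ◁ ev X ≫ (ρ_ X).hom =
      𝟙 X := zigzag X
    rw [← Iso.inv_comp_eq, ← cancel_mono (ρ_ X).hom, Iso.inv_hom_id]
    simpa only [Category.assoc] using h

/-- The dual representation, defined by the inverse of the antipode. -/
abbrev leftDual (X : RepTwisted T c) : RepTwisted T c :=
  dual (antipodeEquiv c).symm.toLinearMap antipodeEquiv_symm_one antipodeEquiv_symm_mul X

/-- A representation is the right dual of its left dual. -/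
def isoRightDualLeftDual (X : RepTwisted T c) : X ≅ rightDual (leftDual X) :=
  doubleDualIso (antipodeEquiv c).symm_apply_apply X

/-- For left duals, the pairing of `leftDual X` with its right dual is transported along the
canonical isomorphism of that right dual with `X`. -/
instance : RigidCategory (RepTwisted T c) where
  rightDual X := ⟨rightDual X⟩
  leftDual X :=
    { leftDual := leftDual X
      exact := exactPairingCongrRight (isoRightDualLeftDual X) }

end TwistedAlg

/-! ### The unit object -/

namespace TwistedAlg

open Coalgebra WeakBialgebra FinRep

variable {B H V P : Type u} {T : VacantDoubleGroupoid B H V P} {k : Type u} [Field k]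
  {c : T.Cocycle k} [Fintype B] [Fintype H]

variable (c) in
/-- The element of the unit object corresponding to a point. -/
def unitElt (p : P) : (tensorUnit k (TwistedAlg T c)).V := εt' k _ (srcIdem c p)

lemma span_unitElt : Submodule.span k (Set.range (unitElt c)) = ⊤ := by
  refine Submodule.eq_top_iff'.mpr ?_
  rintro ⟨_, a, rfl⟩
  change εt' k _ a ∈ _
  induction a using induction with
  | h0 => rw [map_zero]; exact Submodule.zero_mem _
  | hadd a b ha hb => rw [map_add]; exact Submodule.add_mem _ ha hb
  | hbox r A =>
    rw [map_smul]
    refine Submodule.smul_mem _ _ ?_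
    rw [← εt'_εt]
    by_cases hA : T.IsHOne A
    · rw [εt_box_of hA]
      exact Submodule.subset_span ⟨_, rfl⟩
    · rw [εt_box_of_not hA, map_zero]
      exact Submodule.zero_mem _

/-- The counit takes the value 1 on it. -/
lemma unitElt_ne_zero (p : P) : unitElt c p ≠ 0 := by
  intro h
  have h1 := congrArg (fun z => counit (R := k) (incl k _ z)) h
  simp only [unitElt, incl_srcIdem, map_zero] at h1
  rw [← srcIdem_eq_εt, counit_εt, counit_box, counitBox, if_pos (T.isHOne_vone_one p)] at h1
  exact one_ne_zero h1

/-- Together with `box_unitElt_of_ne`, this describes the unit object completely: it is the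
linearized action of the vertical groupoid on its points, with arrows acting from the bottom end to
the top end. -/
lemma box_unitElt_of {A : B} (hA : T.IsHOne A) :
    (tensorUnit k (TwistedAlg T c)).ρ (box c A) (unitElt c (T.ver.tgt (T.hBox.src A))) =
      unitElt c (T.ver.src (T.hBox.src A)) := by
  rw [tensorUnit_ρ, unitElt, incl_srcIdem, box_mul_srcIdem, if_pos (T.bot_left A).symm, ← εt'_εt,
    εt_box_of hA, unitElt]

lemma box_unitElt_of_ne {A : B} {p : P} (hA : ¬ (T.IsHOne A ∧ T.ver.tgt (T.hBox.src A) = p)) :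
    (tensorUnit k (TwistedAlg T c)).ρ (box c A) (unitElt c p) = 0 := by
  rw [tensorUnit_ρ, unitElt, incl_srcIdem, box_mul_srcIdem]
  split_ifs with h
  · rw [← T.bot_left] at h
    rw [← εt'_εt, εt_box_of_not (fun h' => hA ⟨h', h⟩), map_zero]
  · rw [map_zero]

lemma hone_unitElt (g : V) :
    (tensorUnit k (TwistedAlg T c)).ρ (box c (T.hBox.one g)) (unitElt c (T.ver.tgt g)) =
      unitElt c (T.ver.src g) := by
  simpa only [T.hBox.src_one] using box_unitElt_of (c := c) (T.isHOne_hone g)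

lemma one_unitElt (p : P) :
    (tensorUnit k (TwistedAlg T c)).ρ (box c (T.hBox.one (T.ver.one p))) (unitElt c p) =
      unitElt c p := by
  simpa only [T.ver.src_one, T.ver.tgt_one] using hone_unitElt (c := c) (T.ver.one p)

lemma one_unitElt_of_ne {p q : P} (h : p ≠ q) :
    (tensorUnit k (TwistedAlg T c)).ρ (box c (T.hBox.one (T.ver.one p))) (unitElt c q) = 0 :=
  box_unitElt_of_ne fun h' => h (by rw [← h'.2, T.hBox.src_one, T.ver.tgt_one])

lemma isConnected_of_simple (h : Simple (tensorUnit k (TwistedAlg T c))) : T.ver.IsConnected := by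
  intro p q
  by_contra hpq
  -- The span of the vectors of all points joined to `q`, invariant because vertical edges compose.
  let W : Submodule k (tensorUnit k (TwistedAlg T c)).V :=
    Submodule.span k {z | ∃ g, T.ver.tgt g = q ∧ unitElt c (T.ver.src g) = z}
  have hW : ∀ a, ∀ z ∈ W, (tensorUnit k (TwistedAlg T c)).ρ a z ∈ W := by
    intro a z hz
    induction a using induction with
    | h0 => rw [map_zero]; exact W.zero_mem
    | hadd a b ha hb => rw [map_add]; exact W.add_mem ha hb
    | hbox r A =>
      rw [map_smul]
      refine W.smul_mem r ?_
      refine Submodule.span_induction (p := fun z _ => (tensorUnit k _).ρ (box c A) z ∈ W)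
        ?_ ?_ ?_ ?_ hz
      · rintro _ ⟨g, hg, rfl⟩
        by_cases hA : T.IsHOne A ∧ T.ver.tgt (T.hBox.src A) = T.ver.src g
        · rw [← hA.2, box_unitElt_of hA.1]
          refine Submodule.subset_span ⟨T.ver.comp (T.hBox.src A) g, ?_, ?_⟩
          · rw [T.ver.tgt_comp _ _ hA.2, hg]
          · rw [T.ver.src_comp _ _ hA.2]
        · rw [box_unitElt_of_ne hA]
          exact W.zero_mem
      · rw [map_zero]; exact W.zero_mem
      · intro x y _ _ hx hy
        rw [map_add]; exact W.add_mem hx hy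
      · intro s x _ hx
        rw [map_smul]; exact W.smul_mem s hx
  rcases ((simple_iff _).mp h).2 W hW with h0 | h0
  · have : unitElt c q ∈ W :=
      Submodule.subset_span ⟨T.ver.one q, T.ver.tgt_one q, by rw [T.ver.src_one]⟩
    rw [h0, Submodule.mem_bot] at this
    exact unitElt_ne_zero q this
  -- The identity of `p` acts as the projection to the coordinate `p`. It kills `W` as no edge joins
  -- `p` to `q`, yet it fixes the vector of `p`.
  · have h1 : W ≤ LinearMap.ker ((tensorUnit k (TwistedAlg T c)).ρ (box c (T.hBox.one (T.ver.one p)))) := by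
      rw [Submodule.span_le]
      rintro _ ⟨g, hg, rfl⟩
      exact one_unitElt_of_ne fun h => hpq ⟨g, h.symm, hg⟩
    have h2 : unitElt c p ∈ W := h0 ▸ Submodule.mem_top
    have h3 := LinearMap.mem_ker.mp (h1 h2)
    rw [one_unitElt] at h3
    exact unitElt_ne_zero p h3

lemma simple_of_isConnected [Fintype P] (h : T.ver.IsConnected) :
    Simple (tensorUnit k (TwistedAlg T c)) := by
  refine (simple_iff _).mpr ⟨?_, fun W hW => ?_⟩
  · obtain ⟨p⟩ := T.nonempty
    exact ⟨unitElt c p, 0, unitElt_ne_zero p⟩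
  · refine or_iff_not_imp_left.mpr fun h0 => ?_
    obtain ⟨z, hz, hz0⟩ := Submodule.exists_mem_ne_zero_of_ne_bot h0
    have hspan : z ∈ Submodule.span k (Set.range (unitElt c)) := by
      rw [span_unitElt]
      exact Submodule.mem_top
    obtain ⟨r, rfl⟩ := (Submodule.mem_span_range_iff_exists_fun k).mp hspan
    obtain ⟨p, hp⟩ : ∃ p, r p ≠ 0 := by
      by_contra! hr
      exact hz0 (Finset.sum_eq_zero fun p _ => by rw [hr, zero_smul])
    -- Projecting to a coordinate with nonzero coefficient leaves a nonzero multiple of a single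
    -- basis vector; linear independence of the vectors is not needed.
    have h1 := hW (box c (T.hBox.one (T.ver.one p))) _ hz
    rw [map_sum, Finset.sum_eq_single p, map_smul, one_unitElt] at h1
    · have h2 : unitElt c p ∈ W := (W.smul_mem_iff hp).mp h1
      rw [← top_le_iff, ← span_unitElt, Submodule.span_le]
      rintro _ ⟨q, rfl⟩
      -- Arrows act from target to source, so an edge from `q` to `p` carries the vector of `p` to
      -- that of `q`.
      obtain ⟨g, rfl, rfl⟩ := h q p
      rw [← hone_unitElt]
      exact hW _ _ h2
    · intro q _ hq
      rw [map_smul, one_unitElt_of_ne hq.symm, smul_zero]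
    · simp

lemma isMultifusion [Fintype P] [CharZero k] : IsMultifusion k (RepTwisted T c) where
  monoidalPreadditive := inferInstance
  monoidalLinear := inferInstance
  -- The abelian structure was built on the preadditive structure already present, so the two agree
  -- definitionally.
  abelian := ⟨inferInstance, rfl⟩
  semisimple := exists_bicone
  finite_simples := exists_simples
  finiteDimensional_hom := finiteDimensional_hom
  rigid := ⟨inferInstance⟩

end TwistedAlg
end

theorem mainTheorem8 {B H V P k : Type u} [Fintype B] [Fintype H] [Fintype V] [Fintype P]
    [Field k] (T : VacantDoubleGroupoid B H V P) (c : T.Cocycle k) :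
    (Simple (𝟙_ (RepTwisted T c)) ↔ T.ver.IsConnected) ∧
    (CharZero k → IsMultifusion k (RepTwisted T c) ∧
      (IsFusion k (RepTwisted T c) ↔ T.ver.IsConnected)) := by
  have h : Simple (𝟙_ (RepTwisted T c)) ↔ T.ver.IsConnected :=
    ⟨TwistedAlg.isConnected_of_simple, TwistedAlg.simple_of_isConnected⟩
  exact ⟨h, fun _ => ⟨TwistedAlg.isMultifusion, fun hf => h.mp hf.simple_unit,
    fun hc => ⟨TwistedAlg.isMultifusion, h.mpr hc⟩⟩⟩
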